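/- A relational schema $\sigma$ is a finite set of relation names, each with a fixed arity in $\{0,1,2,\dots\}$. A conjunctive query of arity $\alpha\ge 0$ over $\sigma$ is a rule $$Q:\quad (z_1,\dots,z_\alpha)\leftarrow S_1(\bar x_1),\dots,S_n(\bar x_n)\qquad (n>0),$$ where $S_j\in\sigma$, $\bar x_j$ is a tuple of variables whose length is the arity of $S_j$, and each $z_i$ occurs in some $\bar x_j$. Its size is $|Q|=\alpha+n+\sum_{j=1}^n|\bar x_j|$. It is a 2CQ if every relation name equals $S_j$ for at most two indices $j$; $2CQ_{\sigma,\alpha}$ denotes the set of 2CQs of arity $\alpha$ over $\sigma$. Let $\mathcal C$ be an infinite set of constants. An instance $I$ of $\sigma$ is a finite set of facts $R(c_1,\dots,c_a)$ with $R\in\sigma$ of arity $a$ and $c_i\in\mathcal C$. The answer $Q(I)$ is the set of all $(h(z_1),\dots,h(z_\alpha))$ where $h$ maps variables to $\mathcal C$ such that $S_j(h(\bar x_j))\in I$ for all $j$. Write $Q_1\sqsubseteq Q_2$ if $Q_1(I)\subseteq Q_2(I)$ for every instance $I$, and $Q_1\equiv Q_2$ if $Q_1\sqsubseteq Q_2$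 and $Q_2\sqsubseteq Q_1$. For $Q_1,Q_2\in 2CQ_{\sigma,\alpha}$, $Q_1$ is maximally contained in $Q_2$, written $Q_1\sqsubseteq_m Q_2$, if $Q_1\sqsubseteq Q_2$, $Q_2\not\sqsubseteq Q_1$, and every $Q\in 2CQ_{\sigma,\alpha}$ with $Q_1\sqsubseteq Q\sqsubseteq Q_2$ satisfies $Q_1\equiv Q$ or $Q\equiv Q_2$. **Proposition.** Given a relational schema $\sigma$ and queries $Q_1,Q_2\in 2CQ_{\sigma,\alpha}$, deciding $Q_1\sqsubseteq_m Q_2$ can be done in time polynomial in the sizes of $Q_1$ and $Q_2$. More precisely, there are a single program for a unit-cost random access machine (with addition and truncated subtraction of natural numbers) and a polynomial $f$ such that for all $\sigma$, all $\alpha$ and all $Q_1,Q_2\in 2CQ_{\sigma,\alpha}$, the program, given $Q_1$ and $Q_2$ (as sequences of numbers that list heads and atoms, with variables and relation names represented by natural numbers), halts within $f(|Q_1|+|Q_2|)$ steps and outputs $1$ if $Q_1\sqsubseteq_m Q_2$ and $0$ otherwise. -/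

import Mathlib

/-! ### Relational schemas, instances and conjunctive queries -/

/-- A relational schema: finitely many relation names `0, …, numRel - 1`, each with a fixed
arity (which may be `0`). -/
structure Schema where
  numRel : ℕ
  arity : Fin numRel → ℕ

/-- An expression `R(c₁, …, c_a)` with `R` a relation name of `σ`, `a` its arity and the `cᵢ`
taken from `D`.  For `D` the set of constants this is a `σ`-fact, for `D` the set of variables
it is an atom. -/
structure RelAtom (σ : Schema) (D : Type*) where
  rel : Fin σ.numRel
  args : Fin (σ.arity rel) → D

/-- Apply a function to all arguments of a fact or atom. -/
def RelAtom.map {σ : Schema} {D E : Type*} (h : D → E) (A : RelAtom σ D) : RelAtom σ E :=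
  ⟨A.rel, fun i => h (A.args i)⟩

/-- A conjunctive query of arity `α` over `σ`, i.e. a rule
`(z₁, …, z_α) ← S₁(x̄₁), …, S_n(x̄_n)` with `n > 0`, in which every head variable occurs
in the body.  The variables are the natural numbers. -/
structure CQ (σ : Schema) (α : ℕ) where
  head : Fin α → ℕ
  body : List (RelAtom σ ℕ)
  body_ne : body ≠ []
  safe : ∀ i, ∃ A ∈ body, ∃ j, A.args j = head i

namespace CQ

variable {σ : Schema} {α : ℕ}

/-- `h` is an embedding of `Q` in the instance `I` (a finite set of facts). -/
def IsEmbedding {C : Type*} (Q : CQ σ α) (I : Finset (RelAtom σ C)) (h : ℕ → C) : Prop :=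
  ∀ A ∈ Q.body, A.map h ∈ I

/-- The set of answers of `Q` on the instance `I`. -/
def answers {C : Type*} (Q : CQ σ α) (I : Finset (RelAtom σ C)) : Set (Fin α → C) :=
  {c | ∃ h : ℕ → C, Q.IsEmbedding I h ∧ c = fun i => h (Q.head i)}

/-- Containment: `Q₁ ⊑ Q₂`, with respect to instances over the domain `C` of constants. -/
def Contained (C : Type*) (Q₁ Q₂ : CQ σ α) : Prop :=
  ∀ I : Finset (RelAtom σ C), Q₁.answers I ⊆ Q₂.answers I

/-- Equivalence: `Q₁ ≡ Q₂`. -/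
def Equivalent (C : Type*) (Q₁ Q₂ : CQ σ α) : Prop :=
  Contained C Q₁ Q₂ ∧ Contained C Q₂ Q₁

/-- `Q` is a 2CQ: every relation name occurs in at most two body atoms. -/
def IsTwoCQ (Q : CQ σ α) : Prop :=
  ∀ R : Fin σ.numRel, (Q.body.map RelAtom.rel).count R ≤ 2

/-- Maximal containment `Q₁ ⊑ₘ Q₂` in the class of 2CQs: `Q₁` is contained in `Q₂`, `Q₂` is not
contained in `Q₁`, and every 2CQ between them is equivalent to one of them. -/
def MaxContained (C : Type*) (Q₁ Q₂ : CQ σ α) : Prop :=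
  Contained C Q₁ Q₂ ∧ ¬ Contained C Q₂ Q₁ ∧
    ∀ Q : CQ σ α, Q.IsTwoCQ → Contained C Q₁ Q → Contained C Q Q₂ →
      Equivalent C Q₁ Q ∨ Equivalent C Q Q₂

/-- The size of a query: its arity, plus the number of atoms, plus the sum of their arities. -/
def size (Q : CQ σ α) : ℕ :=
  α + Q.body.length + (Q.body.map fun A => σ.arity A.rel).sum

/-- A query written as a sequence of numbers: the arity, the number of atoms, the head, and then
for each atom its relation name, its arity and its variables. -/
def encode (Q : CQ σ α) : List ℕ :=
  [α, Q.body.length] ++ List.ofFn Q.head ++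
    (Q.body.map fun A => [A.rel.val, σ.arity A.rel] ++ List.ofFn A.args).flatten

end CQ

/-! ### Random access machines

The model of computation: structured programs for a random access machine whose memory consists
of number variables and number arrays, with addition and (truncated) subtraction as its only
arithmetic, in the unit-cost measure.  A program is a finite text, hence it can name only finitely
many variables and arrays. -/

/-- Arithmetic expressions. -/
inductive RamExpr where
  | lit (n : ℕ)
  | var (x : ℕ)
  | get (a : ℕ) (i : RamExpr)
  | add (e f : RamExpr)
  | sub (e f : RamExpr)

/-- Programs. The tests of `ite` and `loop` succeed if the value of the expression is not `0`. -/
inductive RamProg where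
  | skip
  | assign (x : ℕ) (e : RamExpr)
  | store (a : ℕ) (i e : RamExpr)
  | seq (p q : RamProg)
  | ite (e : RamExpr) (p q : RamProg)
  | loop (e : RamExpr) (p : RamProg)

/-- The contents of the memory: `vars x` is the value of the variable `x`, and `arrs a i` is the
entry with index `i` of the array `a`. -/
structure RamState where
  vars : ℕ → ℕ
  arrs : ℕ → ℕ → ℕ

/-- The initial state: the input is in array `0`, and everything else is `0`. -/
def RamState.init (input : List ℕ) : RamState where
  vars := fun _ => 0
  arrs := fun a i => if a = 0 then input.getD i 0 else 0

/-- The state after an assignment to a variable. -/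
def RamState.setVar (s : RamState) (x v : ℕ) : RamState :=
  { s with vars := Function.update s.vars x v }

/-- The state after an assignment to an array entry. -/
def RamState.setArr (s : RamState) (a i v : ℕ) : RamState :=
  { s with arrs := Function.update s.arrs a (Function.update (s.arrs a) i v) }

/-- The value of an expression. -/
def RamExpr.value (s : RamState) : RamExpr → ℕ
  | lit n => n
  | var x => s.vars x
  | get a i => s.arrs a (i.value s)
  | add e f => e.value s + f.value s
  | sub e f => e.value s - f.value s

/-- The time to evaluate an expression: one step for each operation in it. -/
def RamExpr.cost : RamExpr → ℕ
  | lit _ => 1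
  | var _ => 1
  | get _ i => i.cost + 1
  | add e f => e.cost + f.cost + 1
  | sub e f => e.cost + f.cost + 1

/-- `Runs p s t s'`: the program `p`, started in state `s`, halts after exactly `t` steps in
state `s'`. -/
inductive RamProg.Runs : RamProg → RamState → ℕ → RamState → Prop
  | skip (s : RamState) : Runs .skip s 1 s
  | assign (x : ℕ) (e : RamExpr) (s : RamState) :
      Runs (.assign x e) s (e.cost + 1) (s.setVar x (e.value s))
  | store (a : ℕ) (i e : RamExpr) (s : RamState) :
      Runs (.store a i e) s (i.cost + e.cost + 1) (s.setArr a (i.value s) (e.value s))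
  | seq {p q : RamProg} {s s' s'' : RamState} {t t' : ℕ} :
      Runs p s t s' → Runs q s' t' s'' → Runs (.seq p q) s (t + t') s''
  | ite_true {e : RamExpr} {p q : RamProg} {s s' : RamState} {t : ℕ} :
      e.value s ≠ 0 → Runs p s t s' → Runs (.ite e p q) s (e.cost + 1 + t) s'
  | ite_false {e : RamExpr} {p q : RamProg} {s s' : RamState} {t : ℕ} :
      e.value s = 0 → Runs q s t s' → Runs (.ite e p q) s (e.cost + 1 + t) s'
  | loop_true {e : RamExpr} {p : RamProg} {s s' s'' : RamState} {t t' : ℕ} :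
      e.value s ≠ 0 → Runs p s t s' → Runs (.loop e p) s' t' s'' →
        Runs (.loop e p) s (e.cost + 1 + t + t') s''
  | loop_false {e : RamExpr} {p : RamProg} {s : RamState} :
      e.value s = 0 → Runs (.loop e p) s (e.cost + 1) s

/-- Programs are deterministic: final state and number of steps are determined by the start. -/
theorem RamProg.Runs.unique {p : RamProg} {s s₁ s₂ : RamState} {t₁ t₂ : ℕ}
    (h₁ : p.Runs s t₁ s₁) (h₂ : p.Runs s t₂ s₂) : t₁ = t₂ ∧ s₁ = s₂ := by
  induction h₁ generalizing t₂ s₂ with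
  | skip s => cases h₂; exact ⟨rfl, rfl⟩
  | assign x e s => cases h₂; exact ⟨rfl, rfl⟩
  | store a i e s => cases h₂; exact ⟨rfl, rfl⟩
  | seq _ _ ih ih' =>
    cases h₂ with
    | seq k k' =>
      obtain ⟨rfl, rfl⟩ := ih k
      obtain ⟨rfl, rfl⟩ := ih' k'
      exact ⟨rfl, rfl⟩
  | ite_true he _ ih =>
    cases h₂ with
    | ite_true _ k =>
      obtain ⟨rfl, rfl⟩ := ih k
      exact ⟨rfl, rfl⟩
    | ite_false he' _ => exact absurd he' he
  | ite_false he _ ih =>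
    cases h₂ with
    | ite_true he' _ => exact absurd he he'
    | ite_false _ k =>
      obtain ⟨rfl, rfl⟩ := ih k
      exact ⟨rfl, rfl⟩
  | loop_true he _ _ ih ih' =>
    cases h₂ with
    | loop_true _ k k' =>
      obtain ⟨rfl, rfl⟩ := ih k
      obtain ⟨rfl, rfl⟩ := ih' k'
      exact ⟨rfl, rfl⟩
    | loop_false he' => exact absurd he' he
  | loop_false he =>
    cases h₂ with
    | loop_true he' _ _ => exact absurd he he'
    | loop_false _ => exact ⟨rfl, rfl⟩

/-- On the given input, the program halts within `T` steps, and then the value of variable `0`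
is `1` if `A` holds and `0` if not. -/
def RamProg.AnswersWithin (p : RamProg) (input : List ℕ) (T : ℕ) (A : Prop) : Prop :=
  ∃ (t : ℕ) (s : RamState), p.Runs (RamState.init input) t s ∧ t ≤ T ∧
    (A → s.vars 0 = 1) ∧ (¬ A → s.vars 0 = 0)

/-! ### Queries as sets of atoms, and homomorphisms -/

namespace RelAtom

variable {σ : Schema}

/-! Containment reverses homomorphisms (`CQ.contained_iff`): `Q₁ ⊑ Q₂` holds iff the body of `Q₂`
maps to that of `Q₁` with heads respected. Write `P → Q` for the existence of such a map. Maximal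
containment asks for `Q₂ → Q₁`, no map back, and no 2CQ strictly between the two. Two facts make
this decidable in polynomial time.

Candidates. There is a polynomial family of 2CQs `X` with `Q₂ → X` such that every 2CQ `S` with `Q₂
→ S → Q₁` and not `S → Q₂` receives a map from a member `X` that does not map to `Q₂`. If `S` lies
strictly between, so does `X`, as `X → S → Q₁` and `Q₁ → X` would give `Q₁ → S`. Hence only members
of the family have to be tested (`CQ.MaxContained.passes`, `CQ.maxContained_of_passes`). If `S` has
a relation name missing in `Q₂`, the member is `Q₂` with one atom of that name on fresh variables
(`addFresh`). Otherwise variables of `Q₂` are first identified as long as the result maps to `Q₂`.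
This gives `P` equivalent to `Q₂`, no further identification of which maps to `Q₂` (`Folded`). Each
relation name with a single atom in `P` then gets a second, fresh atom (`ext`), and the members are
the identifications of two variables in this extension. The reason (`Folded.exists_sub`): if `P → S`
identifies two variables of `P`, these will do. If not, the extension maps onto `S`. It also
retracts to `P`. Were all variables with equal images in `S` also identified by the retraction, the
retraction would factor through `S` and give `S → Q₂`. So some `u`, `v` are identified in `S` but
not by the retraction. A map from the extension to `P` is injective on the variables of `P` and is
determined by them through the retraction, so none can identify `u` and `v`.

Homomorphism test. An atom has at most two possible images, so a homomorphism solves a system of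
binary constraints over domains of size two, as in 2-SAT. Atoms are eliminated one by one, with the
constraints on the others updated. With at most two values, a choice that exists for every two of
the other atoms exists for all of them at once (`Tab.exists_rowMap_of_elim`, `Tab.elim_iff_hom`).

Machine. Queries become tables with `W` rows and columns, where `W` is linear in the size. All
computations are loops whose bounds are at most `W ^ 4` and fixed before the loops start. They are
written in a language of for-programs whose compilation comes with a polynomial time bound
(`Pg.comp_runs`). Correctness is a matter of loop invariants (`Pg.homP_spec`, `Pg.foldP_spec`,
`Pg.mainP_ans`). -/

theorem map_map {D E F : Type*} (g : E → F) (h : D → E) (A : RelAtom σ D) :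
    (A.map h).map g = A.map (g ∘ h) := rfl

/-- The `j`-th argument of an atom, `0` beyond the arity. -/
def argN (A : RelAtom σ ℕ) (j : ℕ) : ℕ :=
  if h : j < σ.arity A.rel then A.args ⟨j, h⟩ else 0

theorem argN_fin (A : RelAtom σ ℕ) (j : Fin (σ.arity A.rel)) : A.argN j = A.args j := by
  simp [argN]

/-- Arguments indexed by `ℕ` spare the transport of functions along equalities of arities. -/
theorem ext_argN {A B : RelAtom σ ℕ} (h : A.rel = B.rel)
    (h' : ∀ j < σ.arity A.rel, A.argN j = B.argN j) : A = B := by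
  obtain ⟨R, a⟩ := A
  obtain ⟨R', b⟩ := B
  obtain rfl : R = R' := h
  congr 1
  funext j
  have := h' j j.2
  simpa [argN] using this

theorem argN_map (h : ℕ → ℕ) (A : RelAtom σ ℕ) {j : ℕ} (hj : j < σ.arity A.rel) :
    (A.map h).argN j = h (A.argN j) := by
  simp [argN, hj, map]

theorem map_congr {h k : ℕ → ℕ} {A : RelAtom σ ℕ}
    (H : ∀ j < σ.arity A.rel, h (A.argN j) = k (A.argN j)) : A.map h = A.map k := by
  refine ext_argN rfl fun j hj => ?_
  rw [argN_map h A hj, argN_map k A hj, H j hj]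

/-- The atom with given relation name and arguments. -/
def ofFun (R : Fin σ.numRel) (f : ℕ → ℕ) : RelAtom σ ℕ := ⟨R, fun j => f j⟩

theorem ofFun_argN (R : Fin σ.numRel) (f : ℕ → ℕ) {j : ℕ} (hj : j < σ.arity R) :
    (ofFun R f).argN j = f j := by
  exact dif_pos hj

theorem ofFun_map (R : Fin σ.numRel) (f h : ℕ → ℕ) : (ofFun R f).map h = ofFun R (h ∘ f) := rfl

end RelAtom

/-- A query given by its head and its set of body atoms. -/
structure QS (σ : Schema) (α : ℕ) where
  head : Fin α → ℕ
  atoms : Set (RelAtom σ ℕ)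

namespace QS

variable {σ : Schema} {α : ℕ}

/-- There is a homomorphism from `P` to `Q`. -/
def Hom (P Q : QS σ α) : Prop :=
  ∃ h : ℕ → ℕ, (∀ A ∈ P.atoms, A.map h ∈ Q.atoms) ∧ ∀ i, h (P.head i) = Q.head i

theorem Hom.refl (P : QS σ α) : Hom P P := ⟨id, fun _ h => h, fun _ => rfl⟩

theorem Hom.trans {P Q R : QS σ α} : Hom P Q → Hom Q R → Hom P R := by
  rintro ⟨h, h1, h2⟩ ⟨k, k1, k2⟩
  exact ⟨k ∘ h, fun A hA => k1 _ (h1 A hA), fun i => by simp [h2, k2]⟩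

/-- Apply a substitution of variables. -/
def map (f : ℕ → ℕ) (P : QS σ α) : QS σ α where
  head := fun i => f (P.head i)
  atoms := {B | ∃ A ∈ P.atoms, B = A.map f}

theorem hom_map (f : ℕ → ℕ) (P : QS σ α) : Hom P (P.map f) :=
  ⟨f, fun A hA => ⟨A, hA, rfl⟩, fun _ => rfl⟩

/-- The variables in the body. -/
def vars (P : QS σ α) : Set ℕ :=
  {x | ∃ A ∈ P.atoms, ∃ j < σ.arity A.rel, A.argN j = x}

/-- Every head variable occurs in the body. -/
def Safe (P : QS σ α) : Prop := ∀ i, P.head i ∈ P.vars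

/-- Each relation name has at most two atoms. -/
def Two (P : QS σ α) : Prop :=
  ∀ A ∈ P.atoms, ∀ B ∈ P.atoms, ∀ D ∈ P.atoms, A.rel = B.rel → A.rel = D.rel →
    A = B ∨ A = D ∨ B = D

/-- The conditions under which the head and the set of atoms come from a 2CQ. -/
structure Good (P : QS σ α) : Prop where
  fin : P.atoms.Finite
  ne : P.atoms.Nonempty
  safe : P.Safe
  two : P.Two

theorem mem_vars_map {P : QS σ α} {f : ℕ → ℕ} {x : ℕ} :
    x ∈ (P.map f).vars ↔ ∃ y ∈ P.vars, f y = x := by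
  constructor
  · rintro ⟨_, ⟨A, hA, rfl⟩, j, hj, rfl⟩
    exact ⟨A.argN j, ⟨A, hA, j, hj, rfl⟩, (RelAtom.argN_map f A hj).symm⟩
  · rintro ⟨_, ⟨A, hA, j, hj, rfl⟩, rfl⟩
    exact ⟨A.map f, ⟨A, hA, rfl⟩, j, hj, RelAtom.argN_map _ _ hj⟩

theorem Two.map {P : QS σ α} (h : P.Two) (f : ℕ → ℕ) : (P.map f).Two := by
  rintro _ ⟨A, hA, rfl⟩ _ ⟨B, hB, rfl⟩ _ ⟨D, hD, rfl⟩ h1 h2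
  rcases h A hA B hB D hD h1 h2 with rfl | rfl | rfl <;> simp

theorem Safe.map {P : QS σ α} (h : P.Safe) (f : ℕ → ℕ) : (P.map f).Safe :=
  fun i => mem_vars_map.2 ⟨_, h i, rfl⟩

theorem Good.map {P : QS σ α} (h : P.Good) (f : ℕ → ℕ) : (P.map f).Good where
  fin := by
    refine (h.fin.image fun A => A.map f).subset ?_
    rintro _ ⟨A, hA, rfl⟩
    exact ⟨A, hA, rfl⟩
  ne := by
    obtain ⟨A, hA⟩ := h.ne
    exact ⟨_, A, hA, rfl⟩
  safe := h.safe.map f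
  two := h.two.map f

end QS

/-! ### Containment as reversed homomorphism, and 2CQs as sets of atoms -/

namespace CQ

variable {σ : Schema} {α : ℕ}

/-- Head and set of atoms of a query. -/
def toQS (Q : CQ σ α) : QS σ α := ⟨Q.head, {A | A ∈ Q.body}⟩

/-- Chandra–Merlin. As `C` is infinite, the variables embed in it. The body of `Q₁`, frozen along
this embedding, is an instance on which `Q₂` must give the frozen head, and unfreezing the embedding
of `Q₂` gives the homomorphism. -/
theorem contained_iff (C : Type*) [Infinite C] (Q₁ Q₂ : CQ σ α) :
    Contained C Q₁ Q₂ ↔ Q₂.toQS.Hom Q₁.toQS := by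
  classical
  constructor
  · intro H
    let ι := Infinite.natEmbedding C
    have hinv : ∀ x, Function.invFun ι (ι x) = x :=
      Function.leftInverse_invFun ι.injective
    obtain ⟨k, hk, hk'⟩ := H ((Q₁.body.map (RelAtom.map ι)).toFinset)
      (show (fun i => ι (Q₁.head i)) ∈ _ from ⟨ι, fun A hA => by
        simpa using ⟨A, hA, rfl⟩, rfl⟩)
    refine ⟨Function.invFun ι ∘ k, fun A hA => ?_, fun i => ?_⟩
    · have := hk A hA
      simp only [List.mem_toFinset, List.mem_map] at this
      obtain ⟨B, hB, hBA⟩ := this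
      have e : A.map (Function.invFun ι ∘ k) = B := by
        rw [← RelAtom.map_map, ← hBA]
        simp [RelAtom.map, hinv]
      rw [e]
      exact hB
    · have := congrFun hk' i
      show Function.invFun ι (k (Q₂.head i)) = Q₁.head i
      exact (congrArg (Function.invFun ι) this).symm.trans (hinv _)
  · rintro ⟨h, h1, h2⟩ I _ ⟨g, hg, rfl⟩
    refine ⟨g ∘ h, fun A hA => hg _ (h1 A hA), ?_⟩
    funext i
    exact congrArg g (h2 i).symm

/-- A body may list an atom twice while `QS` keeps only the set, so the count is of distinct atoms:
three of them with one name would exceed the count in the list. -/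
theorem IsTwoCQ.good {Q : CQ σ α} (h : Q.IsTwoCQ) : Q.toQS.Good where
  fin := List.finite_toSet Q.body
  ne := List.exists_mem_of_ne_nil _ Q.body_ne
  safe := by
    intro i
    obtain ⟨A, hA, j, hj⟩ := Q.safe i
    exact ⟨A, hA, j, j.2, by rw [RelAtom.argN_fin, hj]; rfl⟩
  two := by
    classical
    intro A hA B hB D hD h1 h2
    by_contra! hc
    have hsub : ([A, B, D] : List (RelAtom σ ℕ)).Subperm Q.body := by
      refine List.subperm_of_subset ?_ ?_
      · simp [hc]
      · intro x hx
        simp only [List.mem_cons, List.not_mem_nil, or_false] at hx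
        rcases hx with rfl | rfl | rfl <;> assumption
    have h3 := hsub.countP_le fun X => X.rel == A.rel
    simp only [List.countP_cons, ← h1, ← h2, List.countP_nil, beq_self_eq_true, if_true] at h3
    have h4 := h A.rel
    rw [List.count, List.countP_map] at h4
    exact absurd (h3.trans h4) (by decide)

end CQ

namespace QS

variable {σ : Schema} {α : ℕ}

/-- Candidates are built as sets of atoms; this makes them admissible as intermediate queries in
`MaxContained`. -/
theorem Good.exists_twoCQ {P : QS σ α} (h : P.Good) : ∃ Q : CQ σ α, Q.IsTwoCQ ∧ Q.toQS = P := by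
  classical
  refine ⟨⟨P.head, h.fin.toFinset.toList, ?_, ?_⟩, ?_, ?_⟩
  · obtain ⟨A, hA⟩ := h.ne
    exact List.ne_nil_of_mem (a := A) (by simpa using hA)
  · intro i
    obtain ⟨A, hA, j, hj, e⟩ := h.safe i
    exact ⟨A, by simpa using hA, ⟨j, hj⟩, by rw [← e, ← RelAtom.argN_fin]⟩
  · intro R
    show (List.map RelAtom.rel h.fin.toFinset.toList).count R ≤ 2
    rw [List.count, List.countP_map, List.countP_eq_length_filter,
      ← List.toFinset_card_of_nodup ((Finset.nodup_toList _).filter _)]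
    by_contra! hc
    obtain ⟨A, hA, B, hB, D, hD, hAB, hAD, hBD⟩ := Finset.two_lt_card.1 hc
    simp only [List.mem_toFinset, List.mem_filter, Finset.mem_toList, Function.comp_apply,
      beq_iff_eq, Set.Finite.mem_toFinset] at hA hB hD
    rcases h.two A hA.1 B hB.1 D hD.1 (by rw [hA.2, hB.2]) (by rw [hA.2, hD.2]) with e | e | e
    · exact hAB e
    · exact hAD e
    · exact hBD e
  · obtain ⟨hd, S⟩ := P
    simp [CQ.toQS]

end QS

/-! ### The lower covers of a query among the 2CQs -/

namespace QS

variable {σ : Schema} {α : ℕ}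

/-- The substitution that replaces `v` by `u`. -/
def sub (u v z : ℕ) : ℕ := if z = v then u else z

theorem two_mul_sub (u v z : ℕ) : 2 * sub u v z = sub (2 * u) (2 * v) (2 * z) := by
  unfold sub; split_ifs <;> omega

theorem apply_sub {g : ℕ → ℕ} {u v : ℕ} (h : g u = g v) (z : ℕ) : g (sub u v z) = g z := by
  unfold sub; split_ifs with hz
  · rw [h, hz]
  · rfl

/-- The universal property of an identification: a map with equal values at `u` and `v` factors
through it. -/
theorem hom_map_sub {P S : QS σ α} {g : ℕ → ℕ} {u v : ℕ}
    (hg : ∀ A ∈ P.atoms, A.map g ∈ S.atoms) (hg' : ∀ i, g (P.head i) = S.head i)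
    (h : g u = g v) : Hom (P.map (sub u v)) S := by
  refine ⟨g, ?_, fun i => (apply_sub h _).trans (hg' i)⟩
  rintro _ ⟨A, hA, rfl⟩
  have e : (A.map (sub u v)).map g = A.map g := by
    rw [RelAtom.map_map]
    exact RelAtom.map_congr fun j _ => apply_sub h _
  rw [e]
  exact hg A hA

/-- `P` is equivalent to `P₂`, and no quotient of `P` is. -/
structure Folded (P P₂ : QS σ α) : Prop where
  forth : Hom P₂ P
  back : Hom P P₂
  safe : P.Safe
  fold : ∀ x ∈ P.vars, ∀ y ∈ P.vars, x ≠ y → ¬ Hom (P.map (sub x y)) P₂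

/-- `A` is the only atom of `P` with its relation name. -/
def Single (P : QS σ α) (A : RelAtom σ ℕ) : Prop :=
  A ∈ P.atoms ∧ ∀ B ∈ P.atoms, B.rel = A.rel → B = A

/-- `P`, with variables doubled, together with a second atom with fresh variables for each
relation name that has a single atom. -/
def ext (P : QS σ α) (φ : RelAtom σ ℕ → ℕ → ℕ) : QS σ α where
  head := fun i => 2 * P.head i
  atoms := {B | (∃ A ∈ P.atoms, B = A.map (2 * ·)) ∨
    ∃ A, P.Single A ∧ B = RelAtom.ofFun A.rel fun j => 2 * φ A j + 1}

/-- `P`, with variables doubled, together with an atom of relation name `R` with fresh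
variables. -/
def addFresh (P : QS σ α) (R : Fin σ.numRel) (φ : ℕ → ℕ) : QS σ α where
  head := fun i => 2 * P.head i
  atoms := {B | (∃ A ∈ P.atoms, B = A.map (2 * ·)) ∨
    B = RelAtom.ofFun R fun j => 2 * φ j + 1}

/-- Distinct positions in fresh atoms get distinct numbers. -/
def FreshNum (P : QS σ α) (φ : RelAtom σ ℕ → ℕ → ℕ) : Prop :=
  ∀ A j A' j', P.Single A → j < σ.arity A.rel → P.Single A' → j' < σ.arity A'.rel →
    φ A j = φ A' j' → A = A' ∧ j = j'

theorem hom_ext (P : QS σ α) (φ : RelAtom σ ℕ → ℕ → ℕ) : Hom P (P.ext φ) :=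
  ⟨(2 * ·), fun A hA => Or.inl ⟨A, hA, rfl⟩, fun _ => rfl⟩

theorem hom_addFresh (P : QS σ α) (R : Fin σ.numRel) (φ : ℕ → ℕ) : Hom P (P.addFresh R φ) :=
  ⟨(2 * ·), fun A hA => Or.inl ⟨A, hA, rfl⟩, fun _ => rfl⟩

/-- Old variables are even and fresh ones odd, and by `FreshNum` a fresh variable belongs to one
position only, so values on both kinds can be prescribed independently. -/
theorem FreshNum.exists_map {P : QS σ α} {φ : RelAtom σ ℕ → ℕ → ℕ} (hφ : P.FreshNum φ)
    (g : ℕ → ℕ) (T : RelAtom σ ℕ → RelAtom σ ℕ) :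
    ∃ g' : ℕ → ℕ, (∀ x, g' (2 * x) = g x) ∧
      ∀ A, P.Single A → ∀ j < σ.arity A.rel, g' (2 * φ A j + 1) = (T A).argN j := by
  classical
  refine ⟨fun y => if y % 2 = 0 then g (y / 2) else
    if h : ∃ q : RelAtom σ ℕ × ℕ, P.Single q.1 ∧ q.2 < σ.arity q.1.rel ∧ φ q.1 q.2 = y / 2
    then (T h.choose.1).argN h.choose.2 else 0, fun x => ?_, fun A hA j hj => ?_⟩
  · simp
  · have e1 : (2 * φ A j + 1) % 2 ≠ 0 := by omega
    have e2 : (2 * φ A j + 1) / 2 = φ A j := by omega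
    have h : ∃ q : RelAtom σ ℕ × ℕ, P.Single q.1 ∧ q.2 < σ.arity q.1.rel ∧
        φ q.1 q.2 = (2 * φ A j + 1) / 2 := ⟨(A, j), hA, hj, e2.symm⟩
    simp only [if_neg e1, dif_pos h]
    obtain ⟨h1, h2, h3⟩ := h.choose_spec
    obtain ⟨h4, h5⟩ := hφ _ _ _ _ h1 h2 hA hj (h3.trans e2)
    rw [h4, h5]

/-- Used with `T` choosing second atoms of `S`, and with `T = id`, which yields the retraction to
`P`. -/
theorem ext_hom_of_map {P S : QS σ α} {φ : RelAtom σ ℕ → ℕ → ℕ} {g g' : ℕ → ℕ}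
    {T : RelAtom σ ℕ → RelAtom σ ℕ} (hg : ∀ A ∈ P.atoms, A.map g ∈ S.atoms)
    (hT : ∀ A, P.Single A → T A ∈ S.atoms ∧ (T A).rel = A.rel)
    (h1 : ∀ x, g' (2 * x) = g x)
    (h2 : ∀ A, P.Single A → ∀ j < σ.arity A.rel, g' (2 * φ A j + 1) = (T A).argN j) :
    (∀ A ∈ P.atoms, (A.map (2 * ·)).map g' = A.map g) ∧
    (∀ A, P.Single A → (RelAtom.ofFun A.rel fun j => 2 * φ A j + 1).map g' = T A) ∧
    ∀ B ∈ (P.ext φ).atoms, B.map g' ∈ S.atoms := by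
  have e1 : ∀ A ∈ P.atoms, (A.map (2 * ·)).map g' = A.map g := by
    intro A _
    rw [RelAtom.map_map]
    exact RelAtom.map_congr fun j _ => h1 _
  have e2 : ∀ A, P.Single A → (RelAtom.ofFun A.rel fun j => 2 * φ A j + 1).map g' = T A := by
    intro A hA
    rw [RelAtom.ofFun_map]
    refine RelAtom.ext_argN (hT A hA).2.symm fun j hj => ?_
    exact (RelAtom.ofFun_argN A.rel _ hj).trans (h2 A hA j hj)
  refine ⟨e1, e2, ?_⟩
  rintro B (⟨A, hA, rfl⟩ | ⟨A, hA, rfl⟩)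
  · rw [e1 A hA]
    exact hg A hA
  · rw [e2 A hA]
    exact (hT A hA).1

theorem mem_vars_of_hom {P S : QS σ α} {g : ℕ → ℕ} (hg : ∀ A ∈ P.atoms, A.map g ∈ S.atoms)
    {x : ℕ} (hx : x ∈ P.vars) : g x ∈ S.vars := by
  obtain ⟨A, hA, j, hj, rfl⟩ := hx
  exact ⟨A.map g, hg A hA, j, hj, RelAtom.argN_map g A hj⟩

theorem Safe.ext {P : QS σ α} (h : P.Safe) (φ : RelAtom σ ℕ → ℕ → ℕ) : (P.ext φ).Safe := by
  intro i
  exact mem_vars_of_hom (S := P.ext φ) (g := (2 * ·)) (fun A hA => Or.inl ⟨A, hA, rfl⟩) (h i)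

/-- The identifications of two variables in `P.ext φ` reach every query strictly below `P₂` with
the same relation names. -/
theorem Folded.exists_sub {P P₂ S : QS σ α} {φ : RelAtom σ ℕ → ℕ → ℕ} (hP : Folded P P₂)
    (hφ : P.FreshNum φ) (hS : S.Two) (hPS : Hom P₂ S) (hSP : ¬ Hom S P₂)
    (hrel : ∀ B ∈ S.atoms, ∃ A ∈ P.atoms, A.rel = B.rel) :
    ∃ u ∈ (P.ext φ).vars, ∃ v ∈ (P.ext φ).vars,
      Hom ((P.ext φ).map (sub u v)) S ∧ ¬ Hom ((P.ext φ).map (sub u v)) P₂ := by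
  classical
  obtain ⟨g, hg, hgh⟩ := hP.back.trans hPS
  -- A fresh atom is sent to the atom of `S` with its name that `g` misses, if there is one, so that
  -- `S` gets covered.
  let T : RelAtom σ ℕ → RelAtom σ ℕ := fun A =>
    if h : ∃ B ∈ S.atoms, B.rel = A.rel ∧ B ≠ A.map g then h.choose else A.map g
  have hT : ∀ A, P.Single A → T A ∈ S.atoms ∧ (T A).rel = A.rel := by
    intro A hA
    by_cases h : ∃ B ∈ S.atoms, B.rel = A.rel ∧ B ≠ A.map g
    · simp only [T, dif_pos h]
      exact ⟨h.choose_spec.1, h.choose_spec.2.1⟩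
    · simp only [T, dif_neg h]
      exact ⟨hg A hA.1, rfl⟩
  obtain ⟨g', hg1, hg2⟩ := hφ.exists_map g T
  obtain ⟨hg3, hg4, hg5⟩ := ext_hom_of_map hg hT hg1 hg2
  have hg6 : ∀ i, g' ((P.ext φ).head i) = S.head i := fun i => (hg1 _).trans (hgh i)
  by_cases hinj : ∃ x ∈ P.vars, ∃ y ∈ P.vars, x ≠ y ∧ g x = g y
  · obtain ⟨x, hx, y, hy, hxy, hgxy⟩ := hinj
    have hd : ∀ A ∈ P.atoms, A.map (2 * ·) ∈ (P.ext φ).atoms := fun A hA => Or.inl ⟨A, hA, rfl⟩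
    refine ⟨2 * x, mem_vars_of_hom hd hx, 2 * y, mem_vars_of_hom hd hy,
      hom_map_sub hg5 hg6 (by rw [hg1, hg1, hgxy]), fun hc => hP.fold x hx y hy hxy ?_⟩
    refine Hom.trans ⟨(2 * ·), ?_, ?_⟩ hc
    · rintro _ ⟨A, hA, rfl⟩
      refine ⟨_, hd A hA, ?_⟩
      rw [RelAtom.map_map, RelAtom.map_map]
      exact RelAtom.map_congr fun j _ => two_mul_sub x y _
    · exact fun i => two_mul_sub x y _
  push Not at hinj
  -- `r` retracts the extension to `P`, sending each fresh atom onto the atom it doubles.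
  obtain ⟨r, hr1, hr2⟩ := hφ.exists_map id id
  have hid : ∀ A ∈ P.atoms, A.map id ∈ P.atoms := fun A hA => hA
  obtain ⟨hr3, hr4, hr5⟩ := ext_hom_of_map hid (fun A hA => ⟨hA.1, rfl⟩) hr1 hr2
  -- By now `g` is injective on the variables of `P`. Two atoms of `P` with a common name have two
  -- different images, which by `hS` are all the atoms of `S` with that name.
  have hsurj : ∀ B ∈ S.atoms, ∃ D ∈ (P.ext φ).atoms, D.map g' = B := by
    intro B hB
    obtain ⟨A, hA, hAB⟩ := hrel B hB
    by_cases h1 : B = A.map g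
    · exact ⟨_, Or.inl ⟨A, hA, rfl⟩, (hg3 A hA).trans h1.symm⟩
    by_cases h2 : P.Single A
    · refine ⟨_, Or.inr ⟨A, h2, rfl⟩, (hg4 A h2).trans ?_⟩
      have h : ∃ B ∈ S.atoms, B.rel = A.rel ∧ B ≠ A.map g := ⟨B, hB, hAB.symm, h1⟩
      simp only [T, dif_pos h]
      obtain ⟨k1, k2, k3⟩ := h.choose_spec
      rcases hS _ k1 _ hB _ (hg A hA) (k2.trans hAB) k2 with e | e | e
      · exact e
      · exact absurd e k3
      · exact absurd e h1
    · simp only [Single, hA, true_and] at h2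
      push Not at h2
      obtain ⟨A', hA', hr, hne⟩ := h2
      refine ⟨_, Or.inl ⟨A', hA', rfl⟩, (hg3 A' hA').trans ?_⟩
      rcases hS _ (hg A' hA') _ hB _ (hg A hA) (hr.trans hAB) hr with e | e | e
      · exact e
      · refine absurd (RelAtom.ext_argN hr fun j hj => ?_) hne
        by_contra hc
        refine hinj _ ⟨A', hA', j, hj, rfl⟩ _ ⟨A, hA, j, hr ▸ hj, rfl⟩ hc ?_
        rw [← RelAtom.argN_map g A' hj, ← RelAtom.argN_map g A (hr ▸ hj), e]
      · exact absurd e h1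
  -- If `g'` identified only what `r` identifies, then `r` would factor through `g'`, which is onto,
  -- and give a map from `S` to `P` and on to `P₂`.
  obtain ⟨u, hu, v, hv, huv, hruv⟩ : ∃ u ∈ (P.ext φ).vars, ∃ v ∈ (P.ext φ).vars,
      g' u = g' v ∧ r u ≠ r v := by
    by_contra! hc
    let k : ℕ → ℕ := fun z => if h : ∃ u ∈ (P.ext φ).vars, g' u = z then r h.choose else 0
    have hk : ∀ u ∈ (P.ext φ).vars, k (g' u) = r u := by
      intro u hu
      have h : ∃ w ∈ (P.ext φ).vars, g' w = g' u := ⟨u, hu, rfl⟩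
      simp only [k, dif_pos h]
      exact hc _ h.choose_spec.1 _ hu h.choose_spec.2
    refine hSP (Hom.trans ⟨k, ?_, fun i => ?_⟩ hP.back)
    · intro B hB
      obtain ⟨D, hD, rfl⟩ := hsurj B hB
      have e : (D.map g').map k = D.map r := by
        rw [RelAtom.map_map]
        exact RelAtom.map_congr fun j hj => hk _ ⟨D, hD, j, hj, rfl⟩
      rw [e]
      exact hr5 D hD
    · rw [← hg6, hk _ (hP.safe.ext φ i)]
      exact hr1 _
  refine ⟨u, hu, v, hv, hom_map_sub hg5 hg6 huv, fun hc => hruv ?_⟩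
  -- A map from the quotient amounts to a map `f'` from the extension to `P` with equal values at
  -- `u` and `v`; on `P` it is injective because `P` is folded.
  obtain ⟨f, hf, hfh⟩ := hc.trans hP.forth
  let f' : ℕ → ℕ := f ∘ sub u v
  have hf1 : ∀ D ∈ (P.ext φ).atoms, D.map f' ∈ P.atoms := fun D hD => hf _ ⟨D, hD, rfl⟩
  have hf2 : f' u = f' v := by
    simp only [f', Function.comp_apply, sub, if_true]
    split_ifs <;> rfl
  have he1 : ∀ A ∈ P.atoms, A.map (fun x => f' (2 * x)) ∈ P.atoms :=
    fun A hA => hf1 _ (Or.inl ⟨A, hA, rfl⟩)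
  have he2 : ∀ x ∈ P.vars, ∀ y ∈ P.vars, f' (2 * x) = f' (2 * y) → x = y := by
    intro x hx y hy hxy
    by_contra hne
    exact hP.fold x hx y hy hne
      ((hom_map_sub (g := fun x => f' (2 * x)) he1 (fun i => hfh i) hxy).trans hP.back)
  -- A single atom `A` and its fresh double both land on `A`, the only atom with that name, so `f'`
  -- takes equal values at corresponding positions.
  have hfr : ∀ w ∈ (P.ext φ).vars, f' w = f' (2 * r w) := by
    rintro w ⟨D, ⟨A, hA, rfl⟩ | ⟨A, hA, rfl⟩, j, hj, rfl⟩
    · rw [RelAtom.argN_map _ A hj, hr1, id]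
    · have e0 : (RelAtom.ofFun A.rel fun j => 2 * φ A j + 1).argN j = 2 * φ A j + 1 :=
        RelAtom.ofFun_argN A.rel _ hj
      rw [e0, hr2 A hA j hj, id]
      have e1 := hA.2 _ (hf1 _ (Or.inr ⟨A, hA, rfl⟩)) rfl
      have e2 := hA.2 _ (he1 A hA.1) rfl
      have e3 := congrArg (RelAtom.argN · j) e1
      have e4 := congrArg (RelAtom.argN · j) e2
      rw [RelAtom.argN_map _ A hj] at e4
      rw [RelAtom.argN_map _ (RelAtom.ofFun A.rel fun j => 2 * φ A j + 1) hj, e0] at e3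
      rw [e3, e4]
  refine he2 _ (mem_vars_of_hom hr5 hu) _ (mem_vars_of_hom hr5 hv) ?_
  rw [← hfr u hu, ← hfr v hv, hf2]

/-- The variables of the new atom occur once each and nowhere else, so they can take the arguments
of any atom with the same name. -/
theorem addFresh_hom {P S : QS σ α} {R : Fin σ.numRel} {φ : ℕ → ℕ}
    (hφ : ∀ i < σ.arity R, ∀ j < σ.arity R, φ i = φ j → i = j) (h : Hom P S)
    {B : RelAtom σ ℕ} (hB : B ∈ S.atoms) (hR : B.rel = R) : Hom (P.addFresh R φ) S := by
  classical
  obtain ⟨g, hg, hgh⟩ := h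
  subst hR
  let g' : ℕ → ℕ := fun y => if y % 2 = 0 then g (y / 2) else
    if h : ∃ j < σ.arity B.rel, φ j = y / 2 then B.argN h.choose else 0
  have hg1 : ∀ x, g' (2 * x) = g x := fun x => by simp [g']
  refine ⟨g', ?_, fun i => (hg1 _).trans (hgh i)⟩
  rintro D (⟨A, hA, rfl⟩ | rfl)
  · have e : (A.map (2 * ·)).map g' = A.map g := by
      rw [RelAtom.map_map]
      exact RelAtom.map_congr fun j _ => hg1 _
    rw [e]
    exact hg A hA
  · have e : (RelAtom.ofFun B.rel fun j => 2 * φ j + 1).map g' = B := by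
      rw [RelAtom.ofFun_map]
      refine RelAtom.ext_argN rfl fun j hj => ?_
      refine (RelAtom.ofFun_argN B.rel _ hj).trans ?_
      have e1 : (2 * φ j + 1) % 2 ≠ 0 := by omega
      have e2 : (2 * φ j + 1) / 2 = φ j := by omega
      have h : ∃ i < σ.arity B.rel, φ i = (2 * φ j + 1) / 2 := ⟨j, hj, e2.symm⟩
      simp only [Function.comp_apply, g', if_neg e1, dif_pos h]
      rw [hφ _ h.choose_spec.1 _ hj (h.choose_spec.2.trans e2)]
    rw [e]
    exact hB

theorem not_addFresh_hom {P : QS σ α} {R : Fin σ.numRel} {φ : ℕ → ℕ}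
    (h : ∀ A ∈ P.atoms, A.rel ≠ R) : ¬ Hom (P.addFresh R φ) P := by
  rintro ⟨g, hg, -⟩
  exact h _ (hg _ (Or.inr rfl)) rfl

/-- `X` is not strictly above `P₁` while being not above `P₂`. -/
def Passes (P₁ P₂ X : QS σ α) : Prop := ¬ (Hom X P₁ ∧ ¬ Hom P₁ X ∧ ¬ Hom X P₂)

end QS

/-! ### Maximal containment in terms of the candidates -/

namespace CQ

open QS

variable {σ : Schema} {α : ℕ} {C : Type*} [Infinite C] {Q₁ Q₂ : CQ σ α}

/-- Necessity: a candidate strictly above `Q₁` and not above `Q₂` would itself be an intermediate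
query. -/
theorem MaxContained.passes (h : MaxContained C Q₁ Q₂) {X : QS σ α} (hX : X.Good)
    (h2 : Hom Q₂.toQS X) : Passes Q₁.toQS Q₂.toQS X := by
  rintro ⟨h3, h4, h5⟩
  obtain ⟨Q, hQ, rfl⟩ := hX.exists_twoCQ
  rcases h.2.2 Q hQ ((contained_iff C _ _).2 h3) ((contained_iff C _ _).2 h2) with e | e
  · exact h4 ((contained_iff C _ _).1 e.2)
  · exact h5 ((contained_iff C _ _).1 e.2)

/-- Sufficiency: an intermediate `Q` not equivalent to `Q₂` receives a map from a candidate `X` that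
does not map to `Q₂`. As `X → Q → Q₁`, passing the test forces `Q₁ → X → Q`. -/
theorem maxContained_of_passes (h21 : Hom Q₂.toQS Q₁.toQS) (h12 : ¬ Hom Q₁.toQS Q₂.toQS)
    {P : QS σ α} (hP : Folded P Q₂.toQS) {φ : RelAtom σ ℕ → ℕ → ℕ} (hφ : P.FreshNum φ)
    (hE : ∀ u ∈ (P.ext φ).vars, ∀ v ∈ (P.ext φ).vars,
      Passes Q₁.toQS Q₂.toQS ((P.ext φ).map (sub u v)))
    (hR : ∀ B ∈ Q₁.toQS.atoms, (∀ A ∈ Q₂.toQS.atoms, A.rel ≠ B.rel) →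
      ∃ ψ : ℕ → ℕ, (∀ i < σ.arity B.rel, ∀ j < σ.arity B.rel, ψ i = ψ j → i = j) ∧
        Passes Q₁.toQS Q₂.toQS (Q₂.toQS.addFresh B.rel ψ)) :
    MaxContained C Q₁ Q₂ := by
  simp only [MaxContained, Equivalent, contained_iff C]
  refine ⟨h21, h12, fun Q hQ h1 h2 => ?_⟩
  by_cases h3 : Hom Q.toQS Q₂.toQS
  · exact Or.inr ⟨h2, h3⟩
  refine Or.inl ⟨h1, ?_⟩
  suffices ∃ X : QS σ α, Passes Q₁.toQS Q₂.toQS X ∧ Hom X Q.toQS ∧ ¬ Hom X Q₂.toQS by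
    obtain ⟨X, hX, k1, k2⟩ := this
    by_contra hc
    exact hX ⟨k1.trans h1, fun k => hc (k.trans k1), k2⟩
  -- A name in `Q` that is missing in `Q₂` occurs in `Q₁`, because `Q → Q₁`; so only names of atoms
  -- of `Q₁` have to be tried for fresh atoms.
  by_cases hrel : ∀ B ∈ Q.toQS.atoms, ∃ A ∈ Q₂.toQS.atoms, A.rel = B.rel
  · obtain ⟨u, hu, v, hv, k1, k2⟩ := hP.exists_sub hφ hQ.good.two h2 h3 fun B hB => by
      obtain ⟨A, hA, hAB⟩ := hrel B hB
      obtain ⟨g, hg, -⟩ := hP.forth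
      exact ⟨A.map g, hg A hA, hAB⟩
    exact ⟨_, hE u hu v hv, k1, k2⟩
  · push Not at hrel
    obtain ⟨B, hB, hBr⟩ := hrel
    obtain ⟨g, hg, -⟩ := id h1
    obtain ⟨ψ, hψ, hp⟩ := hR _ (hg B hB) hBr
    exact ⟨_, hp, addFresh_hom hψ h2 hB rfl, not_addFresh_hom hBr⟩

end CQ

/-! ### Tables, and the homomorphism test by elimination of rows -/

/-- A table: row `i` has relation number `rel i` (`0` for an unused row), arity `ar i` and, for
rows of width `W`, the argument `arg (i * W + c)` in column `c`. -/
structure Tab where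
  rel : ℕ → ℕ
  ar : ℕ → ℕ
  arg : ℕ → ℕ

namespace Tab

variable {σ : Schema} {α : ℕ}

/-- Row `i` of `T` holds the atom `A`. -/
structure RowIs (W : ℕ) (T : Tab) (i : ℕ) (A : RelAtom σ ℕ) : Prop where
  rel : T.rel i = A.rel + 2
  ar : T.ar i = σ.arity A.rel
  arg : ∀ c < σ.arity A.rel, T.arg (i * W + c) = A.argN c

/-- `T` holds the query `Q`: the head in row `0`, the atoms in the rows `1, …, W - 1`. -/
structure Rep (W : ℕ) (T : Tab) (Q : QS σ α) : Prop where
  pos : 0 < W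
  rel0 : T.rel 0 = 1
  ar0 : T.ar 0 = α
  arg0 : ∀ c : Fin α, T.arg c = Q.head c
  atoms : ∀ A, A ∈ Q.atoms ↔ ∃ i, 0 < i ∧ i < W ∧ T.RowIs W i A
  live : ∀ i, 0 < i → i < W → T.rel i ≠ 0 → ∃ A : RelAtom σ ℕ, T.RowIs W i A
  wide : ∀ i < W, T.rel i ≠ 0 → T.ar i ≤ W

/-- No three rows have the same relation number. -/
def TwoRows (W : ℕ) (T : Tab) : Prop :=
  ∀ i < W, ∀ j < W, ∀ k < W, T.rel i = T.rel j → T.rel i = T.rel k → T.rel i ≠ 0 →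
    i = j ∨ i = k ∨ j = k

theorem RowIs.unique {W : ℕ} {T : Tab} {i : ℕ} {A B : RelAtom σ ℕ} (hA : T.RowIs W i A)
    (hB : T.RowIs W i B) : A = B := by
  have h : A.rel = B.rel := Fin.ext (by have := hA.rel; have := hB.rel; omega)
  refine RelAtom.ext_argN h fun j hj => ?_
  rw [← hA.arg j hj, ← hB.arg j (h ▸ hj)]

theorem Rep.mem {W : ℕ} {T : Tab} {Q : QS σ α} (h : T.Rep W Q) {i : ℕ} (hi : 0 < i) (hi' : i < W)
    {A : RelAtom σ ℕ} (hA : T.RowIs W i A) : A ∈ Q.atoms :=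
  (h.atoms A).2 ⟨i, hi, hi', hA⟩

/-- Sending row `i` to row `a` and row `i'` to row `a'` respects equality of arguments. -/
def Compat (W : ℕ) (S T : Tab) (i a i' a' : ℕ) : Prop :=
  S.rel i = T.rel a ∧ S.rel i' = T.rel a' ∧
    ∀ c < W, ∀ c' < W, c < S.ar i → c' < S.ar i' →
      S.arg (i * W + c) = S.arg (i' * W + c') → T.arg (a * W + c) = T.arg (a' * W + c')

/-- The constraints that are left when the last `k` rows of `S` have been eliminated. -/
def elim (W : ℕ) (S T : Tab) : ℕ → ℕ → ℕ → ℕ → ℕ → Prop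
  | 0, i, a, i', a' => Compat W S T i a i' a'
  | k + 1, i, a, i', a' => elim W S T k i a i' a' ∧
      (S.rel (W - 1 - k) ≠ 0 → ∃ b < W, elim W S T k (W - 1 - k) b (W - 1 - k) b ∧
        elim W S T k i a (W - 1 - k) b ∧ elim W S T k i' a' (W - 1 - k) b)

variable {W : ℕ} {S T : Tab}

theorem elim_anti {k l : ℕ} (h : k ≤ l) {i a i' a' : ℕ} (H : elim W S T l i a i' a') :
    elim W S T k i a i' a' := by
  induction l, h using Nat.le_induction with
  | base => exact H
  | succ l _ ih => exact ih H.1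

theorem elim_compat {k i a i' a' : ℕ} (H : elim W S T k i a i' a') : Compat W S T i a i' a' :=
  elim_anti (Nat.zero_le k) H

/-- `f` sends the rows of `S` to rows of `T`, respecting equality of arguments. -/
def RowMap (W : ℕ) (S T : Tab) (f : ℕ → ℕ) : Prop :=
  f 0 = 0 ∧ ∀ i < W, S.rel i ≠ 0 → f i < W ∧
    ∀ i' < W, S.rel i' ≠ 0 → Compat W S T i (f i) i' (f i')

/-- A solution survives each elimination: its own value at the eliminated row is the witness `b`. -/
theorem RowMap.elim {f : ℕ → ℕ} (hf : RowMap W S T f) (k : ℕ) {i i' : ℕ} (hi : i < W)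
    (hi' : i' < W) (h : S.rel i ≠ 0) (h' : S.rel i' ≠ 0) :
    Tab.elim W S T k i (f i) i' (f i') := by
  induction k generalizing i i' with
  | zero => exact (hf.2 i hi h).2 i' hi' h'
  | succ k ih =>
    have hc : W - 1 - k < W := by omega
    exact ⟨ih hi hi' h h', fun h0 => ⟨f (W - 1 - k), (hf.2 _ hc h0).1, ih hc hc h0 h0,
      ih hi hc h h0, ih hi' hc h' h0⟩⟩

/-- Rows are reinstated in the order opposite to their elimination, each time extending a partial
solution. The remaining constraints supply, for any two earlier rows, a value of the new row
compatible with both. As `T` has at most two rows with a given relation number, one value suits all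
earlier rows. -/
theorem exists_rowMap_of_elim (hW : 0 < W) (hS : S.rel 0 ≠ 0) (hT : TwoRows W T)
    (H : elim W S T W 0 0 0 0) : ∃ f, RowMap W S T f := by
  suffices ∀ m, 1 ≤ m → m ≤ W → ∃ f : ℕ → ℕ, f 0 = 0 ∧ ∀ i < m, S.rel i ≠ 0 → f i < W ∧
      ∀ i' < m, S.rel i' ≠ 0 → elim W S T (W - m) i (f i) i' (f i') by
    obtain ⟨f, h0, hf⟩ := this W hW le_rfl
    exact ⟨f, h0, fun i hi h => ⟨(hf i hi h).1, fun i' hi' h' =>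
      elim_compat ((hf i hi h).2 i' hi' h')⟩⟩
  intro m hm
  induction m, hm using Nat.le_induction with
  | base =>
    intro _
    refine ⟨fun _ => 0, rfl, fun i hi _ => ⟨hW, fun i' hi' _ => ?_⟩⟩
    obtain rfl : i = 0 := by omega
    obtain rfl : i' = 0 := by omega
    exact elim_anti (by omega) H
  | succ m hm ih =>
    intro hmW
    obtain ⟨f, h0, hf⟩ := ih (by omega)
    obtain ⟨k, hk⟩ : ∃ k, W = m + 1 + k := ⟨W - (m + 1), by omega⟩
    have e1 : W - m = k + 1 := by omega
    have e2 : W - (m + 1) = k := by omega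
    have e3 : W - 1 - k = m := by omega
    rw [e1] at hf
    rw [e2]
    simp only [elim, e3] at hf
    by_cases hl : S.rel m = 0
    · refine ⟨f, h0, fun i hi h => ?_⟩
      have hi' : i < m := lt_of_le_of_ne (by omega) (by rintro rfl; exact h hl)
      refine ⟨(hf i hi' h).1, fun j hj h' => ?_⟩
      have hj' : j < m := lt_of_le_of_ne (by omega) (by rintro rfl; exact h' hl)
      exact ((hf i hi' h).2 j hj' h').1
    have key : ∀ i < m, S.rel i ≠ 0 → ∀ i' < m, S.rel i' ≠ 0 → ∃ b < W, elim W S T k m b m b ∧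
        elim W S T k i (f i) m b ∧ elim W S T k i' (f i') m b :=
      fun i hi h i' hi' h' => ((hf i hi h).2 i' hi' h').2 hl
    obtain ⟨b, hbW, hb, hb'⟩ : ∃ b < W, elim W S T k m b m b ∧
        ∀ i < m, S.rel i ≠ 0 → elim W S T k i (f i) m b := by
      by_contra! hc
      -- Without a common value, `b₁` fails at some `i₁`, a value `b₂` suited to `i₁` fails at some
      -- `i₂`, and `b₃` suits both. These are three different rows of `T` with the relation number
      -- of row `m`.
      obtain ⟨b₁, w₁, s₁, p₁, -⟩ := key 0 hm hS 0 hm hS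
      obtain ⟨i₁, l₁, r₁, n₁⟩ := hc b₁ w₁ s₁
      obtain ⟨b₂, w₂, s₂, p₂, -⟩ := key i₁ l₁ r₁ i₁ l₁ r₁
      obtain ⟨i₂, l₂, r₂, n₂⟩ := hc b₂ w₂ s₂
      obtain ⟨b₃, w₃, s₃, p₃, p₃'⟩ := key i₁ l₁ r₁ i₂ l₂ r₂
      have t₁ := (elim_compat s₁).1
      have t₂ := (elim_compat s₂).1
      have t₃ := (elim_compat s₃).1
      rcases hT b₁ w₁ b₂ w₂ b₃ w₃ (by omega) (by omega) (by omega) with rfl | rfl | rfl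
      · exact n₁ p₂
      · exact n₁ p₃
      · exact n₂ p₃'
    have symm : ∀ k {i a i' a'}, elim W S T k i a i' a' → elim W S T k i' a' i a := by
      intro k
      induction k with
      | zero =>
        intro i a i' a' h
        exact ⟨h.2.1, h.1, fun c hc c' hc' g g' e => (h.2.2 c' hc' c hc g' g e.symm).symm⟩
      | succ k ih =>
        intro i a i' a' h
        refine ⟨ih h.1, fun hl => ?_⟩
        obtain ⟨b, h1, h2, h3, h4⟩ := h.2 hl
        exact ⟨b, h1, h2, h4, h3⟩
    have hfm : ∀ i, i ≠ m → Function.update f m b i = f i := fun i hi =>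
      Function.update_of_ne hi _ _
    have hfm' : Function.update f m b m = b := Function.update_self _ _ _
    refine ⟨Function.update f m b, (hfm 0 (by omega)).trans h0, fun i hi h => ?_⟩
    by_cases hi' : i = m
    · subst hi'
      rw [hfm']
      refine ⟨hbW, fun j hj h' => ?_⟩
      by_cases hj' : j = i
      · rw [hj', hfm']
        exact hb
      · rw [hfm j hj']
        exact symm k (hb' j (by omega) h')
    · have hi'' : i < m := by omega
      rw [hfm i hi']
      refine ⟨(hf i hi'' h).1, fun j hj h' => ?_⟩
      by_cases hj' : j = m
      · rw [hj', hfm']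
        exact hb' i hi'' h
      · rw [hfm j hj']
        exact ((hf i hi'' h).2 j (by omega) h').1

/-- The head is a row with a relation number of its own, so row maps treat head and atoms alike. A
row map sends cells to cells; this defines a map on variables because equal arguments go to equal
arguments. -/
theorem exists_rowMap_iff {P Q : QS σ α} (hS : S.Rep W P) (hT : T.Rep W Q) :
    (∃ f, RowMap W S T f) ↔ P.Hom Q := by
  classical
  constructor
  · rintro ⟨f, h0, hf⟩
    let h : ℕ → ℕ := fun x =>
      if H : ∃ q : ℕ × ℕ, q.1 < W ∧ S.rel q.1 ≠ 0 ∧ q.2 < S.ar q.1 ∧ S.arg (q.1 * W + q.2) = x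
      then T.arg (f H.choose.1 * W + H.choose.2) else 0
    have hh : ∀ i < W, S.rel i ≠ 0 → ∀ c < S.ar i,
        h (S.arg (i * W + c)) = T.arg (f i * W + c) := by
      intro i hi hr c hc
      have H : ∃ q : ℕ × ℕ, q.1 < W ∧ S.rel q.1 ≠ 0 ∧ q.2 < S.ar q.1 ∧
          S.arg (q.1 * W + q.2) = S.arg (i * W + c) := ⟨(i, c), hi, hr, hc, rfl⟩
      simp only [h, dif_pos H]
      obtain ⟨k1, k2, k3, k4⟩ := H.choose_spec
      have w1 := hS.wide _ k1 k2
      have w2 := hS.wide _ hi hr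
      exact ((hf _ k1 k2).2 i hi hr).2.2 _ (by omega) _ (by omega) k3 hc k4
    refine ⟨h, fun A hA => ?_, fun i => ?_⟩
    · obtain ⟨i, hi, hiW, hiA⟩ := (hS.atoms A).1 hA
      have hr : S.rel i ≠ 0 := by rw [hiA.rel]; omega
      obtain ⟨hfi, hc⟩ := hf i hiW hr
      have e := (hc i hiW hr).1
      have hfi0 : 0 < f i := by
        rw [Nat.pos_iff_ne_zero]
        intro h1
        rw [h1, hT.rel0, hiA.rel] at e
        omega
      obtain ⟨B, hB⟩ := hT.live (f i) hfi0 hfi (by rw [← e]; exact hr)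
      have hAB : A.rel = B.rel := Fin.ext (by have := hiA.rel; have := hB.rel; omega)
      have : A.map h = B := by
        refine RelAtom.ext_argN hAB fun j hj => ?_
        have hj : j < σ.arity A.rel := hj
        rw [RelAtom.argN_map h A hj, ← hiA.arg j hj, ← hB.arg j (hAB ▸ hj)]
        exact hh i hiW hr j (by rw [hiA.ar]; exact hj)
      rw [this]
      exact hT.mem hfi0 hfi hB
    · have := hh 0 hS.pos (by rw [hS.rel0]; omega) i (by rw [hS.ar0]; exact i.2)
      rw [h0] at this
      simp only [zero_mul, zero_add] at this
      rw [hS.arg0, hT.arg0] at this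
      exact this
  · rintro ⟨h, h1, h2⟩
    have key : ∀ i, ∃ a, (i = 0 → a = 0) ∧ (i < W → S.rel i ≠ 0 → a < W ∧ T.rel a = S.rel i ∧
        ∀ c < S.ar i, T.arg (a * W + c) = h (S.arg (i * W + c))) := by
      intro i
      rcases Nat.eq_zero_or_pos i with rfl | hi
      · refine ⟨0, fun _ => rfl, fun _ _ => ⟨hS.pos, by rw [hS.rel0, hT.rel0], fun c hc => ?_⟩⟩
        rw [hS.ar0] at hc
        have e1 := hS.arg0 ⟨c, hc⟩
        have e2 := hT.arg0 ⟨c, hc⟩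
        simp only at e1 e2
        simp only [zero_mul, zero_add, e1, e2, h2]
      · by_cases hc : i < W ∧ S.rel i ≠ 0
        · obtain ⟨A, hA⟩ := hS.live i hi hc.1 hc.2
          obtain ⟨a, ha, haW, haA⟩ := (hT.atoms _).1 (h1 A (hS.mem hi hc.1 hA))
          refine ⟨a, by omega, fun _ _ => ⟨haW, by rw [haA.rel, hA.rel]; rfl, fun c hc => ?_⟩⟩
          rw [hA.ar] at hc
          rw [haA.arg c hc, hA.arg c hc, RelAtom.argN_map h A hc]
        · exact ⟨0, fun _ => rfl, fun k1 k2 => absurd ⟨k1, k2⟩ hc⟩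
    choose f hf0 hf using key
    refine ⟨f, hf0 0 rfl, fun i hi hr => ?_⟩
    obtain ⟨k1, k2, k3⟩ := hf i hi hr
    refine ⟨k1, fun i' hi' hr' => ?_⟩
    obtain ⟨k1', k2', k3'⟩ := hf i' hi' hr'
    refine ⟨k2.symm, k2'.symm, fun c _ c' _ hc hc' e => ?_⟩
    rw [k3 c hc, k3' c' hc', e]

/-- Only the target needs at most two rows for each name. -/
theorem elim_iff_hom {P Q : QS σ α} (hS : S.Rep W P) (hT : T.Rep W Q) (hT2 : T.TwoRows W) :
    elim W S T W 0 0 0 0 ↔ P.Hom Q := by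
  rw [← exists_rowMap_iff hS hT]
  have h0 : S.rel 0 ≠ 0 := by rw [hS.rel0]; omega
  refine ⟨exists_rowMap_of_elim hS.pos h0 hT2, ?_⟩
  rintro ⟨f, hf⟩
  have := hf.elim W hS.pos hS.pos h0 h0
  rwa [hf.1] at this

end Tab

/-! ### Operations on tables -/

namespace Tab

variable {σ : Schema} {α : ℕ} {W : ℕ} {T : Tab} {P : QS σ α}

/-- Apply a substitution to the arguments. -/
def map (f : ℕ → ℕ) (T : Tab) : Tab := ⟨T.rel, T.ar, fun x => f (T.arg x)⟩

theorem RowIs.map {i : ℕ} {A : RelAtom σ ℕ} (h : T.RowIs W i A) (f : ℕ → ℕ) :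
    (T.map f).RowIs W i (A.map f) :=
  ⟨h.rel, h.ar, fun c hc => (congrArg f (h.arg c hc)).trans (RelAtom.argN_map f A hc).symm⟩

theorem Rep.map (h : T.Rep W P) (f : ℕ → ℕ) : (T.map f).Rep W (P.map f) where
  pos := h.pos
  rel0 := h.rel0
  ar0 := h.ar0
  arg0 := fun c => congrArg f (h.arg0 c)
  atoms := by
    intro B
    constructor
    · rintro ⟨A, hA, rfl⟩
      obtain ⟨i, h1, h2, h3⟩ := (h.atoms A).1 hA
      exact ⟨i, h1, h2, h3.map f⟩
    · rintro ⟨i, h1, h2, h3⟩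
      obtain ⟨A, hA⟩ := h.live i h1 h2 (by have : T.rel i = _ := h3.rel; omega)
      exact ⟨A, h.mem h1 h2 hA, h3.unique (hA.map f)⟩
  live := by
    intro i h1 h2 h3
    obtain ⟨A, hA⟩ := h.live i h1 h2 h3
    exact ⟨_, hA.map f⟩
  wide := h.wide

theorem TwoRows.map (h : T.TwoRows W) (f : ℕ → ℕ) : (T.map f).TwoRows W := h

theorem Rep.two (h : T.Rep W P) (h2 : T.TwoRows W) : P.Two := by
  intro A hA B hB D hD e1 e2
  obtain ⟨i, i0, iW, hi⟩ := (h.atoms A).1 hA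
  obtain ⟨j, j0, jW, hj⟩ := (h.atoms B).1 hB
  obtain ⟨k, k0, kW, hk⟩ := (h.atoms D).1 hD
  rcases h2 i iW j jW k kW (by rw [hi.rel, hj.rel, e1]) (by rw [hi.rel, hk.rel, e2])
    (by rw [hi.rel]; omega) with rfl | rfl | rfl
  · exact Or.inl (hi.unique hj)
  · exact Or.inr (Or.inl (hi.unique hk))
  · exact Or.inr (Or.inr (hj.unique hk))

theorem Rep.arity_le (h : T.Rep W P) {A : RelAtom σ ℕ} (hA : A ∈ P.atoms) :
    σ.arity A.rel ≤ W := by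
  obtain ⟨i, i0, iW, hi⟩ := (h.atoms A).1 hA
  rw [← hi.ar]
  exact h.wide i iW (by rw [hi.rel]; omega)

/-- Rows `x` and `y` are equal. -/
def SameRow (W : ℕ) (T : Tab) (x y : ℕ) : Prop :=
  T.rel y = T.rel x ∧ ∀ c < W, c < T.ar x → T.arg (y * W + c) = T.arg (x * W + c)

/-- No earlier row is equal to row `x`. -/
def Keep (W : ℕ) (T : Tab) (x : ℕ) : Prop := ¬ ∃ y < W, y < x ∧ SameRow W T x y

/-- Row `x` holds an atom, it is kept, and no different row has the same relation number. -/
def Twin (W : ℕ) (T : Tab) (x : ℕ) : Prop :=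
  x ≠ 0 ∧ Keep W T x ∧ ¬ ∃ y < W, T.rel y = T.rel x ∧ ¬ SameRow W T x y

/-- The rows from `H` on are unused. -/
def Low (H W : ℕ) (T : Tab) : Prop := ∀ i < W, H ≤ i → T.rel i = 0

/-- `E` extends `T` by fresh second rows, in the way `QS.ext` extends queries. -/
structure IsExt (H W : ℕ) (T E : Tab) : Prop where
  keep : ∀ x < H, Keep W T x → E.rel x = T.rel x
  drop : ∀ x < H, ¬ Keep W T x → E.rel x = 0
  twin : ∀ x < H, Twin W T x → E.rel (H + x) = T.rel x
  free : ∀ x < H, ¬ Twin W T x → E.rel (H + x) = 0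
  ar_low : ∀ x < H, E.ar x = T.ar x
  ar_high : ∀ x < H, E.ar (H + x) = T.ar x
  arg_low : ∀ x < H, ∀ c < W, E.arg (x * W + c) = 2 * T.arg (x * W + c)
  arg_high : ∀ x < H, ∀ c < W, E.arg ((H + x) * W + c) = 2 * ((H + x) * W + c) + 1

/-- Arities need no comparison, since the relation number determines them. -/
theorem Rep.sameRow (h : T.Rep W P) {x y : ℕ} (hx : x < W) {A : RelAtom σ ℕ}
    (hA : T.RowIs W x A) (hy : 0 < y) (hy' : y < W) : SameRow W T x y ↔ T.RowIs W y A := by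
  have w := h.wide x hx (by rw [hA.rel]; omega)
  rw [hA.ar] at w
  constructor
  · rintro ⟨h1, h2⟩
    obtain ⟨B, hB⟩ := h.live y hy hy' (by rw [h1, hA.rel]; omega)
    have e : B.rel = A.rel := Fin.ext (by have := hB.rel; have := hA.rel; omega)
    refine ⟨by rw [h1, hA.rel], by rw [hB.ar, e], fun c hc => ?_⟩
    rw [h2 c (by omega) (by rw [hA.ar]; exact hc), hA.arg c hc]
  · intro hB
    refine ⟨by rw [hA.rel, hB.rel], fun c _ hc' => ?_⟩
    rw [hA.ar] at hc'
    rw [hA.arg c hc', hB.arg c hc']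

/-- Identifying variables can make rows equal; the first of several equal rows then stands for the
atom. -/
theorem Rep.exists_keep {H : ℕ} (h : T.Rep W P) (hl : T.Low H W) {A : RelAtom σ ℕ}
    (hA : A ∈ P.atoms) : ∃ x, 0 < x ∧ x < W ∧ x < H ∧ T.RowIs W x A ∧ Keep W T x := by
  classical
  have h1 := (h.atoms A).1 hA
  obtain ⟨x0, xW, hx⟩ := Nat.find_spec h1
  refine ⟨_, x0, xW, ?_, hx, ?_⟩
  · by_contra hc
    have := hl _ xW (by omega)
    rw [hx.rel] at this
    omega
  · rintro ⟨y, yW, hyx, hs⟩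
    have y0 : 0 < y := by
      rw [Nat.pos_iff_ne_zero]
      rintro rfl
      have := hs.1
      rw [h.rel0, hx.rel] at this
      omega
    exact Nat.find_min h1 hyx ⟨y0, yW, (h.sameRow xW hx y0 yW).1 hs⟩

theorem Rep.keep_unique (h : T.Rep W P) {A : RelAtom σ ℕ} {x y : ℕ} (hx : 0 < x) (hxW : x < W)
    (hy : 0 < y) (hyW : y < W) (hxA : T.RowIs W x A) (hyA : T.RowIs W y A) (kx : Keep W T x)
    (ky : Keep W T y) : x = y := by
  rcases Nat.lt_trichotomy x y with hc | hc | hc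
  · exact absurd ⟨x, hxW, hc, (h.sameRow hyW hyA hx hxW).2 hxA⟩ ky
  · exact hc
  · exact absurd ⟨y, hyW, hc, (h.sameRow hxW hxA hy hyW).2 hyA⟩ kx

theorem Rep.twin_iff (h : T.Rep W P) {A : RelAtom σ ℕ} {x : ℕ} (hx : 0 < x) (hxW : x < W)
    (hxA : T.RowIs W x A) (kx : Keep W T x) : Twin W T x ↔ P.Single A := by
  constructor
  · rintro ⟨-, -, h3⟩
    refine ⟨h.mem hx hxW hxA, fun B hB e => ?_⟩
    obtain ⟨y, y0, yW, hy⟩ := (h.atoms B).1 hB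
    by_contra hne
    refine h3 ⟨y, yW, by rw [hy.rel, hxA.rel, e], fun hs => hne ?_⟩
    exact hy.unique ((h.sameRow hxW hxA y0 yW).1 hs)
  · rintro ⟨-, h2⟩
    refine ⟨by omega, kx, ?_⟩
    rintro ⟨y, yW, e, hs⟩
    have y0 : 0 < y := by
      rw [Nat.pos_iff_ne_zero]
      rintro rfl
      rw [h.rel0, hxA.rel] at e
      omega
    obtain ⟨B, hB⟩ := h.live y y0 yW (by rw [e, hxA.rel]; omega)
    have := h2 B (h.mem y0 yW hB) (Fin.ext (by have := hB.rel; have := hxA.rel; omega))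
    exact hs ((h.sameRow hxW hxA y0 yW).2 (this ▸ hB))

theorem mul_add_inj {W a b c d : ℕ} (hc : c < W) (hd : d < W) (h : a * W + c = b * W + d) :
    a = b ∧ c = d := by
  have hW : 0 < W := by omega
  have e1 := congrArg (· / W) h
  have e2 := congrArg (· % W) h
  simp only [Nat.add_comm (_ * W), Nat.add_mul_div_right _ _ hW,
    Nat.div_eq_of_lt hc, Nat.div_eq_of_lt hd, Nat.add_mul_mod_self_right, Nat.mod_eq_of_lt hc,
    Nat.mod_eq_of_lt hd, zero_add] at e1 e2
  exact ⟨e1, e2⟩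

/-- The double of row `x` goes to the free row `H + x`, and its variables are numbered by the cells
of that row, which makes them distinct. -/
theorem Rep.ext {H : ℕ} {E : Tab} (h : T.Rep W P) (hW : W = H + H) (hl : T.Low H W)
    (hE : IsExt H W T E) : ∃ φ, P.FreshNum φ ∧ E.Rep W (P.ext φ) := by
  classical
  have hH : 0 < H := by have := h.pos; omega
  have hk : ∀ A : RelAtom σ ℕ, ∃ x, A ∈ P.atoms →
      0 < x ∧ x < W ∧ x < H ∧ T.RowIs W x A ∧ Keep W T x := fun A => by
    by_cases hA : A ∈ P.atoms
    · obtain ⟨x, hx⟩ := h.exists_keep hl hA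
      exact ⟨x, fun _ => hx⟩
    · exact ⟨0, fun h => absurd h hA⟩
  choose s hs using hk
  have k0 : Keep W T 0 := by
    rintro ⟨y, -, h1, -⟩
    omega
  have low : ∀ x, 0 < x → x < H → ∀ A : RelAtom σ ℕ, T.RowIs W x A → Keep W T x →
      E.RowIs W x (A.map (2 * ·)) := by
    intro x x0 xH A hA kx
    have w := h.arity_le (h.mem x0 (by omega) hA)
    refine ⟨by rw [hE.keep x xH kx, hA.rel]; rfl, by rw [hE.ar_low x xH, hA.ar]; rfl, fun c hc => ?_⟩
    have hc : c < σ.arity A.rel := hc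
    rw [hE.arg_low x xH c (by omega), hA.arg c hc]
    exact (RelAtom.argN_map (2 * ·) A hc).symm
  have high : ∀ x, x < H → ∀ A : RelAtom σ ℕ, T.RowIs W x A → A ∈ P.atoms → Twin W T x →
      E.RowIs W (H + x) (RelAtom.ofFun A.rel fun j => 2 * ((H + x) * W + j) + 1) := by
    intro x xH A hA hAP tx
    have w := h.arity_le hAP
    refine ⟨by rw [hE.twin x xH tx, hA.rel]; rfl, by rw [hE.ar_high x xH, hA.ar]; rfl,
      fun c hc => ?_⟩
    have hc : c < σ.arity A.rel := hc
    rw [hE.arg_high x xH c (by omega)]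
    exact (RelAtom.ofFun_argN A.rel (fun j => 2 * ((H + x) * W + j) + 1) hc).symm
  refine ⟨fun A j => (H + s A) * W + j, ?_, ?_⟩
  · intro A j A' j' hA hj hA' hj' e
    have w := h.arity_le hA.1
    have w' := h.arity_le hA'.1
    obtain ⟨e1, e2⟩ := mul_add_inj (by omega) (by omega) e
    refine ⟨?_, e2⟩
    have e3 : s A = s A' := by omega
    obtain ⟨-, -, -, k1, -⟩ := hs A hA.1
    obtain ⟨-, -, -, k2, -⟩ := hs A' hA'.1
    rw [e3] at k1
    exact k1.unique k2
  · have inv : ∀ i, 0 < i → i < W → E.rel i ≠ 0 →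
        (∃ A ∈ P.atoms, E.RowIs W i (A.map (2 * ·))) ∨
        ∃ A, P.Single A ∧
          E.RowIs W i (RelAtom.ofFun A.rel fun j => 2 * ((H + s A) * W + j) + 1) := by
      intro i i0 iW hi
      by_cases iH : i < H
      · by_cases ki : Keep W T i
        · obtain ⟨A, hA⟩ := h.live i i0 iW (by rw [← hE.keep i iH ki]; exact hi)
          exact Or.inl ⟨A, h.mem i0 iW hA, low i i0 iH A hA ki⟩
        · exact absurd (hE.drop i iH ki) hi
      · obtain ⟨x, rfl⟩ : ∃ x, i = H + x := ⟨i - H, by omega⟩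
        have xH : x < H := by omega
        by_cases tx : Twin W T x
        · have x0 : 0 < x := Nat.pos_iff_ne_zero.2 tx.1
          obtain ⟨A, hA⟩ := h.live x x0 (by omega) (by rw [← hE.twin x xH tx]; exact hi)
          have hAP := h.mem x0 (by omega) hA
          obtain ⟨k1, k2, k3, k4, k5⟩ := hs A hAP
          have e : s A = x := h.keep_unique k1 k2 x0 (by omega) k4 hA k5 tx.2.1
          refine Or.inr ⟨A, (h.twin_iff x0 (by omega) hA tx.2.1).1 tx, ?_⟩
          rw [e]
          exact high x xH A hA hAP tx
        · exact absurd (hE.free x xH tx) hi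
    refine ⟨h.pos, (hE.keep 0 hH k0).trans h.rel0, (hE.ar_low 0 hH).trans h.ar0, fun c => ?_, ?_,
      ?_, ?_⟩
    · have w := h.wide 0 h.pos (by rw [h.rel0]; omega)
      rw [h.ar0] at w
      have := hE.arg_low 0 hH c (by omega)
      simp only [zero_mul, zero_add] at this
      rw [this, h.arg0]
      rfl
    · intro B
      constructor
      · rintro (⟨A, hA, rfl⟩ | ⟨A, hA, rfl⟩)
        · obtain ⟨k1, k2, k3, k4, k5⟩ := hs A hA
          exact ⟨s A, k1, k2, low _ k1 k3 A k4 k5⟩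
        · obtain ⟨k1, k2, k3, k4, k5⟩ := hs A hA.1
          exact ⟨H + s A, by omega, by omega,
            high _ k3 A k4 hA.1 ((h.twin_iff k1 k2 k4 k5).2 hA)⟩
      · rintro ⟨i, i0, iW, hi⟩
        rcases inv i i0 iW (by rw [hi.rel]; omega) with ⟨A, hA, hA'⟩ | ⟨A, hA, hA'⟩
        · exact Or.inl ⟨A, hA, hi.unique hA'⟩
        · exact Or.inr ⟨A, hA, hi.unique hA'⟩
    · intro i i0 iW hi
      rcases inv i i0 iW hi with ⟨A, -, hA'⟩ | ⟨A, -, hA'⟩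
      · exact ⟨_, hA'⟩
      · exact ⟨_, hA'⟩
    · intro i iW hi
      by_cases iH : i < H
      · rw [hE.ar_low i iH]
        refine h.wide i iW ?_
        by_cases ki : Keep W T i
        · rwa [← hE.keep i iH ki]
        · exact absurd (hE.drop i iH ki) hi
      · obtain ⟨x, rfl⟩ : ∃ x, i = H + x := ⟨i - H, by omega⟩
        have xH : x < H := by omega
        rw [hE.ar_high x xH]
        refine h.wide x (by omega) ?_
        by_cases tx : Twin W T x
        · rwa [← hE.twin x xH tx]
        · exact absurd (hE.free x xH tx) hi

/-- A number in the upper half comes from a row without rivals, so only `x` and `H + x` carry it.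
Three rows in the lower half are already rows of `T`. -/
theorem Rep.ext_twoRows {H : ℕ} {E : Tab} (h : T.Rep W P) (hW : W = H + H)
    (hE : IsExt H W T E) (h2 : T.TwoRows W) : E.TwoRows W := by
  have lowRel : ∀ x < H, E.rel x ≠ 0 → Keep W T x ∧ E.rel x = T.rel x := by
    intro x hx h0
    by_cases k : Keep W T x
    · exact ⟨k, hE.keep x hx k⟩
    · exact absurd (hE.drop x hx k) h0
  have highRel : ∀ x < H, E.rel (H + x) ≠ 0 → Twin W T x ∧ E.rel (H + x) = T.rel x := by
    intro x hx h0
    by_cases k : Twin W T x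
    · exact ⟨k, hE.twin x hx k⟩
    · exact absurd (hE.free x hx k) h0
  have same : ∀ x < H, ∀ y < H, Twin W T x → Keep W T y → T.rel y = T.rel x → T.rel x ≠ 0 →
      y = x := by
    intro x hx y hy tx ky e h0
    have x0 : 0 < x := Nat.pos_iff_ne_zero.2 tx.1
    obtain ⟨A, hA⟩ := h.live x x0 (by omega) h0
    have y0 : 0 < y := by
      rw [Nat.pos_iff_ne_zero]
      rintro rfl
      rw [h.rel0, hA.rel] at e
      omega
    have hs : SameRow W T x y := by
      by_contra hc
      exact tx.2.2 ⟨y, by omega, e, hc⟩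
    exact h.keep_unique y0 (by omega) x0 (by omega) ((h.sameRow (by omega) hA y0 (by omega)).1 hs)
      hA ky tx.2.1
  have high : ∀ x < H, ∀ y < W, E.rel (H + x) ≠ 0 → E.rel (H + x) = E.rel y →
      y = x ∨ y = H + x := by
    intro x hx y hy h0 e
    obtain ⟨tx, ex⟩ := highRel x hx h0
    by_cases hyH : y < H
    · obtain ⟨ky, ey⟩ := lowRel y hyH (by omega)
      exact Or.inl (same x hx y hyH tx ky (by omega) (by omega))
    · obtain ⟨z, rfl⟩ : ∃ z, y = H + z := ⟨y - H, by omega⟩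
      obtain ⟨tz, ez⟩ := highRel z (by omega) (by omega)
      have := same x hx z (by omega) tx tz.2.1 (by omega) (by omega)
      exact Or.inr (by omega)
  intro i hi j hj k hk e1 e2 h0
  by_cases iH : i < H
  · by_cases jH : j < H
    · by_cases kH : k < H
      · obtain ⟨-, a1⟩ := lowRel i iH h0
        obtain ⟨-, a2⟩ := lowRel j jH (by omega)
        obtain ⟨-, a3⟩ := lowRel k kH (by omega)
        exact h2 i hi j hj k hk (by omega) (by omega) (by omega)
      · obtain ⟨z, rfl⟩ : ∃ z, k = H + z := ⟨k - H, by omega⟩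
        have b1 := high z (by omega) i hi (by omega) (by omega)
        have b2 := high z (by omega) j hj (by omega) (by omega)
        omega
    · obtain ⟨z, rfl⟩ : ∃ z, j = H + z := ⟨j - H, by omega⟩
      have b1 := high z (by omega) i hi (by omega) (by omega)
      have b2 := high z (by omega) k hk (by omega) (by omega)
      omega
  · obtain ⟨z, rfl⟩ : ∃ z, i = H + z := ⟨i - H, by omega⟩
    have b1 := high z (by omega) j hj (by omega) (by omega)
    have b2 := high z (by omega) k hk (by omega) (by omega)
    omega

/-- `E` extends `T` by a fresh row with relation number `r` and arity `a`. -/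
structure IsNew (H W : ℕ) (T E : Tab) (r a : ℕ) : Prop where
  low : ∀ x < H, E.rel x = T.rel x
  new : E.rel H = r
  free : ∀ x < W, H < x → E.rel x = 0
  ar_low : ∀ x < H, E.ar x = T.ar x
  ar_new : E.ar H = a
  arg_low : ∀ x < H, ∀ c < W, E.arg (x * W + c) = 2 * T.arg (x * W + c)
  arg_new : ∀ c < W, E.arg (H * W + c) = 2 * (H * W + c) + 1

/-- No row of `T` is dropped here: repeated rows do no harm, and the single free row `H` suffices.
-/
theorem Rep.new {H : ℕ} {E : Tab} {R : Fin σ.numRel} (h : T.Rep W P) (hW : W = H + H)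
    (hl : T.Low H W) (hR : σ.arity R ≤ W) (hE : IsNew H W T E (R + 2) (σ.arity R)) :
    E.Rep W (P.addFresh R fun j => H * W + j) := by
  have hH : 0 < H := by have := h.pos; omega
  have low : ∀ x, 0 < x → x < H → ∀ A : RelAtom σ ℕ, T.RowIs W x A → E.RowIs W x (A.map (2 * ·)) := by
    intro x x0 xH A hA
    have w := h.arity_le (h.mem x0 (by omega) hA)
    refine ⟨by rw [hE.low x xH, hA.rel]; rfl, by rw [hE.ar_low x xH, hA.ar]; rfl, fun c hc => ?_⟩
    have hc : c < σ.arity A.rel := hc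
    rw [hE.arg_low x xH c (by omega), hA.arg c hc]
    exact (RelAtom.argN_map (2 * ·) A hc).symm
  have high : E.RowIs W H (RelAtom.ofFun R fun j => 2 * (H * W + j) + 1) := by
    refine ⟨hE.new, hE.ar_new, fun c hc => ?_⟩
    have hc : c < σ.arity R := hc
    rw [hE.arg_new c (by omega)]
    exact (RelAtom.ofFun_argN R (fun j => 2 * (H * W + j) + 1) hc).symm
  have inv : ∀ i, 0 < i → i < W → E.rel i ≠ 0 →
      (∃ A ∈ P.atoms, E.RowIs W i (A.map (2 * ·))) ∨ i = H := by
    intro i i0 iW hi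
    rcases Nat.lt_trichotomy i H with hc | hc | hc
    · obtain ⟨A, hA⟩ := h.live i i0 iW (by rw [← hE.low i hc]; exact hi)
      exact Or.inl ⟨A, h.mem i0 iW hA, low i i0 hc A hA⟩
    · exact Or.inr hc
    · exact absurd (hE.free i iW hc) hi
  refine ⟨h.pos, (hE.low 0 hH).trans h.rel0, (hE.ar_low 0 hH).trans h.ar0, fun c => ?_, ?_, ?_, ?_⟩
  · have w := h.wide 0 h.pos (by rw [h.rel0]; omega)
    rw [h.ar0] at w
    have := hE.arg_low 0 hH c (by omega)
    simp only [zero_mul, zero_add] at this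
    rw [this, h.arg0]
    rfl
  · intro B
    constructor
    · rintro (⟨A, hA, rfl⟩ | rfl)
      · obtain ⟨i, i0, iW, hi⟩ := (h.atoms A).1 hA
        have iH : i < H := by
          by_contra hc
          have := hl i iW (by omega)
          rw [hi.rel] at this
          omega
        exact ⟨i, i0, iW, low i i0 iH A hi⟩
      · exact ⟨H, hH, by omega, high⟩
    · rintro ⟨i, i0, iW, hi⟩
      rcases inv i i0 iW (by rw [hi.rel]; omega) with ⟨A, hA, hA'⟩ | rfl
      · exact Or.inl ⟨A, hA, hi.unique hA'⟩
      · exact Or.inr (hi.unique high)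
  · intro i i0 iW hi
    rcases inv i i0 iW hi with ⟨A, -, hA'⟩ | rfl
    · exact ⟨_, hA'⟩
    · exact ⟨_, high⟩
  · intro i iW hi
    rcases Nat.lt_trichotomy i H with hc | rfl | hc
    · rw [hE.ar_low i hc]
      exact h.wide i iW (by rwa [← hE.low i hc])
    · rwa [hE.ar_new]
    · exact absurd (hE.free i iW hc) hi

theorem IsNew.twoRows {H r a : ℕ} {E : Tab} (hE : IsNew H W T E r a) (hW : W = H + H)
    (h2 : T.TwoRows W) (hr : ∀ i < W, T.rel i ≠ r) : E.TwoRows W := by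
  intro i hi j hj k hk e1 e2 h0
  have key : ∀ x < W, E.rel x ≠ 0 → x < H ∧ E.rel x = T.rel x ∨ x = H := by
    intro x hx hx0
    rcases Nat.lt_trichotomy x H with hc | hc | hc
    · exact Or.inl ⟨hc, hE.low x hc⟩
    · exact Or.inr hc
    · exact absurd (hE.free x hx hc) hx0
  have hn := hE.new
  have ri := hr i hi
  have rj := hr j hj
  have rk := hr k hk
  rcases key i hi h0 with ⟨-, a1⟩ | rfl
  · rcases key j hj (by omega) with ⟨-, a2⟩ | rfl
    · rcases key k hk (by omega) with ⟨-, a3⟩ | rfl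
      · exact h2 i hi j hj k hk (by omega) (by omega) (by omega)
      · omega
    · omega
  · rcases key j hj (by omega) with ⟨-, a2⟩ | rfl
    · omega
    · exact Or.inl rfl

end Tab

/-! ### A language of for-programs, and its compilation to the random access machine -/

/-- Memory of a for-program: loop bounds, number variables and number arrays. -/
structure Mem where
  lims : ℕ → ℕ
  vars : ℕ → ℕ
  arrs : ℕ → ℕ → ℕ

namespace Mem

def setVar (m : Mem) (x v : ℕ) : Mem := { m with vars := Function.update m.vars x v }

def setLim (m : Mem) (l v : ℕ) : Mem := { m with lims := Function.update m.lims l v }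

def setArr (m : Mem) (a : ℕ) (f : ℕ → ℕ) : Mem := { m with arrs := Function.update m.arrs a f }

end Mem

/-- Expressions: `bv k` is the variable of the `k`-th enclosing quantifier, `sel c e f` is `e` if
`c ≠ 0` and `f` otherwise, and `any l e` is `1` if `e ≠ 0` for some value of the bound variable
below the bound `l`, and `0` otherwise. -/
inductive Ex where
  | lit (n : ℕ)
  | var (x : ℕ)
  | lim (l : ℕ)
  | bv (k : ℕ)
  | get (a : ℕ) (i : Ex)
  | add (e f : Ex)
  | sub (e f : Ex)
  | sel (c e f : Ex)
  | any (l : ℕ) (e : Ex)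

/-! ### Expressions with bounded quantifiers and their compilation -/

namespace Ex

open Classical in
/-- The value of an expression, for given values of the bound variables. -/
noncomputable def val (m : Mem) : List ℕ → Ex → ℕ
  | _, lit n => n
  | _, var x => m.vars x
  | _, lim l => m.lims l
  | env, bv k => env.getD k 0
  | env, get a i => m.arrs a (val m env i)
  | env, add e f => val m env e + val m env f
  | env, sub e f => val m env e - val m env f
  | env, sel c e f => if val m env c ≠ 0 then val m env e else val m env f
  | env, any l e => if ∃ v < m.lims l, val m (v :: env) e ≠ 0 then 1 else 0

/-- The arrays that an expression reads. -/
def reads : Ex → List ℕ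
  | lit _ => []
  | var _ => []
  | lim _ => []
  | bv _ => []
  | get a i => a :: reads i
  | add e f => reads e ++ reads f
  | sub e f => reads e ++ reads f
  | sel c e f => reads c ++ (reads e ++ reads f)
  | any _ e => reads e

/-- This is what makes `fill` a simultaneous assignment: entries already written cannot affect an
expression that does not read the array. -/
theorem val_congr {m m' : Mem} (hl : m.lims = m'.lims) (hv : m.vars = m'.vars) (e : Ex)
    (ha : ∀ a ∈ e.reads, m.arrs a = m'.arrs a) (env : List ℕ) : val m env e = val m' env e := by
  induction e generalizing env with
  | lit n => rfl
  | var x => simp [val, hv]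
  | lim l => simp [val, hl]
  | bv k => rfl
  | get a i ih =>
    simp only [reads, List.mem_cons, forall_eq_or_imp] at ha
    simp only [val, ih ha.2, ha.1]
  | add e f ihe ihf =>
    simp only [reads, List.mem_append] at ha
    simp only [val, ihe fun a h => ha a (Or.inl h), ihf fun a h => ha a (Or.inr h)]
  | sub e f ihe ihf =>
    simp only [reads, List.mem_append] at ha
    simp only [val, ihe fun a h => ha a (Or.inl h), ihf fun a h => ha a (Or.inr h)]
  | sel c e f ihc ihe ihf =>
    simp only [reads, List.mem_append] at ha
    simp only [val, ihc fun a h => ha a (Or.inl h), ihe fun a h => ha a (Or.inr (Or.inl h)),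
      ihf fun a h => ha a (Or.inr (Or.inr h))]
  | any l e ih =>
    simp only [val, hl, ih ha]

/-- Code that stores the value of an expression in the scratch register `r`, preserving the scratch
registers below `r`; the bound variables are in the scratch registers `ρ`. -/
def comp : List ℕ → ℕ → Ex → RamProg
  | _, r, lit n => .assign (3 * r + 2) (.lit n)
  | _, r, var x => .assign (3 * r + 2) (.var (3 * x))
  | _, r, lim l => .assign (3 * r + 2) (.var (3 * l + 1))
  | ρ, r, bv k => .assign (3 * r + 2)
      (match ρ[k]? with
        | some q => .var (3 * q + 2)
        | none => .lit 0)
  | ρ, r, get a i => .seq (comp ρ r i) (.assign (3 * r + 2) (.get a (.var (3 * r + 2))))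
  | ρ, r, add e f => .seq (comp ρ r e) (.seq (comp ρ (r + 1) f)
      (.assign (3 * r + 2) (.add (.var (3 * r + 2)) (.var (3 * (r + 1) + 2)))))
  | ρ, r, sub e f => .seq (comp ρ r e) (.seq (comp ρ (r + 1) f)
      (.assign (3 * r + 2) (.sub (.var (3 * r + 2)) (.var (3 * (r + 1) + 2)))))
  | ρ, r, sel c e f => .seq (comp ρ r c) (.ite (.var (3 * r + 2)) (comp ρ r e) (comp ρ r f))
  -- Register `r` collects the result, `r + 1` is both counter and bound variable, and `r + 2`
  -- receives the value of the body.
  | ρ, r, any l e => .seq (.assign (3 * r + 2) (.lit 0)) (.seq (.assign (3 * (r + 1) + 2) (.lit 0))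
      (.loop (.sub (.var (3 * l + 1)) (.var (3 * (r + 1) + 2)))
        (.seq (comp ((r + 1) :: ρ) (r + 2) e)
          (.seq (.ite (.var (3 * (r + 2) + 2)) (.assign (3 * r + 2) (.lit 1)) .skip)
            (.assign (3 * (r + 1) + 2) (.add (.var (3 * (r + 1) + 2)) (.lit 1)))))))

open Polynomial in
/-- A bound on the time to evaluate an expression, in terms of the largest loop bound. -/
noncomputable def time : Ex → Polynomial ℕ
  | lit _ => 2
  | var _ => 2
  | lim _ => 2
  | bv _ => 2
  | get _ i => time i + 3
  | add e f => time e + time f + 4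
  | sub e f => time e + time f + 4
  | sel c e f => time c + time e + time f + 2
  | any _ e => 8 + X * (time e + 12)

end Ex

/-- The machine state `s` represents the memory `m`. -/
structure Sim (m : Mem) (s : RamState) : Prop where
  vars : ∀ x, s.vars (3 * x) = m.vars x
  lims : ∀ l, s.vars (3 * l + 1) = m.lims l
  arrs : s.arrs = m.arrs

/-- Machine variables are split modulo `3`: residue `0` for variables, `1` for loop bounds, `2` for
scratch registers, which a `Mem` does not see. -/
theorem Sim.setScratch {m : Mem} {s : RamState} (h : Sim m s) (r v : ℕ) :
    Sim m (s.setVar (3 * r + 2) v) where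
  vars := fun x => by
    have : 3 * x ≠ 3 * r + 2 := by omega
    simp [RamState.setVar, Function.update_of_ne this, h.vars]
  lims := fun l => by
    have : 3 * l + 1 ≠ 3 * r + 2 := by omega
    simp [RamState.setVar, Function.update_of_ne this, h.lims]
  arrs := h.arrs

/-- A counting loop. -/
theorem RamProg.Runs.count {p : RamProg} {b c n B : ℕ} {I : ℕ → RamState → Prop}
    (step : ∀ k < n, ∀ s : RamState, I k s → s.vars b = n → s.vars c = k →
      ∃ t s', p.Runs s t s' ∧ t ≤ B ∧ I (k + 1) s' ∧ s'.vars b = n ∧ s'.vars c = k + 1)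
    {s : RamState} (h0 : I 0 s) (hb : s.vars b = n) (hc : s.vars c = 0) :
    ∃ t s', (RamProg.loop (.sub (.var b) (.var c)) p).Runs s t s' ∧ t ≤ 4 + n * (B + 4) ∧
      I n s' ∧ s'.vars b = n := by
  -- Induction on the number `d` of rounds left. A test takes `4` steps, `3` for the difference and
  -- `1` for the branch.
  suffices ∀ d k, k + d = n → ∀ s : RamState, I k s → s.vars b = n → s.vars c = k →
      ∃ t s', (RamProg.loop (.sub (.var b) (.var c)) p).Runs s t s' ∧ t ≤ 4 + d * (B + 4) ∧
        I n s' ∧ s'.vars b = n from this n 0 (Nat.zero_add n) s h0 hb hc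
  intro d
  induction d with
  | zero =>
    intro k hk s hI hb hc
    obtain rfl : k = n := hk
    exact ⟨_, s, .loop_false (by simp [RamExpr.value, hb, hc]), by simp [RamExpr.cost], hI, hb⟩
  | succ d ih =>
    intro k hk s hI hb hc
    obtain ⟨t, s', h1, h2, h3, h4, h5⟩ := step k (by omega) s hI hb hc
    obtain ⟨t', s'', k1, k2, k3, k4⟩ := ih (k + 1) (by omega) s' h3 h4 h5
    refine ⟨_, s'', .loop_true ?_ h1 k1, ?_, k3, k4⟩
    · simp only [RamExpr.value, hb, hc]
      omega
    · simp only [RamExpr.cost]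
      rw [Nat.add_mul, Nat.one_mul]
      omega

namespace RamState

@[simp] theorem setVar_self (s : RamState) (x v : ℕ) : (s.setVar x v).vars x = v := by
  simp [setVar]

theorem setVar_ne (s : RamState) {x y : ℕ} (v : ℕ) (h : y ≠ x) :
    (s.setVar x v).vars y = s.vars y := by
  simp [setVar, Function.update_of_ne h]

end RamState

/-- The scratch registers `ρ` hold the values `env` and are below `r`. -/
def EnvOk (s : RamState) (r : ℕ) (ρ env : List ℕ) : Prop :=
  List.Forall₂ (fun q v => q < r ∧ s.vars (3 * q + 2) = v) ρ env

theorem EnvOk.mono {s s' : RamState} {r r' : ℕ} {ρ env : List ℕ} (h : EnvOk s r ρ env)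
    (hr : r ≤ r') (hs : ∀ q < r, s'.vars (3 * q + 2) = s.vars (3 * q + 2)) :
    EnvOk s' r' ρ env :=
  h.imp fun q v ⟨h1, h2⟩ => ⟨by omega, by rw [hs q h1, h2]⟩

theorem EnvOk.value {s : RamState} {r : ℕ} {ρ env : List ℕ} (h : EnvOk s r ρ env) (k : ℕ) :
    (match ρ[k]? with
      | some q => RamExpr.var (3 * q + 2)
      | none => RamExpr.lit 0).value s = env.getD k 0 := by
  induction h generalizing k with
  | nil => simp [RamExpr.value]
  | cons h1 _ ih =>
    cases k with
    | zero => simp [RamExpr.value, h1.2]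
    | succ k => simpa using ih k

theorem EnvOk.cost {ρ : List ℕ} (k : ℕ) :
    (match ρ[k]? with
      | some q => RamExpr.var (3 * q + 2)
      | none => RamExpr.lit 0).cost = 1 := by
  cases ρ[k]? <;> rfl

namespace Ex

/-- Runs of compiled expressions. -/
theorem comp_runs {m : Mem} {N : ℕ} (hN : ∀ l, m.lims l ≤ N) (e : Ex) {ρ env : List ℕ} {r : ℕ}
    {s : RamState} (hs : Sim m s) (he : EnvOk s r ρ env) :
    ∃ t s', (comp ρ r e).Runs s t s' ∧ t ≤ e.time.eval N ∧ Sim m s' ∧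
      (∀ q < r, s'.vars (3 * q + 2) = s.vars (3 * q + 2)) ∧
      s'.vars (3 * r + 2) = e.val m env := by
  have ne : ∀ {q r : ℕ}, q < r → 3 * q + 2 ≠ 3 * r + 2 := by intros; omega
  induction e generalizing ρ env r s with
  | lit n =>
    exact ⟨_, _, .assign _ _ _, by simp [RamExpr.cost, time], hs.setScratch _ _,
      fun q hq => s.setVar_ne _ (ne hq), by simp [RamExpr.value, val]⟩
  | var x =>
    exact ⟨_, _, .assign _ _ _, by simp [RamExpr.cost, time], hs.setScratch _ _,
      fun q hq => s.setVar_ne _ (ne hq), by simp [RamExpr.value, val, hs.vars]⟩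
  | lim l =>
    exact ⟨_, _, .assign _ _ _, by simp [RamExpr.cost, time], hs.setScratch _ _,
      fun q hq => s.setVar_ne _ (ne hq), by simp [RamExpr.value, val, hs.lims]⟩
  | bv k =>
    refine ⟨_, _, .assign _ _ _, ?_, hs.setScratch _ _,
      fun q hq => s.setVar_ne _ (ne hq), ?_⟩
    · rw [EnvOk.cost]
      simp [time]
    · rw [RamState.setVar_self, he.value, val]
  | get a i ih =>
    obtain ⟨t, s', h1, h2, h3, h4, h5⟩ := ih hs he
    refine ⟨_, _, .seq h1 (.assign _ _ _), ?_, h3.setScratch _ _,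
      fun q hq => (s'.setVar_ne _ (ne hq)).trans (h4 q hq), ?_⟩
    · simp only [RamExpr.cost, time, Polynomial.eval_add, Polynomial.eval_ofNat]
      omega
    · simp [RamExpr.value, val, h5, h3.arrs]
  | add e f ihe ihf =>
    obtain ⟨t, s', h1, h2, h3, h4, h5⟩ := ihe hs he
    obtain ⟨t', s'', k1, k2, k3, k4, k5⟩ := ihf h3 (he.mono (Nat.le_succ r) h4)
    refine ⟨_, _, .seq h1 (.seq k1 (.assign _ _ _)), ?_, k3.setScratch _ _, fun q hq =>
      (s''.setVar_ne _ (ne hq)).trans ((k4 q (by omega)).trans (h4 q hq)), ?_⟩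
    · simp only [RamExpr.cost, time, Polynomial.eval_add, Polynomial.eval_ofNat]
      omega
    · simp [RamExpr.value, val, k5, k4 r (Nat.lt_succ_self r), h5]
  | sub e f ihe ihf =>
    obtain ⟨t, s', h1, h2, h3, h4, h5⟩ := ihe hs he
    obtain ⟨t', s'', k1, k2, k3, k4, k5⟩ := ihf h3 (he.mono (Nat.le_succ r) h4)
    refine ⟨_, _, .seq h1 (.seq k1 (.assign _ _ _)), ?_, k3.setScratch _ _, fun q hq =>
      (s''.setVar_ne _ (ne hq)).trans ((k4 q (by omega)).trans (h4 q hq)), ?_⟩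
    · simp only [RamExpr.cost, time, Polynomial.eval_add, Polynomial.eval_ofNat]
      omega
    · simp [RamExpr.value, val, k5, k4 r (Nat.lt_succ_self r), h5]
  | sel c e f ihc ihe ihf =>
    obtain ⟨t, s', h1, h2, h3, h4, h5⟩ := ihc hs he
    by_cases hc : val m env c = 0
    · obtain ⟨t', s'', k1, k2, k3, k4, k5⟩ := ihf h3 (he.mono le_rfl h4)
      refine ⟨_, _, .seq h1 (.ite_false (by simpa [RamExpr.value, h5] using hc) k1), ?_, k3,
        fun q hq => (k4 q hq).trans (h4 q hq), by simp [val, hc, k5]⟩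
      simp only [RamExpr.cost, time, Polynomial.eval_add, Polynomial.eval_ofNat]
      omega
    · obtain ⟨t', s'', k1, k2, k3, k4, k5⟩ := ihe h3 (he.mono le_rfl h4)
      refine ⟨_, _, .seq h1 (.ite_true (by simpa [RamExpr.value, h5] using hc) k1), ?_, k3,
        fun q hq => (k4 q hq).trans (h4 q hq), by simp [val, hc, k5]⟩
      simp only [RamExpr.cost, time, Polynomial.eval_add, Polynomial.eval_ofNat]
      omega
  | any l e ih =>
    classical
    -- After `k` rounds the result register tells whether a value below `k` has succeeded.
    let I : ℕ → RamState → Prop := fun k s' => Sim m s' ∧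
      (∀ q < r, s'.vars (3 * q + 2) = s.vars (3 * q + 2)) ∧
      s'.vars (3 * r + 2) = if ∃ v < k, val m (v :: env) e ≠ 0 then 1 else 0
    have s1 := (hs.setScratch r 0).setScratch (r + 1) 0
    obtain ⟨t, s', h1, h2, ⟨h3, h4, h5⟩, -⟩ := RamProg.Runs.count (n := m.lims l)
      -- The `8` steps are at most `4` for recording a success and `4` for the counter.
      (b := 3 * l + 1) (c := 3 * (r + 1) + 2) (I := I) (B := e.time.eval N + 8)
      (p := .seq (comp ((r + 1) :: ρ) (r + 2) e)
          (.seq (.ite (.var (3 * (r + 2) + 2)) (.assign (3 * r + 2) (.lit 1)) .skip)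
            (.assign (3 * (r + 1) + 2) (.add (.var (3 * (r + 1) + 2)) (.lit 1)))))
      (s := (s.setVar (3 * r + 2) 0).setVar (3 * (r + 1) + 2) 0) (by
        rintro k hk w ⟨w1, w2, w3⟩ hb hc
        obtain ⟨t, w', a1, a2, a3, a4, a5⟩ := ih (ρ := (r + 1) :: ρ) (env := k :: env)
          (r := r + 2) w1 (.cons ⟨by omega, hc⟩ (he.mono (by omega) w2))
        have b1 : w'.vars (3 * (r + 1) + 2) = k := (a4 _ (by omega)).trans hc
        have b2 : w'.vars (3 * r + 2) = _ := (a4 _ (by omega)).trans w3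
        have b3 : ∀ q < r, w'.vars (3 * q + 2) = s.vars (3 * q + 2) := fun q hq =>
          (a4 _ (by omega)).trans (w2 q hq)
        have sp : (∃ v < k + 1, val m (v :: env) e ≠ 0) ↔
            (∃ v < k, val m (v :: env) e ≠ 0) ∨ val m (k :: env) e ≠ 0 := by
          constructor
          · rintro ⟨v, hv, hv'⟩
            rcases Nat.lt_succ_iff_lt_or_eq.1 hv with h | rfl
            · exact Or.inl ⟨v, h, hv'⟩
            · exact Or.inr hv'
          · rintro (⟨v, hv, hv'⟩ | h)
            · exact ⟨v, by omega, hv'⟩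
            · exact ⟨k, by omega, h⟩
        by_cases hv : val m (k :: env) e = 0
        · refine ⟨_, _, .seq a1 (.seq (.ite_false (by simpa [RamExpr.value, a5] using hv)
            (.skip _)) (.assign _ _ _)), ?_, ⟨a3.setScratch _ _, fun q hq => ?_, ?_⟩, ?_, ?_⟩
          · simp only [RamExpr.cost]
            omega
          · rw [RamState.setVar_ne _ _ (by omega), b3 q hq]
          · rw [RamState.setVar_ne _ _ (by omega), b2]
            simp only [sp, hv, ne_eq, not_true_eq_false, or_false]
          · rw [RamState.setVar_ne _ _ (by omega), a3.lims]
          · simp [RamExpr.value, b1]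
        · refine ⟨_, _, .seq a1 (.seq (.ite_true (by simpa [RamExpr.value, a5] using hv)
            (.assign _ _ _)) (.assign _ _ _)), ?_,
            ⟨(a3.setScratch _ _).setScratch _ _, fun q hq => ?_, ?_⟩, ?_, ?_⟩
          · simp only [RamExpr.cost]
            omega
          · rw [RamState.setVar_ne _ _ (by omega), RamState.setVar_ne _ _ (by omega), b3 q hq]
          · rw [RamState.setVar_ne _ _ (by omega), RamState.setVar_self,
              if_pos (sp.2 (Or.inr hv))]
            rfl
          · rw [RamState.setVar_ne _ _ (by omega), RamState.setVar_ne _ _ (by omega), a3.lims]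
          · rw [RamState.setVar_self]
            simp only [RamExpr.value]
            rw [RamState.setVar_ne _ _ (by omega), b1])
      ⟨s1, fun q hq => by
        rw [RamState.setVar_ne _ _ (by omega), RamState.setVar_ne _ _ (by omega)], by
        rw [RamState.setVar_ne _ _ (by omega)]
        simp⟩ (s1.lims l) (by simp)
    refine ⟨_, s', .seq (.assign _ _ _) (.seq (.assign _ _ _) h1), ?_, h3, h4, h5⟩
    have : m.lims l * (e.time.eval N + 12) ≤ N * (e.time.eval N + 12) :=
      Nat.mul_le_mul_right _ (hN l)
    simp only [RamExpr.cost, time, Polynomial.eval_add, Polynomial.eval_mul, Polynomial.eval_X,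
      Polynomial.eval_ofNat]
    have e8 : e.time.eval N + 8 + 4 = e.time.eval N + 12 := by ring
    rw [e8] at h2
    omega

end Ex

/-- For-programs: `forTo x l p` runs `p` for `x = 0, 1, …` below the bound `l`, and `fill l a e`
sets the entries of the array `a` with index below the bound `l` to the values of `e`. -/
inductive Pg where
  | assign (x : ℕ) (e : Ex)
  | store (a : ℕ) (i e : Ex)
  | fill (l a : ℕ) (e : Ex)
  | seq (p q : Pg)
  | ite (c : Ex) (p q : Pg)
  | skip
  | forTo (x l : ℕ) (p : Pg)

/-- Iterate `f 0`, `f 1`, …, `f (n - 1)`. -/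
def iter {M : Type*} (f : ℕ → M → M) : ℕ → M → M
  | 0, m => m
  | n + 1, m => f n (iter f n m)

theorem iter_induction {M : Type*} {f : ℕ → M → M} {n : ℕ} {m : M} (I : ℕ → M → Prop)
    (h0 : I 0 m) (hs : ∀ k < n, ∀ m', I k m' → I (k + 1) (f k m')) : I n (iter f n m) := by
  suffices ∀ k ≤ n, I k (iter f k m) from this n le_rfl
  intro k
  induction k with
  | zero => exact fun _ => h0
  | succ k ih => exact fun hk => hs k (by omega) _ (ih (by omega))

/-! ### Semantics, compilation and running time of for-programs -/

namespace Pg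

/-- The effect of a program. -/
noncomputable def eval : Pg → Mem → Mem
  | assign x e, m => m.setVar x (e.val m [])
  | store a i e, m => m.setArr a (Function.update (m.arrs a) (i.val m []) (e.val m []))
  | fill l a e, m => m.setArr a fun v => if v < m.lims l then e.val m [v] else m.arrs a v
  | seq p q, m => eval q (eval p m)
  | ite c p q, m => if c.val m [] ≠ 0 then eval p m else eval q m
  | skip, m => m
  | forTo x l p, m => iter (fun k m' => eval p (m'.setVar x k)) (m.lims l) m

/-- The expressions used to fill an array do not read that array. -/
def ok : Pg → Bool
  | assign _ _ => true
  | store _ _ _ => true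
  | fill _ a e => !(e.reads.contains a)
  | seq p q => ok p && ok q
  | ite _ p q => ok p && ok q
  | skip => true
  | forTo _ _ p => ok p

/-- The variables that a program sets. -/
def setsVar : Pg → List ℕ
  | assign x _ => [x]
  | store _ _ _ => []
  | fill _ _ _ => []
  | seq p q => setsVar p ++ setsVar q
  | ite _ p q => setsVar p ++ setsVar q
  | skip => []
  | forTo x _ p => x :: setsVar p

/-- The arrays that a program writes. -/
def setsArr : Pg → List ℕ
  | assign _ _ => []
  | store a _ _ => [a]
  | fill _ a _ => [a]
  | seq p q => setsArr p ++ setsArr q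
  | ite _ p q => setsArr p ++ setsArr q
  | skip => []
  | forTo _ _ p => setsArr p

/-- Loop bounds cannot change during a run; this is why the time is a polynomial in the largest
bound that can be read off the program text. -/
theorem eval_lims (p : Pg) (m : Mem) : (p.eval m).lims = m.lims := by
  induction p generalizing m with
  | assign x e => rfl
  | store a i e => rfl
  | fill l a e => rfl
  | seq p q ihp ihq => simp only [eval, ihp, ihq]
  | ite c p q ihp ihq =>
    simp only [eval]
    split_ifs
    · exact ihp m
    · exact ihq m
  | skip => rfl
  | forTo x l p ih =>
    exact iter_induction (fun _ (m' : Mem) => m'.lims = m.lims) rfl fun k _ m' h => (ih _).trans h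

theorem eval_vars (p : Pg) (m : Mem) {y : ℕ} (hy : y ∉ p.setsVar) :
    (p.eval m).vars y = m.vars y := by
  induction p generalizing m with
  | assign x e =>
    simp only [setsVar, List.mem_singleton] at hy
    simp [eval, Mem.setVar, Function.update_of_ne hy]
  | store a i e => rfl
  | fill l a e => rfl
  | seq p q ihp ihq =>
    simp only [setsVar, List.mem_append, not_or] at hy
    simp only [eval, ihp _ hy.1, ihq _ hy.2]
  | ite c p q ihp ihq =>
    simp only [setsVar, List.mem_append, not_or] at hy
    simp only [eval]
    split_ifs
    · exact ihp m hy.1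
    · exact ihq m hy.2
  | skip => rfl
  | forTo x l p ih =>
    simp only [setsVar, List.mem_cons, not_or] at hy
    exact iter_induction (fun _ (m' : Mem) => m'.vars y = m.vars y) rfl fun k _ m' h =>
      (ih _ hy.2).trans ((Function.update_of_ne hy.1 _ _).trans h)

theorem eval_arrs (p : Pg) (m : Mem) {b : ℕ} (hb : b ∉ p.setsArr) :
    (p.eval m).arrs b = m.arrs b := by
  induction p generalizing m with
  | assign x e => rfl
  | store a i e =>
    simp only [setsArr, List.mem_singleton] at hb
    simp [eval, Mem.setArr, Function.update_of_ne hb]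
  | fill l a e =>
    simp only [setsArr, List.mem_singleton] at hb
    simp [eval, Mem.setArr, Function.update_of_ne hb]
  | seq p q ihp ihq =>
    simp only [setsArr, List.mem_append, not_or] at hb
    simp only [eval, ihp _ hb.1, ihq _ hb.2]
  | ite c p q ihp ihq =>
    simp only [setsArr, List.mem_append, not_or] at hb
    simp only [eval]
    split_ifs
    · exact ihp m hb.1
    · exact ihq m hb.2
  | skip => rfl
  | forTo x l p ih =>
    simp only [setsArr] at hb
    exact iter_induction (fun _ (m' : Mem) => m'.arrs b = m.arrs b) rfl fun k _ m' h =>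
      (ih _ hb).trans h

/-- Compilation, with scratch registers from `r` on. -/
def comp : ℕ → Pg → RamProg
  | r, assign x e => .seq (e.comp [] r) (.assign (3 * x) (.var (3 * r + 2)))
  | r, store a i e => .seq (i.comp [] r) (.seq (e.comp [] (r + 1))
      (.store a (.var (3 * r + 2)) (.var (3 * (r + 1) + 2))))
  | r, fill l a e => .seq (.assign (3 * r + 2) (.lit 0))
      (.loop (.sub (.var (3 * l + 1)) (.var (3 * r + 2)))
        (.seq (e.comp [r] (r + 1)) (.seq
          (.store a (.var (3 * r + 2)) (.var (3 * (r + 1) + 2)))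
          (.assign (3 * r + 2) (.add (.var (3 * r + 2)) (.lit 1))))))
  | r, seq p q => .seq (comp r p) (comp r q)
  | r, ite c p q => .seq (c.comp [] r) (.ite (.var (3 * r + 2)) (comp r p) (comp r q))
  | _, skip => .skip
  | r, forTo x l p => .seq (.assign (3 * r + 2) (.lit 0))
      (.loop (.sub (.var (3 * l + 1)) (.var (3 * r + 2)))
        (.seq (.assign (3 * x) (.var (3 * r + 2))) (.seq (comp (r + 1) p)
          (.assign (3 * r + 2) (.add (.var (3 * r + 2)) (.lit 1))))))

open Polynomial in
/-- A bound on the time to run a program, in terms of the largest loop bound. -/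
noncomputable def time : Pg → Polynomial ℕ
  | assign _ e => e.time + 2
  | store _ i e => i.time + e.time + 3
  | fill _ _ e => 6 + X * (e.time + 11)
  | seq p q => time p + time q
  | ite c p q => c.time + time p + time q + 2
  | skip => 1
  | forTo _ _ p => 6 + X * (time p + 10)

theorem _root_.Sim.setVar {m : Mem} {s : RamState} (h : Sim m s) (x v : ℕ) :
    Sim (m.setVar x v) (s.setVar (3 * x) v) where
  vars := fun y => by
    by_cases hy : y = x
    · subst hy
      simp [Mem.setVar]
    · rw [RamState.setVar_ne _ _ (by omega), h.vars]
      simp [Mem.setVar, Function.update_of_ne hy]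
  lims := fun l => by
    rw [RamState.setVar_ne _ _ (by omega), h.lims]
    rfl
  arrs := h.arrs

theorem _root_.Sim.setLim {m : Mem} {s : RamState} (h : Sim m s) (l v : ℕ) :
    Sim (m.setLim l v) (s.setVar (3 * l + 1) v) where
  vars := fun y => by
    rw [RamState.setVar_ne _ _ (by omega), h.vars]
    rfl
  lims := fun y => by
    by_cases hy : y = l
    · subst hy
      simp [Mem.setLim]
    · rw [RamState.setVar_ne _ _ (by omega), h.lims]
      simp [Mem.setLim, Function.update_of_ne hy]
  arrs := h.arrs

theorem _root_.Sim.setArr {m : Mem} {s : RamState} (h : Sim m s) (a i v : ℕ) :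
    Sim (m.setArr a (Function.update (m.arrs a) i v)) (s.setArr a i v) where
  vars := h.vars
  lims := h.lims
  arrs := by simp [RamState.setArr, Mem.setArr, h.arrs]

/-- Runs of compiled programs. -/
theorem comp_runs {N : ℕ} (p : Pg) {m : Mem} (hN : ∀ l, m.lims l ≤ N) (hp : p.ok = true)
    {r : ℕ} {s : RamState} (hs : Sim m s) :
    ∃ t s', (comp r p).Runs s t s' ∧ t ≤ p.time.eval N ∧ Sim (p.eval m) s' ∧
      ∀ q < r, s'.vars (3 * q + 2) = s.vars (3 * q + 2) := by
  induction p generalizing m r s with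
  | assign x e =>
    obtain ⟨t, s', h1, h2, h3, h4, h5⟩ := e.comp_runs hN (r := r) hs .nil
    refine ⟨_, _, .seq h1 (.assign _ _ _), ?_, ?_, fun q hq => ?_⟩
    · simp only [RamExpr.cost, time, Polynomial.eval_add, Polynomial.eval_ofNat]
      omega
    · simp only [RamExpr.value, h5, eval]
      exact h3.setVar _ _
    · rw [RamState.setVar_ne _ _ (by omega), h4 q hq]
  | store a i e =>
    obtain ⟨t, s', h1, h2, h3, h4, h5⟩ := i.comp_runs hN (r := r) hs .nil
    obtain ⟨t', s'', k1, k2, k3, k4, k5⟩ := e.comp_runs hN (r := r + 1) h3 .nil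
    refine ⟨_, _, .seq h1 (.seq k1 (.store _ _ _ _)), ?_, ?_, fun q hq => ?_⟩
    · simp only [RamExpr.cost, time, Polynomial.eval_add, Polynomial.eval_ofNat]
      omega
    · simp only [RamExpr.value, k5, k4 r (Nat.lt_succ_self r), h5, eval]
      exact k3.setArr _ _ _
    · exact (k4 q (by omega)).trans (h4 q hq)
  | fill l a e =>
    simp only [ok, List.contains_iff_mem, Bool.not_eq_true', Bool.eq_false_iff, ne_eq] at hp
    -- The memory in which the first `k` entries of `a` have been filled. The values of `e` are the
    -- same as in `m`, since `e` does not read `a`.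
    let mk : ℕ → Mem := fun k => m.setArr a fun v => if v < k then e.val m [v] else m.arrs a v
    have hmk : ∀ k env, e.val (mk k) env = e.val m env := fun k env =>
      Ex.val_congr (m := mk k) (m' := m) rfl rfl e (fun b hb => by
        have : b ≠ a := by rintro rfl; exact hp hb
        simp [mk, Mem.setArr, Function.update_of_ne this]) env
    have hm0 : mk 0 = m := by simp [mk, Mem.setArr]
    have hms : ∀ k, (mk k).setArr a (Function.update ((mk k).arrs a) k (e.val m [k])) =
        mk (k + 1) := by
      intro k
      simp only [mk, Mem.setArr, Function.update_self, Function.update_idem, Mem.mk.injEq,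
        true_and]
      congr 1
      funext v
      rcases Nat.lt_trichotomy v k with hv | hv | hv
      · rw [Function.update_of_ne (by omega), if_pos hv, if_pos (by omega)]
      · rw [hv, Function.update_self, if_pos (by omega)]
      · rw [Function.update_of_ne (by omega), if_neg (by omega), if_neg (by omega)]
    let I : ℕ → RamState → Prop := fun k s' => Sim (mk k) s' ∧
      ∀ q < r, s'.vars (3 * q + 2) = s.vars (3 * q + 2)
    obtain ⟨t, s', h1, h2, ⟨h3, h4⟩, -⟩ := RamProg.Runs.count (n := m.lims l)
      (b := 3 * l + 1) (c := 3 * r + 2) (I := I) (B := e.time.eval N + 7)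
      (p := .seq (e.comp [r] (r + 1)) (.seq
          (.store a (.var (3 * r + 2)) (.var (3 * (r + 1) + 2)))
          (.assign (3 * r + 2) (.add (.var (3 * r + 2)) (.lit 1)))))
      (s := s.setVar (3 * r + 2) 0) (by
        rintro k hk w ⟨w1, w2⟩ hb hc
        obtain ⟨t, w', a1, a2, a3, a4, a5⟩ := e.comp_runs (m := mk k) hN (ρ := [r]) (env := [k])
          (r := r + 1) w1 (.cons ⟨by omega, hc⟩ .nil)
        rw [hmk] at a5
        have b1 : w'.vars (3 * r + 2) = k := (a4 _ (by omega)).trans hc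
        refine ⟨_, _, .seq a1 (.seq (.store _ _ _ _) (.assign _ _ _)), ?_,
          ⟨Sim.setScratch ?_ _ _, fun q hq => ?_⟩, ?_, ?_⟩
        · simp only [RamExpr.cost]
          omega
        · simp only [RamExpr.value, a5, b1]
          rw [← hms]
          exact a3.setArr _ _ _
        · rw [RamState.setVar_ne _ _ (by omega)]
          exact (a4 q (by omega)).trans (w2 q hq)
        · rw [RamState.setVar_ne _ _ (by omega)]
          exact a3.lims l
        · simp [RamExpr.value, RamState.setArr, b1])
      ⟨by rw [hm0]; exact hs.setScratch _ _, fun q hq => RamState.setVar_ne _ _ (by omega)⟩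
      ((hs.setScratch r 0).lims l) (by simp)
    refine ⟨_, s', .seq (.assign _ _ _) h1, ?_, h3, h4⟩
    have : m.lims l * (e.time.eval N + 11) ≤ N * (e.time.eval N + 11) :=
      Nat.mul_le_mul_right _ (hN l)
    simp only [RamExpr.cost, time, Polynomial.eval_add, Polynomial.eval_mul, Polynomial.eval_X,
      Polynomial.eval_ofNat]
    have e8 : e.time.eval N + 7 + 4 = e.time.eval N + 11 := by ring
    rw [e8] at h2
    omega
  | seq p q ihp ihq =>
    simp only [ok, Bool.and_eq_true] at hp
    obtain ⟨t, s', h1, h2, h3, h4⟩ := ihp hN hp.1 (r := r) hs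
    obtain ⟨t', s'', k1, k2, k3, k4⟩ := ihq (by rw [eval_lims]; exact hN) hp.2 (r := r) h3
    refine ⟨_, _, .seq h1 k1, ?_, k3, fun q hq => (k4 q hq).trans (h4 q hq)⟩
    simp only [time, Polynomial.eval_add]
    omega
  | ite c p q ihp ihq =>
    simp only [ok, Bool.and_eq_true] at hp
    obtain ⟨t, s', h1, h2, h3, h4, h5⟩ := c.comp_runs hN (r := r) hs .nil
    by_cases hc : c.val m [] = 0
    · obtain ⟨t', s'', k1, k2, k3, k4⟩ := ihq hN hp.2 (r := r) h3
      refine ⟨_, _, .seq h1 (.ite_false (by simpa [RamExpr.value, h5] using hc) k1), ?_,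
        by simpa [eval, hc] using k3, fun q hq => (k4 q hq).trans (h4 q hq)⟩
      simp only [RamExpr.cost, time, Polynomial.eval_add, Polynomial.eval_ofNat]
      omega
    · obtain ⟨t', s'', k1, k2, k3, k4⟩ := ihp hN hp.1 (r := r) h3
      refine ⟨_, _, .seq h1 (.ite_true (by simpa [RamExpr.value, h5] using hc) k1), ?_,
        by simpa [eval, hc] using k3, fun q hq => (k4 q hq).trans (h4 q hq)⟩
      simp only [RamExpr.cost, time, Polynomial.eval_add, Polynomial.eval_ofNat]
      omega
  | skip => exact ⟨_, s, .skip s, by simp [time], hs, fun _ _ => rfl⟩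
  | forTo x l p ih =>
    simp only [ok] at hp
    let mk : ℕ → Mem := fun k => iter (fun k m' => eval p (m'.setVar x k)) k m
    have hmk : ∀ k, (mk k).lims = m.lims := fun k =>
      iter_induction (fun _ (m' : Mem) => m'.lims = m.lims) rfl fun k _ m' h => (eval_lims p _).trans h
    let I : ℕ → RamState → Prop := fun k s' => Sim (mk k) s' ∧
      ∀ q < r, s'.vars (3 * q + 2) = s.vars (3 * q + 2)
    obtain ⟨t, s', h1, h2, ⟨h3, h4⟩, -⟩ := RamProg.Runs.count (n := m.lims l)
      (b := 3 * l + 1) (c := 3 * r + 2) (I := I) (B := p.time.eval N + 6)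
      (p := .seq (.assign (3 * x) (.var (3 * r + 2))) (.seq (comp (r + 1) p)
          (.assign (3 * r + 2) (.add (.var (3 * r + 2)) (.lit 1)))))
      (s := s.setVar (3 * r + 2) 0) (by
        rintro k hk w ⟨w1, w2⟩ hb hc
        obtain ⟨t, w', a1, a2, a3, a4⟩ := ih (m := (mk k).setVar x k)
          (by show ∀ l, (mk k).lims l ≤ N; rw [hmk]; exact hN) hp (r := r + 1) (w1.setVar x k)
        have b1 : w'.vars (3 * r + 2) = k :=
          ((a4 _ (by omega)).trans (RamState.setVar_ne _ _ (by omega))).trans hc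
        refine ⟨_, _, .seq (.assign _ _ _) (.seq (s' := w') (t := t) ?_ (.assign _ _ _)), ?_,
          ⟨a3.setScratch _ _, fun q hq => ?_⟩, ?_, ?_⟩
        · simp only [RamExpr.value, hc]
          exact a1
        · simp only [RamExpr.cost]
          omega
        · rw [RamState.setVar_ne _ _ (by omega), a4 q (by omega),
            RamState.setVar_ne _ _ (by omega), w2 q hq]
        · rw [RamState.setVar_ne _ _ (by omega), a3.lims, eval_lims]
          exact congrFun (hmk k) l
        · simp [RamExpr.value, b1])
      ⟨hs.setScratch _ _, fun q hq => RamState.setVar_ne _ _ (by omega)⟩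
      ((hs.setScratch r 0).lims l) (by simp)
    refine ⟨_, s', .seq (.assign _ _ _) h1, ?_, h3, h4⟩
    have : m.lims l * (p.time.eval N + 10) ≤ N * (p.time.eval N + 10) :=
      Nat.mul_le_mul_right _ (hN l)
    simp only [RamExpr.cost, time, Polynomial.eval_add, Polynomial.eval_mul, Polynomial.eval_X,
      Polynomial.eval_ofNat]
    have e8 : p.time.eval N + 6 + 4 = p.time.eval N + 10 := by ring
    rw [e8] at h2
    omega

end Pg

/-! ### Formulas, pairing, and the program for the homomorphism test -/

namespace Ex

def and (e f : Ex) : Ex := sel e f (lit 0)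
def not (e : Ex) : Ex := sel e (lit 0) (lit 1)
def imp (e f : Ex) : Ex := sel e f (lit 1)
-- Both truncated differences vanish only at equality. In `lt` a single difference serves as truth
-- value, every nonzero number counting as true.
def eq (e f : Ex) : Ex := sel (add (sub e f) (sub f e)) (lit 0) (lit 1)
def lt (e f : Ex) : Ex := sub f e
def all (l : ℕ) (e : Ex) : Ex := not (any l (not e))

/-- The expression is not `0`. -/
def Holds (m : Mem) (env : List ℕ) (e : Ex) : Prop := e.val m env ≠ 0

variable {m : Mem} {env : List ℕ} {e f : Ex} {l : ℕ}

theorem holds_and : (e.and f).Holds m env ↔ e.Holds m env ∧ f.Holds m env := by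
  simp only [Holds, and, val]
  split_ifs with h <;> simp [h]

theorem holds_not : e.not.Holds m env ↔ ¬ e.Holds m env := by
  simp only [Holds, not, val]
  split_ifs with h <;> simp [h]

theorem holds_imp : (e.imp f).Holds m env ↔ (e.Holds m env → f.Holds m env) := by
  simp only [Holds, imp, val]
  split_ifs with h <;> simp [h]

theorem holds_eq : (e.eq f).Holds m env ↔ e.val m env = f.val m env := by
  have h : (e.eq f).val m env = if e.val m env - f.val m env + (f.val m env - e.val m env) ≠ 0
    then 0 else 1 := rfl
  rw [Holds, h]
  by_cases h : e.val m env = f.val m env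
  · simp [h]
  · rw [if_pos (by omega)]
    simp [h]

theorem holds_lt : (e.lt f).Holds m env ↔ e.val m env < f.val m env := by
  simp only [Holds, lt, val]
  omega

theorem holds_any : (any l e).Holds m env ↔ ∃ v < m.lims l, e.Holds m (v :: env) := by
  simp only [Holds, val]
  split_ifs with h <;> simp [h]

theorem holds_all : (all l e).Holds m env ↔ ∀ v < m.lims l, e.Holds m (v :: env) := by
  simp only [all, holds_not, holds_any]
  push Not
  rfl

theorem val_sel {c : Ex} (h : c.Holds m env) : (sel c e f).val m env = e.val m env := if_pos h

theorem val_sel_not {c : Ex} (h : ¬ c.Holds m env) : (sel c e f).val m env = f.val m env :=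
  if_neg h

/-- First component of a number read in base `W`. -/
def fst (e : Ex) : Ex := get 1 e
/-- Second component of a number read in base `W`. -/
def snd (e : Ex) : Ex := get 2 e
/-- The number with given components in base `W`. -/
def cell (i c : Ex) : Ex := add (get 3 i) c

end Ex

theorem Pg.eval_ite_pos {c : Ex} {p q : Pg} {m : Mem} (h : c.Holds m []) :
    (Pg.ite c p q).eval m = p.eval m := if_pos h

theorem Pg.eval_ite_neg {c : Ex} {p q : Pg} {m : Mem} (h : ¬ c.Holds m []) :
    (Pg.ite c p q).eval m = q.eval m := if_neg h

theorem Pg.eval_seq (p q : Pg) (m : Mem) : (Pg.seq p q).eval m = q.eval (p.eval m) := rfl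

theorem Pg.eval_fill_self {l a : ℕ} {e : Ex} {m : Mem} {v : ℕ} (h : v < m.lims l) :
    ((Pg.fill l a e).eval m).arrs a v = e.val m [v] := by
  simp [eval, Mem.setArr, h]

/-- The loop bounds `2, …, 5` are the powers of `W`, and the arrays `1, 2, 3` hold quotients,
remainders and multiples. -/
structure Geo (W : ℕ) (m : Mem) : Prop where
  pos : 0 < W
  lim2 : m.lims 2 = W
  lim3 : m.lims 3 = W * W
  lim5 : m.lims 5 = W * W * W * W
  fst : ∀ x < W * W * W, ∀ y < W, m.arrs 1 (x * W + y) = x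
  snd : ∀ x < W * W * W, ∀ y < W, m.arrs 2 (x * W + y) = y
  mul : ∀ x < W * W * W, m.arrs 3 x = x * W

theorem mul_add_lt_mul {x y A W : ℕ} (hx : x < A) (hy : y < W) : x * W + y < A * W := by
  have : (x + 1) * W ≤ A * W := Nat.mul_le_mul_right _ hx
  rw [Nat.add_mul] at this
  omega

theorem Geo.of_eq {W : ℕ} {m m' : Mem} (h : Geo W m) (hl : m'.lims = m.lims)
    (h1 : m'.arrs 1 = m.arrs 1) (h2 : m'.arrs 2 = m.arrs 2) (h3 : m'.arrs 3 = m.arrs 3) :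
    Geo W m' where
  pos := h.pos
  lim2 := by rw [hl, h.lim2]
  lim3 := by rw [hl, h.lim3]
  lim5 := by rw [hl, h.lim5]
  fst := by rw [h1]; exact h.fst
  snd := by rw [h2]; exact h.snd
  mul := by rw [h3]; exact h.mul

/-- The numbers of the arrays that hold a table. -/
structure TabName where
  r : ℕ
  a : ℕ
  g : ℕ

/-- The table in given arrays. -/
def Mem.tab (m : Mem) (k : TabName) : Tab := ⟨m.arrs k.r, m.arrs k.a, m.arrs k.g⟩

/-! ### The homomorphism test as a for-program -/

namespace Pg

open Ex

/-- The initial constraints of the homomorphism test. -/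
def compatE (S T : TabName) : Ex :=
  and (eq (get S.r (fst (fst (fst (bv 0))))) (get T.r (snd (fst (fst (bv 0))))))
    (and (eq (get S.r (snd (fst (bv 0)))) (get T.r (snd (bv 0))))
      (all 2 (all 2 (imp (lt (bv 1) (get S.a (fst (fst (fst (bv 2))))))
        (imp (lt (bv 0) (get S.a (snd (fst (bv 2)))))
          (imp (eq (get S.g (cell (fst (fst (fst (bv 2)))) (bv 1)))
              (get S.g (cell (snd (fst (bv 2))) (bv 0))))
            (eq (get T.g (cell (snd (fst (fst (bv 2)))) (bv 1)))
              (get T.g (cell (snd (bv 2)) (bv 0))))))))))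

/-- The constraints that are left after the elimination of row `var 7`. -/
def elimE : Ex :=
  and (get 4 (bv 0))
    (any 2 (and (get 4 (cell (cell (cell (var 7) (bv 0)) (var 7)) (bv 0)))
      (and (get 4 (cell (cell (fst (fst (bv 1))) (var 7)) (bv 0)))
        (get 4 (cell (cell (cell (snd (fst (bv 1))) (snd (bv 1))) (var 7)) (bv 0))))))

/-- Set variable `v` to a number other than `0` if there is a homomorphism from the table `S` to
the table `T`, and to `0` if not. -/
def homP (S T : TabName) (v : ℕ) : Pg :=
  .seq (.fill 5 4 (compatE S T)) (.seq
    (.forTo 6 2 (.seq (.assign 7 (.sub (.sub (.lim 2) (.lit 1)) (.var 6)))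
      (.ite (.get S.r (.var 7)) (.seq (.fill 5 5 elimE) (.fill 5 4 (.get 5 (.bv 0)))) .skip)))
    (.assign v (.get 4 (.lit 0))))

variable {W : ℕ} {m : Mem} {S T : TabName}

/-- Array `4` holds the constraints `R`. -/
def Holds4 (W : ℕ) (m : Mem) (R : ℕ → ℕ → ℕ → ℕ → Prop) : Prop :=
  ∀ i < W, ∀ a < W, ∀ i' < W, ∀ a' < W,
    (m.arrs 4 (((i * W + a) * W + i') * W + a') ≠ 0 ↔ R i a i' a')

/-- A quadruple of rows is a four-digit number in base `W`, and the nested `fst` and `snd` extract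
its digits. -/
theorem compatE_holds (hg : Geo W m) {i a i' a' : ℕ} (hi : i < W) (ha : a < W) (hi' : i' < W)
    (ha' : a' < W) : (compatE S T).Holds m [((i * W + a) * W + i') * W + a'] ↔
      Tab.Compat W (m.tab S) (m.tab T) i a i' a' := by
  have hW := hg.pos
  have b1 : i < W * W * W := by nlinarith [Nat.mul_pos hW hW]
  have b1' : i' < W * W * W := by nlinarith [Nat.mul_pos hW hW]
  have b1a : a < W * W * W := by nlinarith [Nat.mul_pos hW hW]
  have b1a' : a' < W * W * W := by nlinarith [Nat.mul_pos hW hW]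
  have b2 : i * W + a < W * W := mul_add_lt_mul hi ha
  have b3 : (i * W + a) * W + i' < W * W * W := mul_add_lt_mul b2 hi'
  have b4 : i * W + a < W * W * W := by nlinarith
  have e1 := hg.fst _ b3 _ ha'
  have e2 := hg.snd _ b3 _ ha'
  have e3 := hg.fst _ b4 _ hi'
  have e4 := hg.snd _ b4 _ hi'
  have e5 := hg.fst _ b1 _ ha
  have e6 := hg.snd _ b1 _ ha
  simp only [compatE, holds_and, holds_eq, holds_all, holds_imp, holds_lt, Ex.fst, Ex.snd, cell,
    val, List.getD_cons_zero, List.getD_cons_succ, e1, e2, e3, e4, e5, e6, hg.lim2,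
    hg.mul i b1, hg.mul i' b1', hg.mul a b1a, hg.mul a' b1a', Tab.Compat, Mem.tab]

theorem elimE_holds (hg : Geo W m) {R : ℕ → ℕ → ℕ → ℕ → Prop} (hR : Holds4 W m R)
    (h7 : m.vars 7 < W) {i a i' a' : ℕ} (hi : i < W) (ha : a < W) (hi' : i' < W)
    (ha' : a' < W) : elimE.Holds m [((i * W + a) * W + i') * W + a'] ↔
      R i a i' a' ∧ ∃ b < W, R (m.vars 7) b (m.vars 7) b ∧ R i a (m.vars 7) b ∧
        R i' a' (m.vars 7) b := by
  have hW := hg.pos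
  have lt1 : ∀ {x}, x < W → x < W * W * W := fun h => by nlinarith [Nat.mul_pos hW hW]
  have lt2 : ∀ {x}, x < W * W → x < W * W * W := fun h => by nlinarith
  have b2 : i * W + a < W * W := mul_add_lt_mul hi ha
  have b2' : i' * W + a' < W * W := mul_add_lt_mul hi' ha'
  have b3 : (i * W + a) * W + i' < W * W * W := mul_add_lt_mul b2 hi'
  have e1 := hg.fst _ b3 _ ha'
  have e2 := hg.snd _ b3 _ ha'
  have e3 := hg.fst _ (lt2 b2) _ hi'
  have e4 := hg.snd _ (lt2 b2) _ hi'
  simp only [elimE, holds_and, holds_any, hg.lim2]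
  refine and_congr (hR i hi a ha i' hi' a' ha') (exists_congr fun b => and_congr_right fun hb => ?_)
  have f1 := hg.mul _ (lt1 h7)
  have f2 := hg.mul _ (lt2 (mul_add_lt_mul h7 hb))
  have f3 := hg.mul _ (mul_add_lt_mul (mul_add_lt_mul h7 hb) h7)
  have f4 := hg.mul _ (lt2 b2)
  have f5 := hg.mul _ (mul_add_lt_mul b2 h7)
  have f6 := hg.mul _ (lt1 hi')
  have f7 := hg.mul _ (lt2 b2')
  have f8 := hg.mul _ (mul_add_lt_mul b2' h7)
  simp only [Ex.Holds, Ex.fst, Ex.snd, cell, val, List.getD_cons_zero, List.getD_cons_succ, e1,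
    e2, e3, e4, f1, f2, f3, f4, f5, f6, f7, f8]
  rw [hR _ h7 _ hb _ h7 _ hb, hR _ hi _ ha _ h7 _ hb, hR _ hi' _ ha' _ h7 _ hb]

theorem tab_eval (p : Pg) (m : Mem) {k : TabName} (h1 : k.r ∉ p.setsArr) (h2 : k.a ∉ p.setsArr)
    (h3 : k.g ∉ p.setsArr) : (p.eval m).tab k = m.tab k := by
  simp only [Mem.tab, eval_arrs p m h1, eval_arrs p m h2, eval_arrs p m h3]

/-- After `k` rounds array `4` holds `Tab.elim` for `k`; its entry `0` codes the head row sent to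
the head row. Each round goes through array `5`, as `fill` must not read what it writes. `S` is
consulted in every round and so must avoid these arrays, while `T` is read only at the start. -/
theorem homP_spec (hg : Geo W m) {v : ℕ} (hS : 5 < S.r ∧ 5 < S.a ∧ 5 < S.g) :
    ((homP S T v).eval m).vars v ≠ 0 ↔ Tab.elim W (m.tab S) (m.tab T) W 0 0 0 0 := by
  have hW := hg.pos
  have idx : ∀ {i a i' a'}, i < W → a < W → i' < W → a' < W →
      ((i * W + a) * W + i') * W + a' < W * W * W * W := fun hi ha hi' ha' =>
    mul_add_lt_mul (mul_add_lt_mul (mul_add_lt_mul hi ha) hi') ha'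
  let I : ℕ → Mem → Prop := fun k m' => Geo W m' ∧ m'.tab S = m.tab S ∧
    Holds4 W m' (Tab.elim W (m.tab S) (m.tab T) k)
  have tabS : ∀ p : Pg, p.setsArr ⊆ [4, 5] → ∀ m', (p.eval m').tab S = m'.tab S := by
    intro p hp m'
    have key : ∀ x, 5 < x → x ∉ p.setsArr := fun x hx hx' => by
      have := hp hx'
      simp only [List.mem_cons, List.not_mem_nil, or_false] at this
      omega
    exact tab_eval _ _ (key _ hS.1) (key _ hS.2.1) (key _ hS.2.2)
  have geo : ∀ p : Pg, p.setsArr ⊆ [4, 5] → ∀ m', Geo W m' → Geo W (p.eval m') := by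
    intro p hp m' h
    have key : ∀ x, x < 4 → x ∉ p.setsArr := fun x hx hx' => by
      have := hp hx'
      simp only [List.mem_cons, List.not_mem_nil, or_false] at this
      omega
    exact h.of_eq (eval_lims _ _) (eval_arrs _ _ (key _ (by omega)))
      (eval_arrs _ _ (key _ (by omega))) (eval_arrs _ _ (key _ (by omega)))
  have h0 : I 0 ((Pg.fill 5 4 (compatE S T)).eval m) := by
    have hs : (Pg.fill 5 4 (compatE S T)).setsArr ⊆ [4, 5] := by simp [setsArr]
    refine ⟨geo _ hs m hg, tabS _ hs m, fun i hi a ha i' hi' a' ha' => ?_⟩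
    rw [eval_fill_self (by rw [hg.lim5]; exact idx hi ha hi' ha')]
    exact compatE_holds hg hi ha hi' ha'
  have hstep : ∀ k < W, ∀ m', I k m' → I (k + 1) (eval
      (.seq (.assign 7 (.sub (.sub (.lim 2) (.lit 1)) (.var 6)))
        (.ite (.get S.r (.var 7)) (.seq (.fill 5 5 elimE) (.fill 5 4 (.get 5 (.bv 0)))) .skip))
      (m'.setVar 6 k)) := by
    rintro k hk m' ⟨w1, w2, w3⟩
    set m₁ := (Pg.assign 7 (.sub (.sub (.lim 2) (.lit 1)) (.var 6))).eval (m'.setVar 6 k) with hm₁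
    have g₁ : Geo W m₁ := w1.of_eq rfl rfl rfl rfl
    have t₁ : m₁.tab S = m.tab S := w2
    have r₁ : Holds4 W m₁ (Tab.elim W (m.tab S) (m.tab T) k) := w3
    have v₁ : m₁.vars 7 = W - 1 - k := by
      simp [hm₁, eval, Mem.setVar, val, w1.lim2]
    have c₁ : (Ex.get S.r (.var 7)).Holds m₁ [] ↔ (m.tab S).rel (W - 1 - k) ≠ 0 := by
      rw [← t₁, ← v₁]
      rfl
    show I (k + 1) (eval _ m₁)
    by_cases hc : (Ex.get S.r (.var 7)).Holds m₁ []
    · rw [eval_ite_pos hc]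
      have hs : (Pg.seq (.fill 5 5 elimE) (.fill 5 4 (.get 5 (.bv 0)))).setsArr ⊆ [4, 5] := by
        simp [setsArr]
      refine ⟨geo _ hs _ g₁, (tabS _ hs _).trans t₁, fun i hi a ha i' hi' a' ha' => ?_⟩
      have hx := idx hi ha hi' ha'
      rw [← g₁.lim5] at hx
      rw [eval_seq, eval_fill_self (by rw [eval_lims]; exact hx)]
      simp only [val, List.getD_cons_zero]
      rw [eval_fill_self hx]
      refine (elimE_holds g₁ r₁ (by omega) hi ha hi' ha').trans ?_
      simp only [v₁, Tab.elim]
      exact and_congr_right fun _ => ⟨fun h _ => h, fun h => h (c₁.1 hc)⟩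
    · rw [eval_ite_neg hc]
      refine ⟨g₁, t₁, fun i hi a ha i' hi' a' ha' => (r₁ i hi a ha i' hi' a' ha').trans ?_⟩
      simp only [Tab.elim]
      exact ⟨fun h => ⟨h, fun h' => absurd (c₁.2 h') hc⟩, fun h => h.1⟩
  obtain ⟨-, -, h3⟩ := iter_induction I h0 hstep
  have := h3 0 hW 0 hW 0 hW 0 hW
  simp only [zero_mul, zero_add] at this
  rw [← this]
  have e : ((Pg.fill 5 4 (compatE S T)).eval m).lims 2 = W := hg.lim2
  simp only [homP, eval] at e ⊢
  rw [e]
  simp [Mem.setVar, val]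

theorem homP_setsArr (S T : TabName) (v : ℕ) : (homP S T v).setsArr = [4, 5, 4] := rfl

theorem homP_setsVar (S T : TabName) (v : ℕ) : (homP S T v).setsVar = [6, 7, v] := rfl

end Pg

/-! ### Tables that agree on the part in use -/

namespace Tab

variable {σ : Schema} {α : ℕ} {W : ℕ} {T T' : Tab} {P : QS σ α}

/-- The tables agree as far as they are used. -/
structure Agree (W : ℕ) (T T' : Tab) : Prop where
  rel : ∀ i < W, T.rel i = T'.rel i
  ar : ∀ i < W, T.ar i = T'.ar i
  arg : ∀ x < W * W, T.arg x = T'.arg x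

theorem Agree.symm (h : Agree W T T') : Agree W T' T :=
  ⟨fun i hi => (h.rel i hi).symm, fun i hi => (h.ar i hi).symm, fun x hx => (h.arg x hx).symm⟩

theorem Agree.rowIs (h : Agree W T T') {i : ℕ} (hi : i < W) {A : RelAtom σ ℕ}
    (hw : σ.arity A.rel ≤ W) (hA : T.RowIs W i A) : T'.RowIs W i A :=
  ⟨(h.rel i hi).symm.trans hA.rel, (h.ar i hi).symm.trans hA.ar, fun c hc =>
    (h.arg _ (mul_add_lt_mul hi (by omega))).symm.trans (hA.arg c hc)⟩

/-- Programs fill arrays only below `W` or `W * W`; whatever lies beyond has no influence on the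
query represented. -/
theorem Rep.of_agree (hT : T.Rep W P) (h : Agree W T T') : T'.Rep W P := by
  have w : ∀ i < W, T'.rel i ≠ 0 → T'.ar i ≤ W := fun i hi h0 => by
    rw [← h.ar i hi]
    exact hT.wide i hi (by rwa [h.rel i hi])
  have back : ∀ {i}, i < W → ∀ {A : RelAtom σ ℕ}, T'.RowIs W i A → T.RowIs W i A := by
    intro i hi A hA
    have := w i hi (by rw [hA.rel]; omega)
    rw [hA.ar] at this
    exact h.symm.rowIs hi this hA
  refine ⟨hT.pos, (h.rel 0 hT.pos).symm.trans hT.rel0, (h.ar 0 hT.pos).symm.trans hT.ar0,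
    fun c => ?_, fun A => ?_, fun i i0 iW hi => ?_, w⟩
  · have := hT.wide 0 hT.pos (by rw [hT.rel0]; omega)
    rw [hT.ar0] at this
    rw [← hT.arg0 c, h.arg]
    have := c.2
    nlinarith
  · rw [hT.atoms]
    constructor
    · rintro ⟨i, i0, iW, hi⟩
      exact ⟨i, i0, iW, h.rowIs iW (hT.arity_le (hT.mem i0 iW hi)) hi⟩
    · rintro ⟨i, i0, iW, hi⟩
      exact ⟨i, i0, iW, back iW hi⟩
  · obtain ⟨A, hA⟩ := hT.live i i0 iW (by rwa [h.rel i iW])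
    exact ⟨A, h.rowIs iW (hT.arity_le (hT.mem i0 iW hA)) hA⟩

theorem TwoRows.of_agree (h2 : T.TwoRows W) (h : Agree W T T') : T'.TwoRows W := by
  intro i hi j hj k hk
  rw [← h.rel i hi, ← h.rel j hj, ← h.rel k hk]
  exact h2 i hi j hj k hk

/-- This lets loops range over cells instead of variables. -/
theorem Rep.exists_cell (h : T.Rep W P) {x : ℕ} (hx : x ∈ P.vars) : ∃ p < W * W, T.arg p = x := by
  obtain ⟨A, hA, j, hj, rfl⟩ := hx
  obtain ⟨i, i0, iW, hi⟩ := (h.atoms A).1 hA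
  have := h.arity_le hA
  exact ⟨i * W + j, mul_add_lt_mul iW (by omega), hi.arg j hj⟩

theorem Rep.good (h : T.Rep W P) (h2 : T.TwoRows W) (hs : P.Safe) (hne : P.atoms.Nonempty) :
    P.Good where
  fin := by
    refine ((Set.finite_Iio W).biUnion (t := fun i => {A : RelAtom σ ℕ | T.RowIs W i A})
      fun i _ => Set.Subsingleton.finite fun A hA B hB => RowIs.unique hA hB).subset ?_
    intro A hA
    obtain ⟨i, -, iW, hi⟩ := (h.atoms A).1 hA
    exact Set.mem_biUnion (x := i) iW hi
  ne := hne
  safe := hs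
  two := h.two h2

end Tab

/-! ### Candidates are good queries -/

namespace QS

variable {σ : Schema} {α : ℕ} {P Q : QS σ α}

theorem Hom.nonempty (h : Hom P Q) (hP : P.atoms.Nonempty) : Q.atoms.Nonempty := by
  obtain ⟨g, hg, -⟩ := h
  obtain ⟨A, hA⟩ := hP
  exact ⟨_, hg A hA⟩

theorem Safe.addFresh (h : P.Safe) (R : Fin σ.numRel) (φ : ℕ → ℕ) : (P.addFresh R φ).Safe := by
  intro i
  exact mem_vars_of_hom (S := P.addFresh R φ) (g := (2 * ·)) (fun A hA => Or.inl ⟨A, hA, rfl⟩) (h i)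

/-- The new name has just one atom, so the limit of two is respected. -/
theorem Good.addFresh (h : P.Good) {R : Fin σ.numRel} (hR : ∀ A ∈ P.atoms, A.rel ≠ R)
    (φ : ℕ → ℕ) : (P.addFresh R φ).Good where
  fin := by
    refine ((h.fin.image fun A => A.map (2 * ·)).insert
      (RelAtom.ofFun R fun j => 2 * φ j + 1)).subset ?_
    rintro B (⟨A, hA, rfl⟩ | rfl)
    · exact Or.inr ⟨A, hA, rfl⟩
    · exact Or.inl rfl
  ne := (hom_addFresh P R φ).nonempty h.ne
  safe := h.safe.addFresh R φ
  two := by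
    rintro _ (⟨A, hA, rfl⟩ | rfl) _ (⟨B, hB, rfl⟩ | rfl) _ (⟨D, hD, rfl⟩ | rfl) e1 e2
    · rcases h.two A hA B hB D hD e1 e2 with rfl | rfl | rfl <;> simp
    · exact absurd e2 (hR A hA)
    · exact absurd e1 (hR A hA)
    · exact absurd e1 (hR A hA)
    · exact absurd e1.symm (hR B hB)
    · exact Or.inr (Or.inl rfl)
    · exact Or.inl rfl
    · exact Or.inl rfl

/-- An identification that loses all maps to a target still does so after further identifications.
Hence one pass over all pairs folds a query completely. -/
theorem hom_map_sub_map (P : QS σ α) (s : ℕ → ℕ) (c d : ℕ) :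
    Hom (P.map (sub c d)) ((P.map s).map (sub (s c) (s d))) := by
  refine hom_map_sub (g := sub (s c) (s d) ∘ s) ?_ (fun _ => rfl) ?_
  · intro A hA
    exact ⟨A.map s, ⟨A, hA, rfl⟩, rfl⟩
  · simp only [sub, Function.comp_apply, if_true]
    split_ifs <;> rfl

end QS

/-! ### Testing one candidate, and folding the second query -/

namespace Pg

open Ex QS

variable {σ : Schema} {α : ℕ}

theorem eval_forTo (x l : ℕ) (p : Pg) (m : Mem) : (Pg.forTo x l p).eval m =
    iter (fun k m' => p.eval (m'.setVar x k)) (m.lims l) m := rfl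

/-- Two nested loops over pairs below the same bound. -/
theorem eval_pairs {x y l n : ℕ} {p : Pg} {m : Mem} (I : Set (ℕ × ℕ) → Mem → Prop)
    (hn : m.lims l = n) (hxy : x ≠ y) (hxp : x ∉ p.setsVar)
    (hset : ∀ S m' v, I S m' → I S (m'.setVar x v) ∧ I S (m'.setVar y v))
    (h0 : I ∅ m)
    (step : ∀ S m', I S m' → m'.vars x < n → m'.vars y < n →
      I (insert (m'.vars x, m'.vars y) S) (p.eval m')) :
    I {q | q.1 < n ∧ q.2 < n} ((Pg.forTo x l (.forTo y l p)).eval m) := by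
  rw [eval_forTo, hn]
  have key := iter_induction (f := fun k m' => (Pg.forTo y l p).eval (m'.setVar x k)) (n := n)
    (m := m) (fun u m' => m'.lims l = n ∧ I {q | q.1 < u ∧ q.2 < n} m')
    ⟨hn, by simpa using h0⟩ (by
      rintro u hu m₁ ⟨hl, h1⟩
      rw [eval_forTo, show (m₁.setVar x u).lims l = n from hl]
      have key := iter_induction (f := fun k m' => p.eval (m'.setVar y k)) (n := n)
        (m := m₁.setVar x u) (fun v m' => m'.lims l = n ∧ m'.vars x = u ∧
          I {q | (q.1 < u ∧ q.2 < n) ∨ (q.1 = u ∧ q.2 < v)} m')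
        ⟨hl, by simp [Mem.setVar], by simpa using (hset _ _ u h1).1⟩ (by
          rintro v hv m₂ ⟨hl', hx', h2⟩
          have hx2 : (m₂.setVar y v).vars x = u := (Function.update_of_ne hxy _ _).trans hx'
          have hy2 : (m₂.setVar y v).vars y = v := by simp [Mem.setVar]
          -- Pairs are visited in lexicographic order, and one round adds `(u, v)`.
          have e : {q : ℕ × ℕ | (q.1 < u ∧ q.2 < n) ∨ (q.1 = u ∧ q.2 < v + 1)} =
              insert (u, v) {q | (q.1 < u ∧ q.2 < n) ∨ (q.1 = u ∧ q.2 < v)} := by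
            ext ⟨a, b⟩
            simp only [Set.mem_ofPred_eq, Set.mem_insert_iff, Prod.mk.injEq]
            omega
          have h3 := step _ _ (hset _ _ v h2).2 (by omega) (by omega)
          rw [hx2, hy2] at h3
          refine ⟨by rw [eval_lims]; exact hl', by rw [eval_vars _ _ hxp, hx2], ?_⟩
          rw [e]
          exact h3)
      refine ⟨key.1, ?_⟩
      have e : {q : ℕ × ℕ | q.1 < u + 1 ∧ q.2 < n} =
          {q | (q.1 < u ∧ q.2 < n) ∨ (q.1 = u ∧ q.2 < n)} := by
        ext ⟨a, b⟩
        simp only [Set.mem_ofPred_eq]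
        omega
      rw [e]
      exact key.2.2)
  exact key.2

/-- The answer in variable `0` is `p`. -/
def Ans (m : Mem) (p : Prop) : Prop := (p → m.vars 0 = 1) ∧ (¬ p → m.vars 0 = 0)

theorem Ans.congr {m m' : Mem} {p p' : Prop} (h : Ans m p) (hm : m'.vars 0 = m.vars 0)
    (hp : p ↔ p') : Ans m' p' := by
  rw [Ans, hm, ← hp]
  exact h

def nameOne : TabName := ⟨10, 11, 12⟩
def nameTwo : TabName := ⟨20, 21, 22⟩
-- Identifications change arguments only, so this table shares relation numbers and arities with
-- `nameTwo`; likewise `nameTry`, and `nameCand` with `nameExt`.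
def nameFold : TabName := ⟨20, 21, 30⟩
def nameTry : TabName := ⟨20, 21, 52⟩
def nameExt : TabName := ⟨40, 41, 42⟩
def nameCand : TabName := ⟨40, 41, 52⟩

/-- The memory holds the queries `Q₁` and `Q₂` and the data for pairing. -/
structure Ctx (H W : ℕ) (Q₁ Q₂ : QS σ α) (m : Mem) : Prop where
  geo : Geo W m
  half : m.vars 3 = H
  width : W = H + H
  rep1 : (m.tab nameOne).Rep W Q₁
  two1 : (m.tab nameOne).TwoRows W
  low1 : (m.tab nameOne).Low H W
  rep2 : (m.tab nameTwo).Rep W Q₂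
  two2 : (m.tab nameTwo).TwoRows W
  low2 : (m.tab nameTwo).Low H W

variable {H W : ℕ} {Q₁ Q₂ : QS σ α} {m : Mem}

theorem Ctx.of_eq {m' : Mem} (h : Ctx H W Q₁ Q₂ m) (hl : m'.lims = m.lims)
    (h3 : m'.vars 3 = m.vars 3)
    (ha : ∀ b ∈ [1, 2, 3, 10, 11, 12, 20, 21, 22], m'.arrs b = m.arrs b) :
    Ctx H W Q₁ Q₂ m' := by
  simp only [List.mem_cons, List.not_mem_nil, or_false, forall_eq_or_imp, forall_eq] at ha
  obtain ⟨a1, a2, a3, b1, b2, b3, c1, c2, c3⟩ := ha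
  have t1 : m'.tab nameOne = m.tab nameOne := by simp only [Mem.tab, nameOne, b1, b2, b3]
  have t2 : m'.tab nameTwo = m.tab nameTwo := by simp only [Mem.tab, nameTwo, c1, c2, c3]
  refine ⟨h.geo.of_eq hl a1 a2 a3, h3.trans h.half, h.width, ?_, ?_, ?_, ?_, ?_, ?_⟩
  · rw [t1]; exact h.rep1
  · rw [t1]; exact h.two1
  · rw [t1]; exact h.low1
  · rw [t2]; exact h.rep2
  · rw [t2]; exact h.two2
  · rw [t2]; exact h.low2

theorem Ctx.setVar (h : Ctx H W Q₁ Q₂ m) {x : ℕ} (hx : x ≠ 3) (v : ℕ) :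
    Ctx H W Q₁ Q₂ (m.setVar x v) :=
  h.of_eq rfl (Function.update_of_ne (Ne.symm hx) _ _) fun _ _ => rfl

theorem Ctx.eval (h : Ctx H W Q₁ Q₂ m) (p : Pg) (h3 : 3 ∉ p.setsVar)
    (ha : ∀ b ∈ [1, 2, 3, 10, 11, 12, 20, 21, 22], b ∉ p.setsArr) :
    Ctx H W Q₁ Q₂ (p.eval m) :=
  h.of_eq (eval_lims p m) (eval_vars p m h3) fun b hb => eval_arrs p m (ha b hb)

theorem homP_iff {P Q : QS σ α} {S T : TabName} {v : ℕ} (hg : Geo W m)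
    (hS : 5 < S.r ∧ 5 < S.a ∧ 5 < S.g) (hP : (m.tab S).Rep W P) (hQ : (m.tab T).Rep W Q)
    (h2 : (m.tab T).TwoRows W) : ((homP S T v).eval m).vars v ≠ 0 ↔ P.Hom Q :=
  (homP_spec hg hS).trans (Tab.elim_iff_hom hP hQ h2)

/-- Set the answer to `0` if the table `X` is strictly above the first query and not above the
second one. -/
def checkP (X : TabName) : Pg :=
  .seq (homP X nameOne 8) (.seq (homP nameOne X 9) (.seq (homP X nameTwo 10)
    (.ite (and (.var 8) (and (not (.var 9)) (not (.var 10)))) (.assign 0 (.lit 0)) .skip)))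

theorem homP_tab {S T X : TabName} {v : ℕ} (hX : 5 < X.r ∧ 5 < X.a ∧ 5 < X.g) :
    ((homP S T v).eval m).tab X = m.tab X := by
  have key : ∀ x, 5 < x → x ∉ (homP S T v).setsArr := fun x hx hx' => by
    simp only [homP_setsArr, List.mem_cons, List.not_mem_nil, or_false] at hx'
    omega
  exact tab_eval _ _ (key _ hX.1) (key _ hX.2.1) (key _ hX.2.2)

theorem Ctx.homP (h : Ctx H W Q₁ Q₂ m) (S T : TabName) {v : ℕ} (hv : v ≠ 3) :
    Ctx H W Q₁ Q₂ ((homP S T v).eval m) :=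
  h.eval _ (by simp [homP_setsVar, hv.symm]) (by rw [homP_setsArr]; decide)

theorem homP_vars {S T : TabName} {v x : ℕ} (hx : x ≠ v) (h6 : x ≠ 6) (h7 : x ≠ 7) :
    ((Pg.homP S T v).eval m).vars x = m.vars x :=
  eval_vars _ _ (by simp [homP_setsVar, hx, h6, h7])

/-- The answer is only ever lowered to `0`, so successive tests accumulate as a conjunction. -/
theorem checkP_ans {X : TabName} {Q : QS σ α} (h : Ctx H W Q₁ Q₂ m)
    (hX : 5 < X.r ∧ 5 < X.a ∧ 5 < X.g) (hQ : (m.tab X).Rep W Q) (h2 : (m.tab X).TwoRows W)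
    {p : Prop} (hp : Ans m p) : Ans ((checkP X).eval m) (p ∧ Passes Q₁ Q₂ Q) := by
  simp only [checkP, eval_seq]
  set m₁ := (Pg.homP X nameOne 8).eval m with hm₁
  set m₂ := (Pg.homP nameOne X 9).eval m₁ with hm₂
  set m₃ := (Pg.homP X nameTwo 10).eval m₂ with hm₃
  have c₁ : Ctx H W Q₁ Q₂ m₁ := h.homP _ _ (by decide)
  have c₂ : Ctx H W Q₁ Q₂ m₂ := c₁.homP _ _ (by decide)
  have x₁ : m₁.tab X = m.tab X := homP_tab hX
  have x₂ : m₂.tab X = m.tab X := (homP_tab hX).trans x₁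
  have e8 : m₃.vars 8 ≠ 0 ↔ Q.Hom Q₁ := by
    rw [hm₃, homP_vars (by decide) (by decide) (by decide), hm₂,
      homP_vars (by decide) (by decide) (by decide)]
    exact homP_iff h.geo hX hQ h.rep1 h.two1
  have e9 : m₃.vars 9 ≠ 0 ↔ Q₁.Hom Q := by
    rw [hm₃, homP_vars (by decide) (by decide) (by decide)]
    exact homP_iff c₁.geo (by decide) c₁.rep1 (by rwa [x₁]) (by rwa [x₁])
  have e10 : m₃.vars 10 ≠ 0 ↔ Q.Hom Q₂ :=
    homP_iff c₂.geo hX (by rwa [x₂]) c₂.rep2 c₂.two2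
  have e0 : m₃.vars 0 = m.vars 0 := by
    rw [hm₃, homP_vars (by decide) (by decide) (by decide), hm₂,
      homP_vars (by decide) (by decide) (by decide), hm₁,
      homP_vars (by decide) (by decide) (by decide)]
  have hc : (and (.var 8) (and (not (.var 9)) (not (.var 10)))).Holds m₃ [] ↔
      ¬ Passes Q₁ Q₂ Q := by
    simp only [holds_and, holds_not, Passes, not_not]
    exact and_congr e8 (and_congr (not_congr e9) (not_congr e10))
  by_cases hpass : Passes Q₁ Q₂ Q
  · rw [eval_ite_neg (fun k => hc.1 k hpass)]
    exact hp.congr e0 (by simp [hpass])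
  · rw [eval_ite_pos (hc.2 hpass)]
    exact ⟨fun k => absurd k.2 hpass, fun _ => by simp [eval, Mem.setVar, val]⟩

/-- The entries of array `g`, with the value of entry `var 12` replaced by that of entry
`var 11`. -/
def mergeE (g : ℕ) : Ex :=
  sel (eq (get g (bv 0)) (get g (var 12))) (get g (var 11)) (get g (bv 0))

theorem merge_agree (hg : Geo W m) (r a g : ℕ) (hr : r ≠ 52) (ha : a ≠ 52) :
    Tab.Agree W ((m.tab ⟨r, a, g⟩).map (sub (m.arrs g (m.vars 11)) (m.arrs g (m.vars 12))))
      (((Pg.fill 3 52 (mergeE g)).eval m).tab ⟨r, a, 52⟩) := by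
  refine ⟨fun i _ => ?_, fun i _ => ?_, fun x hx => ?_⟩
  · exact (congrFun (eval_arrs (.fill 3 52 (mergeE g)) m (by simpa [setsArr] using hr)) i).symm
  · exact (congrFun (eval_arrs (.fill 3 52 (mergeE g)) m (by simpa [setsArr] using ha)) i).symm
  · refine Eq.trans ?_ (eval_fill_self (l := 3) (a := 52) (e := mergeE g) (m := m) (v := x)
      (by rw [hg.lim3]; exact hx)).symm
    have hc : (eq (get g (bv 0)) (get g (var 12))).Holds m [x] ↔
      m.arrs g x = m.arrs g (m.vars 12) := holds_eq
    by_cases h : m.arrs g x = m.arrs g (m.vars 12)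
    · rw [mergeE, val_sel (hc.2 h)]
      exact if_pos h
    · rw [mergeE, val_sel_not (fun k => h (hc.1 k))]
      exact if_neg h

/-- Identify variables of the second query as long as this does not change it up to
equivalence; the result is in the table `nameFold`. -/
def foldP : Pg :=
  .seq (.fill 3 30 (.get 22 (.bv 0))) (.forTo 11 3 (.forTo 12 3
    (.seq (.fill 3 52 (mergeE 30)) (.seq (homP nameTry nameTwo 8)
      (.ite (.var 8) (.fill 3 30 (.get 52 (.bv 0))) .skip)))))

theorem foldP_setsArr : foldP.setsArr = [30, 52, 4, 5, 4, 30] := rfl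

theorem foldP_setsVar : foldP.setsVar = [11, 12, 6, 7, 8] := rfl

/-- Greedy identification. Invariant: for every pair of cells already tried, either they agree or
identifying their values leaves no map to `Q₂`; `hom_map_sub_map` carries this past later
identifications. The current query stays equivalent to `Q₂`, being a quotient that was accepted only
because it maps back. -/
theorem foldP_spec (h : Ctx H W Q₁ Q₂ m) (hs : Q₂.Safe) :
    ∃ P, ((foldP.eval m).tab nameFold).Rep W P ∧ Folded P Q₂ := by
  let I : Set (ℕ × ℕ) → Mem → Prop := fun S m' => Ctx H W Q₁ Q₂ m' ∧
    ∃ P, (m'.tab nameFold).Rep W P ∧ Hom Q₂ P ∧ Hom P Q₂ ∧ P.Safe ∧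
      ∀ q ∈ S, q.1 < W * W → q.2 < W * W → m'.arrs 30 q.1 = m'.arrs 30 q.2 ∨
        ¬ Hom (P.map (sub (m'.arrs 30 q.1) (m'.arrs 30 q.2))) Q₂
  set m₁ := (Pg.fill 3 30 (.get 22 (.bv 0))).eval m with hm₁
  have c₁ : Ctx H W Q₁ Q₂ m₁ := h.eval _ (by decide) (by decide)
  have a₁ : Tab.Agree W (m.tab nameTwo) (m₁.tab nameFold) := by
    refine ⟨fun i _ => rfl, fun i _ => rfl, fun x hx => ?_⟩
    exact (eval_fill_self (l := 3) (a := 30) (e := .get 22 (.bv 0)) (m := m) (v := x)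
      (by rw [h.geo.lim3]; exact hx)).symm
  have h0 : I ∅ m₁ := ⟨c₁, Q₂, h.rep2.of_agree a₁, Hom.refl _, Hom.refl _, hs, by simp⟩
  have key := eval_pairs (x := 11) (y := 12) (l := 3) (n := W * W)
    (p := .seq (.fill 3 52 (mergeE 30)) (.seq (Pg.homP nameTry nameTwo 8)
      (.ite (.var 8) (.fill 3 30 (.get 52 (.bv 0))) .skip))) I c₁.geo.lim3 (by decide)
    (by simp [setsVar, homP_setsVar])
    (fun S m' v ⟨k1, k2⟩ => ⟨⟨k1.setVar (by decide) v, k2⟩, ⟨k1.setVar (by decide) v, k2⟩⟩) h0 (by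
      rintro S m' ⟨k1, P, k2, k3, k4, k5, k6⟩ hu hv
      simp only [eval_seq]
      set a := m'.arrs 30 (m'.vars 11) with ha
      set b := m'.arrs 30 (m'.vars 12) with hb
      set m₂ := (Pg.fill 3 52 (mergeE 30)).eval m' with hm₂
      have c₂ : Ctx H W Q₁ Q₂ m₂ := k1.eval _ (by simp [setsVar]) (by simp [setsArr])
      have r₂ : (m₂.tab nameTry).Rep W (P.map (sub a b)) :=
        (k2.map _).of_agree (merge_agree k1.geo 20 21 30 (by decide) (by decide))
      set m₃ := (Pg.homP nameTry nameTwo 8).eval m₂ with hm₃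
      have c₃ : Ctx H W Q₁ Q₂ m₃ := c₂.homP _ _ (by decide)
      have e₃ : m₃.vars 8 ≠ 0 ↔ Hom (P.map (sub a b)) Q₂ :=
        homP_iff c₂.geo (by decide) r₂ c₂.rep2 c₂.two2
      have f₃ : m₃.arrs 30 = m'.arrs 30 := by
        rw [hm₃, eval_arrs _ _ (by rw [homP_setsArr]; decide), hm₂,
          eval_arrs _ _ (by simp [setsArr])]
      have t₃ : m₃.tab nameTry = m₂.tab nameTry := homP_tab (by decide)
      by_cases hh : Hom (P.map (sub a b)) Q₂
      · rw [eval_ite_pos (c := .var 8) (e₃.2 hh)]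
        set m₄ := (Pg.fill 3 30 (.get 52 (.bv 0))).eval m₃ with hm₄
        have c₄ : Ctx H W Q₁ Q₂ m₄ := c₃.eval _ (by simp [setsVar]) (by simp [setsArr])
        have a₄ : Tab.Agree W (m₃.tab nameTry) (m₄.tab nameFold) := by
          refine ⟨fun i _ => rfl, fun i _ => rfl, fun x hx => ?_⟩
          exact (eval_fill_self (l := 3) (a := 30) (e := .get 52 (.bv 0)) (m := m₃) (v := x)
            (by rw [c₃.geo.lim3]; exact hx)).symm
        have v₄ : ∀ x < W * W, m₄.arrs 30 x = sub a b (m'.arrs 30 x) := by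
          intro x hx
          have e1 := a₄.arg x hx
          rw [t₃] at e1
          exact e1.symm.trans ((merge_agree k1.geo 20 21 30 (by decide) (by decide)).arg x hx).symm
        refine ⟨c₄, P.map (sub a b), ?_, k3.trans (hom_map _ _), hh, k5.map _, ?_⟩
        · rw [← t₃] at r₂
          exact r₂.of_agree a₄
        · rintro q hq h1 h2
          rw [v₄ _ h1, v₄ _ h2]
          rcases hq with rfl | hq
          · refine Or.inl ?_
            simp only [QS.sub, ← ha, ← hb, if_true]
            split_ifs <;> rfl
          · rcases k6 q hq h1 h2 with e | e
            · exact Or.inl (by rw [e])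
            · exact Or.inr fun k => e ((hom_map_sub_map P _ _ _).trans k)
      · rw [eval_ite_neg (c := .var 8) (fun k => hh (e₃.1 k))]
        show I _ m₃
        refine ⟨c₃, P, ?_, k3, k4, k5, fun q hq h1 h2 => ?_⟩
        · have : m₃.tab nameFold = m'.tab nameFold := by
            rw [hm₃, homP_tab (by decide)]
            exact tab_eval _ _ (by decide) (by decide) (by decide)
          rw [this]
          exact k2
        · show m₃.arrs 30 q.1 = m₃.arrs 30 q.2 ∨
            ¬ Hom (P.map (sub (m₃.arrs 30 q.1) (m₃.arrs 30 q.2))) Q₂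
          rw [f₃]
          rcases hq with rfl | hq
          · exact Or.inr hh
          · exact k6 q hq h1 h2)
  obtain ⟨-, P, k2, k3, k4, k5, k6⟩ := key
  refine ⟨P, k2, k3, k4, k5, fun x hx y hy hxy => ?_⟩
  obtain ⟨u, hu, rfl⟩ := k2.exists_cell hx
  obtain ⟨v, hv, rfl⟩ := k2.exists_cell hy
  exact (k6 (u, v) ⟨hu, hv⟩ hu hv).resolve_left hxy

end Pg

/-! ### Building and testing all candidates -/

namespace Pg

open Ex QS

variable {σ : Schema} {α : ℕ} {H W : ℕ} {Q₁ Q₂ : QS σ α} {m : Mem}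

/-- Row `bv 0` equals row `x`, where `x k` is the row under `k` quantifiers. -/
def sameE (x : ℕ → Ex) : Ex :=
  and (eq (get 20 (bv 0)) (get 20 (x 1))) (all 2 (imp (lt (bv 0) (get 21 (x 2)))
    (eq (get 30 (cell (bv 1) (bv 0))) (get 30 (cell (x 2) (bv 0))))))

/-- Row `x` is kept. -/
def keepE (x : ℕ → Ex) : Ex := not (any 2 (and (lt (bv 0) (x 1)) (sameE x)))

/-- Row `x` gets a twin. -/
def twinE (x : ℕ → Ex) : Ex :=
  and (x 0) (and (keepE x) (not (any 2 (and (eq (get 20 (bv 0)) (get 20 (x 1)))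
    (not (sameE x))))))

theorem Geo.mul_lt (hg : Geo W m) {x : ℕ} (hx : x < W) : m.arrs 3 x = x * W :=
  hg.mul x (by have := hg.pos; nlinarith [Nat.mul_pos this this])

theorem sameE_holds (hg : Geo W m) {x : ℕ → Ex} {w v y : ℕ} (hv : v < W) (hy : y < W)
    (h1 : (x 1).val m [y, w] = v) (h2 : ∀ z, (x 2).val m [z, y, w] = v) :
    (sameE x).Holds m [y, w] ↔ Tab.SameRow W (m.tab nameFold) v y := by
  simp only [sameE, holds_and, holds_eq, holds_all, holds_imp, holds_lt, cell, val,
    List.getD_cons_zero, List.getD_cons_succ, h1, h2, hg.lim2, Geo.mul_lt hg hv,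
    Geo.mul_lt hg hy, Tab.SameRow, Mem.tab, nameFold]

theorem keepE_holds (hg : Geo W m) {x : ℕ → Ex} {w v : ℕ} (hv : v < W)
    (h1 : ∀ y, (x 1).val m [y, w] = v) (h2 : ∀ z y, (x 2).val m [z, y, w] = v) :
    (keepE x).Holds m [w] ↔ Tab.Keep W (m.tab nameFold) v := by
  simp only [keepE, holds_not, holds_any, holds_and, holds_lt, h1, val, List.getD_cons_zero,
    hg.lim2, Tab.Keep]
  refine not_congr (exists_congr fun y => and_congr_right fun hy => and_congr_right fun _ => ?_)
  exact sameE_holds hg hv hy (h1 y) fun z => h2 z y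

theorem twinE_holds (hg : Geo W m) {x : ℕ → Ex} {w v : ℕ} (hv : v < W)
    (h0 : (x 0).val m [w] = v) (h1 : ∀ y, (x 1).val m [y, w] = v)
    (h2 : ∀ z y, (x 2).val m [z, y, w] = v) :
    (twinE x).Holds m [w] ↔ Tab.Twin W (m.tab nameFold) v := by
  simp only [twinE, holds_and, keepE_holds hg hv h1 h2, holds_not, holds_any, holds_eq, h1, val,
    List.getD_cons_zero, hg.lim2, Tab.Twin]
  refine and_congr (by rw [Holds, h0]) (and_congr_right fun _ => not_congr
    (exists_congr fun y => and_congr_right fun hy => and_congr_right fun _ => not_congr ?_))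
  exact sameE_holds hg hv hy (h1 y) fun z => h2 z y

/-- Twice the entry of array `g` in the rows below `var 3`, and fresh numbers in the others. -/
def freshE (g : ℕ) : Ex :=
  sel (lt (fst (bv 0)) (var 3)) (add (get g (bv 0)) (get g (bv 0)))
    (add (add (bv 0) (bv 0)) (lit 1))

theorem freshE_low (hg : Geo W m) (h3 : m.vars 3 = H) (hHW : H ≤ W) (g : ℕ) {x c : ℕ} (hx : x < H)
    (hc : c < W) : (freshE g).val m [x * W + c] = 2 * m.arrs g (x * W + c) := by
  have hW := hg.pos
  have e := hg.fst x (by nlinarith [Nat.mul_pos hW hW]) c hc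
  rw [freshE, val_sel]
  · simp only [val, List.getD_cons_zero]
    omega
  · rw [holds_lt]
    simp only [fst, val, List.getD_cons_zero, e, h3, hx]

theorem freshE_high (hg : Geo W m) (h3 : m.vars 3 = H) (g : ℕ) {x c : ℕ} (hx : H ≤ x) (hx' : x < W)
    (hc : c < W) : (freshE g).val m [x * W + c] = 2 * (x * W + c) + 1 := by
  have hW := hg.pos
  have e := hg.fst x (by nlinarith [Nat.mul_pos hW hW]) c hc
  rw [freshE, val_sel_not]
  · simp only [val, List.getD_cons_zero]
    omega
  · rw [holds_lt]
    simp only [fst, val, List.getD_cons_zero, e, h3]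
    omega

/-- Build the table `nameExt` from the table `nameFold`. -/
def extP : Pg :=
  .seq (.fill 2 40 (sel (lt (bv 0) (var 3))
      (sel (keepE bv) (get 20 (bv 0)) (lit 0))
      (sel (twinE fun k => .sub (bv k) (var 3)) (get 20 (.sub (bv 0) (var 3))) (lit 0))))
    (.seq (.fill 2 41 (sel (lt (bv 0) (var 3)) (get 21 (bv 0)) (get 21 (.sub (bv 0) (var 3)))))
      (.fill 3 42 (freshE 30)))

theorem extP_spec (h : Ctx H W Q₁ Q₂ m) :
    Tab.IsExt H W (m.tab nameFold) ((extP.eval m).tab nameExt) := by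
  have hw := h.width
  have hg := h.geo
  simp only [extP, eval_seq]
  set e40 : Ex := sel (lt (bv 0) (var 3))
      (sel (keepE bv) (get 20 (bv 0)) (lit 0))
      (sel (twinE fun k => .sub (bv k) (var 3)) (get 20 (.sub (bv 0) (var 3))) (lit 0)) with he40
  set e41 : Ex := sel (lt (bv 0) (var 3)) (get 21 (bv 0)) (get 21 (.sub (bv 0) (var 3))) with he41
  set m₁ := (Pg.fill 2 40 e40).eval m with hm₁
  set m₂ := (Pg.fill 2 41 e41).eval m₁ with hm₂
  set m₃ := (Pg.fill 3 42 (freshE 30)).eval m₂ with hm₃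
  have g₂ : Geo W m₂ := hg.of_eq rfl rfl rfl rfl
  have r : ∀ x < W, m₃.arrs 40 x = e40.val m [x] := fun x hx =>
    eval_fill_self (l := 2) (a := 40) (m := m) (by rw [hg.lim2]; exact hx)
  -- Array `40` has been overwritten meanwhile, but `e41` does not read it.
  have a : ∀ x < W, m₃.arrs 41 x = e41.val m [x] := fun x hx =>
    (eval_fill_self (l := 2) (a := 41) (e := e41) (m := m₁) (by
      rw [show m₁.lims 2 = m.lims 2 from rfl, hg.lim2]; exact hx)).trans
    (val_congr (m := m₁) (m' := m) rfl rfl e41 (by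
      simp only [he41, reads, lt, List.append_nil, List.nil_append, List.mem_append, List.mem_cons,
        List.not_mem_nil, or_false, or_self, forall_eq]
      rfl) _)
  have g : ∀ p < W * W, m₃.arrs 42 p = (freshE 30).val m₂ [p] := fun p hp =>
    eval_fill_self (by rw [g₂.lim3]; exact hp)
  have lowc : ∀ x, (lt (bv 0) (var 3)).Holds m [x] ↔ x < H := fun x => by
    rw [holds_lt, ← h.half]
    rfl
  have kp : ∀ x < W, (keepE bv).Holds m [x] ↔ Tab.Keep W (m.tab nameFold) x := fun x hx =>
    keepE_holds hg hx (fun y => rfl) (fun z y => rfl)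
  have tw : ∀ x < H, (twinE fun k => .sub (bv k) (var 3)).Holds m [H + x] ↔
      Tab.Twin W (m.tab nameFold) x := fun x hx => by
    have e : H + x - m.vars 3 = x := by rw [h.half]; omega
    exact twinE_holds hg (by omega) e (fun _ => e) (fun _ _ => e)
  have e1 : ∀ x < H, (Ex.sub (bv 0) (var 3)).val m [H + x] = x := fun x hx => by
    show H + x - m.vars 3 = x
    rw [h.half]
    omega
  refine ⟨fun x hx hk => ?_, fun x hx hk => ?_, fun x hx ht => ?_, fun x hx ht => ?_,
    fun x hx => ?_, fun x hx => ?_, fun x hx c hc => ?_, fun x hx c hc => ?_⟩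
  · refine (r x (by omega)).trans ?_
    rw [he40, val_sel ((lowc x).2 hx), val_sel ((kp x (by omega)).2 hk)]
    rfl
  · refine (r x (by omega)).trans ?_
    rw [he40, val_sel ((lowc x).2 hx), val_sel_not fun k => hk ((kp x (by omega)).1 k)]
    rfl
  · refine (r (H + x) (by omega)).trans ?_
    rw [he40, val_sel_not (fun k => by have := (lowc (H + x)).1 k; omega),
      val_sel ((tw x hx).2 ht), val, e1 x hx]
    rfl
  · refine (r (H + x) (by omega)).trans ?_
    rw [he40, val_sel_not (fun k => by have := (lowc (H + x)).1 k; omega),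
      val_sel_not (fun k => ht ((tw x hx).1 k))]
    rfl
  · refine (a x (by omega)).trans ?_
    rw [he41, val_sel ((lowc x).2 hx)]
    rfl
  · refine (a (H + x) (by omega)).trans ?_
    rw [he41, val_sel_not (fun k => by have := (lowc (H + x)).1 k; omega), val, e1 x hx]
    rfl
  · refine (g _ (mul_add_lt_mul (by omega) hc)).trans ?_
    rw [freshE_low g₂ h.half (by omega) 30 hx hc]
    rfl
  · refine (g _ (mul_add_lt_mul (by omega) hc)).trans ?_
    exact freshE_high g₂ h.half 30 (by omega) (by omega) hc

/-- Check the candidates that identify two entries of the table `nameExt`. -/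
def candP : Pg :=
  .forTo 11 3 (.forTo 12 3 (.seq (.fill 3 52 (mergeE 42)) (checkP nameCand)))

theorem checkP_setsVar (X : TabName) :
    (checkP X).setsVar = [6, 7, 8, 6, 7, 9, 6, 7, 10, 0] := rfl

theorem checkP_setsArr (X : TabName) :
    (checkP X).setsArr = [4, 5, 4, 4, 5, 4, 4, 5, 4] := rfl

/-- The loops run over all pairs of cells, including equal and unused ones. The superfluous
candidates are harmless, since every quotient of the extension has to pass when containment is
maximal. -/
theorem candP_ans (h : Ctx H W Q₁ Q₂ m) {E : QS σ α} (hE : (m.tab nameExt).Rep W E)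
    (h2 : (m.tab nameExt).TwoRows W) {p : Prop} (hp : Ans m p) :
    Ans (candP.eval m) (p ∧ ∀ u < W * W, ∀ v < W * W,
      Passes Q₁ Q₂ (E.map (QS.sub (m.arrs 42 u) (m.arrs 42 v)))) := by
  have key := eval_pairs (x := 11) (y := 12) (l := 3) (n := W * W) (m := m)
    (p := .seq (.fill 3 52 (mergeE 42)) (checkP nameCand))
    (fun S m' => Ctx H W Q₁ Q₂ m' ∧ m'.tab nameExt = m.tab nameExt ∧ Ans m' (p ∧ ∀ q ∈ S,
      Passes Q₁ Q₂ (E.map (QS.sub (m.arrs 42 q.1) (m.arrs 42 q.2)))))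
    h.geo.lim3 (by decide) (by simp [setsVar, checkP_setsVar])
    (fun S m' v ⟨k1, k2, k3⟩ =>
      ⟨⟨k1.setVar (by decide) v, k2, k3⟩, ⟨k1.setVar (by decide) v, k2, k3⟩⟩)
    ⟨h, rfl, by simpa using hp⟩ (by
      rintro S m' ⟨k1, k2, k3⟩ hu hv
      rw [eval_seq]
      set m₂ := (Pg.fill 3 52 (mergeE 42)).eval m' with hm₂
      have c₂ : Ctx H W Q₁ Q₂ m₂ := k1.eval _ (by simp [setsVar]) (by simp [setsArr])
      have ag := merge_agree k1.geo 40 41 42 (by decide) (by decide)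
      have r' : (m'.tab nameExt).Rep W E := by rw [k2]; exact hE
      have t' : (m'.tab nameExt).TwoRows W := by rw [k2]; exact h2
      have r₂ : (m₂.tab nameCand).Rep W _ := (r'.map _).of_agree ag
      have t₂ : (m₂.tab nameCand).TwoRows W := (t'.map _).of_agree ag
      refine ⟨c₂.eval _ (by simp [checkP_setsVar]) (by simp [checkP_setsArr]), ?_, ?_⟩
      · rw [tab_eval _ _ (by decide) (by decide) (by decide), ← k2]
        exact tab_eval _ _ (by decide) (by decide) (by decide)
      · refine (checkP_ans c₂ (by decide) r₂ t₂ (p := p ∧ ∀ q ∈ S,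
          Passes Q₁ Q₂ (E.map (QS.sub (m.arrs 42 q.1) (m.arrs 42 q.2)))) k3).congr rfl ?_
        have e : m'.arrs 42 = m.arrs 42 := congrArg Tab.arg k2
        rw [Set.forall_mem_insert, e]
        tauto)
  refine key.2.2.congr rfl ?_
  simp only [Set.mem_ofPred_eq, Prod.forall, and_imp]
  exact and_congr_right fun _ => ⟨fun k u hu v hv => k u v hu hv, fun k u v hu hv => k u hu v hv⟩

/-- Check the candidates that add a fresh atom for a new relation name. -/
def newP : Pg :=
  .forTo 11 2 (.ite (and (var 11) (and (get 10 (var 11))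
      (not (any 2 (eq (get 20 (bv 0)) (get 10 (var 11)))))))
    (.seq (.fill 2 40 (sel (lt (bv 0) (var 3)) (get 20 (bv 0))
        (sel (eq (bv 0) (var 3)) (get 10 (var 11)) (lit 0))))
      (.seq (.fill 2 41 (sel (lt (bv 0) (var 3)) (get 21 (bv 0)) (get 11 (var 11))))
        (.seq (.fill 3 52 (freshE 22)) (checkP nameCand)))) .skip)

theorem newP_isNew (h : Ctx H W Q₁ Q₂ m) (hH : 0 < H) : Tab.IsNew H W (m.tab nameTwo)
    ((eval (.seq (.fill 2 40 (sel (lt (bv 0) (var 3)) (get 20 (bv 0))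
        (sel (eq (bv 0) (var 3)) (get 10 (var 11)) (lit 0))))
      (.seq (.fill 2 41 (sel (lt (bv 0) (var 3)) (get 21 (bv 0)) (get 11 (var 11))))
        (.fill 3 52 (freshE 22)))) m).tab nameCand)
    (m.arrs 10 (m.vars 11)) (m.arrs 11 (m.vars 11)) := by
  have hw := h.width
  have hg := h.geo
  simp only [eval_seq]
  set e40 : Ex := sel (lt (bv 0) (var 3)) (get 20 (bv 0))
        (sel (eq (bv 0) (var 3)) (get 10 (var 11)) (lit 0)) with he40
  set e41 : Ex := sel (lt (bv 0) (var 3)) (get 21 (bv 0)) (get 11 (var 11)) with he41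
  set m₁ := (Pg.fill 2 40 e40).eval m with hm₁
  set m₂ := (Pg.fill 2 41 e41).eval m₁ with hm₂
  set m₃ := (Pg.fill 3 52 (freshE 22)).eval m₂ with hm₃
  have g₁ : Geo W m₁ := hg.of_eq rfl rfl rfl rfl
  have g₂ : Geo W m₂ := hg.of_eq rfl rfl rfl rfl
  have r : ∀ x < W, m₃.arrs 40 x = e40.val m [x] := fun x hx =>
    eval_fill_self (l := 2) (a := 40) (m := m) (by rw [hg.lim2]; exact hx)
  have a : ∀ x < W, m₃.arrs 41 x = e41.val m₁ [x] := fun x hx =>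
    eval_fill_self (l := 2) (a := 41) (e := e41) (m := m₁) (by rw [g₁.lim2]; exact hx)
  have g : ∀ p < W * W, m₃.arrs 52 p = (freshE 22).val m₂ [p] := fun p hp =>
    eval_fill_self (by rw [g₂.lim3]; exact hp)
  have lowc : ∀ x, (lt (bv 0) (var 3)).Holds m [x] ↔ x < H := fun x => by
    rw [holds_lt, ← h.half]
    rfl
  have lowc₁ : ∀ x, (lt (bv 0) (var 3)).Holds m₁ [x] ↔ x < H := lowc
  have eqc : ∀ x, (eq (bv 0) (var 3)).Holds m [x] ↔ x = H := fun x => by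
    rw [holds_eq, ← h.half]
    rfl
  refine ⟨fun x hx => ?_, ?_, fun x hx hx' => ?_, fun x hx => ?_, ?_, fun x hx c hc => ?_,
    fun c hc => ?_⟩
  · refine (r x (by omega)).trans ?_
    rw [he40, val_sel ((lowc x).2 hx)]
    rfl
  · refine (r H (by omega)).trans ?_
    rw [he40, val_sel_not (fun k => by have := (lowc H).1 k; omega), val_sel ((eqc H).2 rfl)]
    rfl
  · refine (r x hx).trans ?_
    rw [he40, val_sel_not (fun k => by have := (lowc x).1 k; omega),
      val_sel_not (fun k => by have := (eqc x).1 k; omega)]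
    rfl
  · refine (a x (by omega)).trans ?_
    rw [he41, val_sel ((lowc₁ x).2 hx)]
    rfl
  · refine (a H (by omega)).trans ?_
    rw [he41, val_sel_not (fun k => by have := (lowc₁ H).1 k; omega)]
    rfl
  · refine (g _ (mul_add_lt_mul (by omega) hc)).trans ?_
    rw [freshE_low g₂ h.half (by omega) 22 hx hc]
    rfl
  · refine (g _ (mul_add_lt_mul (by omega) hc)).trans ?_
    exact freshE_high g₂ h.half 22 le_rfl (by omega) hc

/-- The loop runs over the rows of `Q₁`; the guard skips the head, unused rows, and names that `Q₂`
already has. -/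
theorem newP_ans (h : Ctx H W Q₁ Q₂ m) {p : Prop} (hp : Ans m p) :
    Ans (newP.eval m) (p ∧ ∀ B ∈ Q₁.atoms, (∀ A ∈ Q₂.atoms, A.rel ≠ B.rel) →
      Passes Q₁ Q₂ (Q₂.addFresh B.rel fun j => H * W + j)) := by
  have hH : 0 < H := by have := h.width; have := h.geo.pos; omega
  let C : ℕ → Prop := fun i => 0 < i → ∀ B : RelAtom σ ℕ, (m.tab nameOne).RowIs W i B →
    (∀ A ∈ Q₂.atoms, A.rel ≠ B.rel) → Passes Q₁ Q₂ (Q₂.addFresh B.rel fun j => H * W + j)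
  rw [newP, eval_forTo, h.geo.lim2]
  have key := iter_induction (fun k m' => Ctx H W Q₁ Q₂ m' ∧ m'.tab nameOne = m.tab nameOne ∧
    Ans m' (p ∧ ∀ i < k, C i)) (n := W) (m := m) (f := fun k m' => (Pg.ite (and (var 11)
      (and (get 10 (var 11)) (not (any 2 (eq (get 20 (bv 0)) (get 10 (var 11)))))))
    (.seq (.fill 2 40 (sel (lt (bv 0) (var 3)) (get 20 (bv 0))
        (sel (eq (bv 0) (var 3)) (get 10 (var 11)) (lit 0))))
      (.seq (.fill 2 41 (sel (lt (bv 0) (var 3)) (get 21 (bv 0)) (get 11 (var 11))))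
        (.seq (.fill 3 52 (freshE 22)) (checkP nameCand)))) .skip).eval (m'.setVar 11 k))
    ⟨h, rfl, by simpa using hp⟩ (by
      rintro k hk m' ⟨k1, k2, k3⟩
      have k1' := k1.setVar (x := 11) (by decide) k
      set m₁ := m'.setVar 11 k with hm₁
      have v₁ : m₁.vars 11 = k := by simp [hm₁, Mem.setVar]
      have t₁ : m₁.tab nameOne = m.tab nameOne := k2
      have a₁ : Ans m₁ (p ∧ ∀ i < k, C i) := k3
      have hC : (p ∧ ∀ i < k + 1, C i) ↔ (p ∧ ∀ i < k, C i) ∧ C k := by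
        rw [Nat.forall_lt_succ_right]
        tauto
      have hc : (and (var 11) (and (get 10 (var 11))
          (not (any 2 (eq (get 20 (bv 0)) (get 10 (var 11))))))).Holds m₁ [] ↔
          k ≠ 0 ∧ (m₁.tab nameOne).rel k ≠ 0 ∧
            ¬ ∃ v < W, (m₁.tab nameTwo).rel v = (m₁.tab nameOne).rel k := by
        simp only [holds_and, holds_not, holds_any, holds_eq, k1'.geo.lim2]
        simp only [Holds, val, v₁, List.getD_cons_zero]
        rfl
      by_cases hcond : (and (var 11) (and (get 10 (var 11))
          (not (any 2 (eq (get 20 (bv 0)) (get 10 (var 11))))))).Holds m₁ []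
      · rw [eval_ite_pos hcond]
        obtain ⟨d1, d2, d3⟩ := hc.1 hcond
        obtain ⟨B, hB⟩ := k1'.rep1.live k (by omega) hk d2
        have hBm := k1'.rep1.mem (by omega) hk hB
        have isn := newP_isNew k1' hH
        rw [v₁, show m₁.arrs 10 k = _ from hB.rel, show m₁.arrs 11 k = _ from hB.ar] at isn
        have hnew := k1'.rep2.new k1'.width k1'.low2 (k1'.rep1.arity_le hBm) isn
        have htwo := isn.twoRows k1'.width k1'.two2 fun i hi e =>
          d3 ⟨i, hi, e.trans hB.rel.symm⟩
        simp only [eval_seq] at hnew htwo ⊢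
        set m₂ := (Pg.fill 3 52 (freshE 22)).eval ((Pg.fill 2 41 (sel (lt (bv 0) (var 3))
          (get 21 (bv 0)) (get 11 (var 11)))).eval ((Pg.fill 2 40 (sel (lt (bv 0) (var 3))
            (get 20 (bv 0)) (sel (eq (bv 0) (var 3)) (get 10 (var 11)) (lit 0)))).eval m₁))
          with hm₂
        have c₂ : Ctx H W Q₁ Q₂ m₂ := k1'.of_eq rfl rfl (by
          simp only [List.mem_cons, List.not_mem_nil, or_false, forall_eq_or_imp, forall_eq]
          exact ⟨rfl, rfl, rfl, rfl, rfl, rfl, rfl, rfl, rfl⟩)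
        refine ⟨c₂.eval _ (by simp [checkP_setsVar]) (by simp [checkP_setsArr]), ?_, ?_⟩
        · rw [tab_eval _ _ (by decide) (by decide) (by decide), ← t₁]
          rfl
        · refine (checkP_ans c₂ (by decide) hnew htwo (p := p ∧ ∀ i < k, C i) a₁).congr rfl ?_
          rw [hC]
          refine and_congr_right fun _ => ⟨fun hp _ B' hB' _ => ?_, fun hp => ?_⟩
          · rw [← t₁] at hB'
            obtain rfl := hB.unique hB'
            exact hp
          · refine hp (by omega) B (by rw [← t₁]; exact hB) fun A hA e => d3 ?_
            obtain ⟨i, -, iW, hi⟩ := (k1'.rep2.atoms A).1 hA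
            exact ⟨i, iW, by rw [hi.rel, hB.rel, e]⟩
      · rw [eval_ite_neg hcond]
        refine ⟨k1', t₁, a₁.congr rfl ?_⟩
        rw [hC]
        refine ⟨fun h => ⟨h, fun k0 B hB hA => ?_⟩, fun h => h.1⟩
        rw [← t₁] at hB
        refine absurd (hc.2 ⟨by omega, by rw [hB.rel]; omega, ?_⟩) hcond
        rintro ⟨v, hv, e⟩
        have v0 : 0 < v := by
          rw [Nat.pos_iff_ne_zero]
          rintro rfl
          rw [k1'.rep2.rel0, hB.rel] at e
          omega
        rw [hB.rel] at e
        obtain ⟨A, hA'⟩ := k1'.rep2.live v v0 hv (by omega)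
        have := hA'.rel
        exact hA A (k1'.rep2.mem v0 hv hA') (Fin.ext (by omega)))
  refine key.2.2.congr rfl (and_congr_right fun _ => ⟨fun hk B hB hA => ?_, fun hk i hi i0 B hB => ?_⟩)
  · obtain ⟨i, i0, iW, hi⟩ := (h.rep1.atoms B).1 hB
    exact hk i iW i0 B hi hA
  · exact hk B (h.rep1.mem i0 hi hB)

/-- The decision procedure, for queries in tables. -/
def mainP : Pg :=
  .seq (.assign 0 (lit 1)) (.seq (homP nameTwo nameOne 8)
    (.seq (.ite (var 8) .skip (.assign 0 (lit 0))) (.seq (homP nameOne nameTwo 8)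
      (.seq (.ite (var 8) (.assign 0 (lit 0)) .skip)
        (.seq foldP (.seq extP (.seq candP newP)))))))

/-- Folding and extending need no map between the two queries, so these phases run even after the
answer has become `0`. The accumulated conjunction is what `maxContained_of_passes` asks for, and
`MaxContained.passes` gives the converse. -/
theorem mainP_ans (C : Type*) [Infinite C] {R₁ R₂ : CQ σ α} (t₂ : R₂.IsTwoCQ)
    (h : Ctx H W R₁.toQS R₂.toQS m) :
    Ans (mainP.eval m) (CQ.MaxContained C R₁ R₂) := by
  simp only [mainP, eval_seq]
  set m₁ := (Pg.assign 0 (lit 1)).eval m with hm₁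
  set m₂ := (homP nameTwo nameOne 8).eval m₁ with hm₂
  set m₃ := (Pg.ite (var 8) .skip (.assign 0 (lit 0))).eval m₂ with hm₃
  set m₄ := (homP nameOne nameTwo 8).eval m₃ with hm₄
  set m₅ := (Pg.ite (var 8) (.assign 0 (lit 0)) .skip).eval m₄ with hm₅
  have c₁ : Ctx H W R₁.toQS R₂.toQS m₁ := h.eval _ (by decide) (by decide)
  have c₂ : Ctx H W R₁.toQS R₂.toQS m₂ := c₁.homP _ _ (by decide)
  have c₃ : Ctx H W R₁.toQS R₂.toQS m₃ := c₂.eval _ (by decide) (by decide)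
  have c₄ : Ctx H W R₁.toQS R₂.toQS m₄ := c₃.homP _ _ (by decide)
  have c₅ : Ctx H W R₁.toQS R₂.toQS m₅ := c₄.eval _ (by decide) (by decide)
  have v₂ : m₂.vars 0 = 1 := homP_vars (by decide) (by decide) (by decide)
  have e₂ : (var 8).Holds m₂ [] ↔ R₂.toQS.Hom R₁.toQS :=
    homP_iff c₁.geo (by decide) c₁.rep2 c₁.rep1 c₁.two1
  have a₃ : Ans m₃ (R₂.toQS.Hom R₁.toQS) := by
    by_cases hh : R₂.toQS.Hom R₁.toQS
    · rw [hm₃, eval_ite_pos (e₂.2 hh)]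
      exact ⟨fun _ => v₂, fun k => absurd hh k⟩
    · rw [hm₃, eval_ite_neg fun k => hh (e₂.1 k)]
      exact ⟨fun k => absurd k hh, fun _ => rfl⟩
  have e₄ : (var 8).Holds m₄ [] ↔ R₁.toQS.Hom R₂.toQS :=
    homP_iff c₃.geo (by decide) c₃.rep1 c₃.rep2 c₃.two2
  have v₄ : m₄.vars 0 = m₃.vars 0 := homP_vars (by decide) (by decide) (by decide)
  have a₅ : Ans m₅ (R₂.toQS.Hom R₁.toQS ∧ ¬ R₁.toQS.Hom R₂.toQS) := by
    by_cases hh : R₁.toQS.Hom R₂.toQS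
    · rw [hm₅, eval_ite_pos (e₄.2 hh)]
      exact ⟨fun k => absurd hh k.2, fun _ => rfl⟩
    · rw [hm₅, eval_ite_neg fun k => hh (e₄.1 k)]
      exact a₃.congr v₄ (by simp [hh])
  obtain ⟨P, hP, hF⟩ := foldP_spec c₅ t₂.good.safe
  set m₆ := foldP.eval m₅ with hm₆
  have c₆ : Ctx H W R₁.toQS R₂.toQS m₆ := c₅.eval _ (by simp [foldP_setsVar]) (by
    simp [foldP_setsArr])
  have l₆ : (m₆.tab nameFold).Low H W := c₆.low2
  have w₆ : (m₆.tab nameFold).TwoRows W := c₆.two2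
  have ex := extP_spec c₆
  obtain ⟨φ, hφ, hE⟩ := hP.ext c₆.width l₆ ex
  have hE2 := hP.ext_twoRows c₆.width ex w₆
  set m₇ := extP.eval m₆ with hm₇
  have c₇ : Ctx H W R₁.toQS R₂.toQS m₇ := c₆.eval _ (by simp [extP, setsVar]) (by
    simp [extP, setsArr])
  have a₇ : Ans m₇ (R₂.toQS.Hom R₁.toQS ∧ ¬ R₁.toQS.Hom R₂.toQS) := by
    refine a₅.congr ?_ Iff.rfl
    rw [hm₇, eval_vars _ _ (by simp [extP, setsVar]), hm₆, eval_vars _ _ (by simp [foldP_setsVar])]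
  have a₈ := candP_ans c₇ hE hE2 a₇
  have c₈ : Ctx H W R₁.toQS R₂.toQS (candP.eval m₇) := c₇.eval _
    (by simp [candP, setsVar, checkP_setsVar]) (by simp [candP, setsArr, checkP_setsArr])
  refine (newP_ans c₈ a₈).congr rfl ?_
  have hne : R₂.toQS.atoms.Nonempty := t₂.good.ne
  constructor
  · rintro ⟨⟨⟨h1, h2⟩, h3⟩, h4⟩
    refine CQ.maxContained_of_passes h1 h2 hF hφ ?_ fun B hB hA => ⟨_, ?_, h4 B hB hA⟩
    · intro u hu v hv
      obtain ⟨p, hp, rfl⟩ := hE.exists_cell hu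
      obtain ⟨q, hq, rfl⟩ := hE.exists_cell hv
      exact h3 p hp q hq
    · intro i _ j _ e
      simpa using e
  · intro hM
    refine ⟨⟨⟨(CQ.contained_iff C _ _).1 hM.1, fun k => hM.2.1 ((CQ.contained_iff C _ _).2 k)⟩,
      fun u hu v hv => ?_⟩, fun B hB hA => ?_⟩
    · have hh := hF.forth.trans ((hom_ext P φ).trans (hom_map (QS.sub (m₇.arrs 42 u)
        (m₇.arrs 42 v)) _))
      exact hM.passes ((hE.good hE2 (hF.safe.ext φ) ((hF.forth.trans (hom_ext P φ)).nonempty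
        hne)).map _) hh
    · exact hM.passes (t₂.good.addFresh hA _) (hom_addFresh _ _ _)

end Pg

/-! ### Reading the input -/

/-- The numbers in `arr` from position `p` on list the atoms in `l`. -/
def AtomsAt {σ : Schema} (arr : ℕ → ℕ) : ℕ → List (RelAtom σ ℕ) → Prop
  | _, [] => True
  | p, A :: l => arr p = A.rel ∧ arr (p + 1) = σ.arity A.rel ∧
      (∀ c < σ.arity A.rel, arr (p + 2 + c) = A.argN c) ∧ AtomsAt arr (p + 2 + σ.arity A.rel) l

/-- The number of entries that encode the atoms in `l`. -/
def atomsLen {σ : Schema} (l : List (RelAtom σ ℕ)) : ℕ := (l.map fun A => 2 + σ.arity A.rel).sum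

/-- The numbers in `arr` from position `p` on encode `Q`. -/
structure QueryAt {σ : Schema} {α : ℕ} (arr : ℕ → ℕ) (p : ℕ) (Q : CQ σ α) : Prop where
  arity : arr p = α
  len : arr (p + 1) = Q.body.length
  head : ∀ c : Fin α, arr (p + 2 + c) = Q.head c
  atoms : AtomsAt arr (p + 2 + α) Q.body

section

variable {σ : Schema} {α : ℕ}

theorem getD_append_length_add (pre l : List ℕ) (i : ℕ) :
    (pre ++ l).getD (pre.length + i) 0 = l.getD i 0 := by
  rw [List.getD_append_right _ _ _ _ (Nat.le_add_right _ _), Nat.add_sub_cancel_left]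

theorem getD_ofFn_append {n : ℕ} (f : Fin n → ℕ) (l : List ℕ) (c : Fin n) :
    (List.ofFn f ++ l).getD c 0 = f c := by
  rw [List.getD_append _ _ _ _ (by simp)]
  simp [List.getD]

theorem atomsAt_append (l : List (RelAtom σ ℕ)) (pre post : List ℕ) :
    AtomsAt (fun i => (pre ++ ((l.map fun A => [A.rel.val, σ.arity A.rel] ++
      List.ofFn A.args).flatten ++ post)).getD i 0) pre.length l := by
  induction l generalizing pre with
  | nil => trivial
  | cons A l ih =>
    simp only [List.map_cons, List.flatten_cons, List.append_assoc]
    refine ⟨getD_append_length_add pre _ 0, getD_append_length_add pre _ 1, fun c hc => ?_, ?_⟩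
    · rw [Nat.add_assoc]
      refine (getD_append_length_add pre _ (2 + c)).trans ?_
      rw [RelAtom.argN, dif_pos hc, Nat.add_comm]
      exact getD_ofFn_append A.args _ ⟨c, hc⟩
    · have := ih (pre ++ ([A.rel.val, σ.arity A.rel] ++ List.ofFn A.args))
      have e : (pre ++ ([A.rel.val, σ.arity A.rel] ++ List.ofFn A.args)).length =
          pre.length + 2 + σ.arity A.rel := by
        simp only [List.length_append, List.length_cons, List.length_nil, List.length_ofFn]
        omega
      rw [e] at this
      simpa only [List.append_assoc] using this

/-- The text before and after is arbitrary because the second query is read behind the first. -/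
theorem queryAt_append (Q : CQ σ α) (pre post : List ℕ) :
    QueryAt (fun i => (pre ++ (Q.encode ++ post)).getD i 0) pre.length Q where
  arity := getD_append_length_add pre (Q.encode ++ post) 0
  len := getD_append_length_add pre (Q.encode ++ post) 1
  head := fun c => by
    rw [Nat.add_assoc]
    refine (getD_append_length_add pre _ (2 + c)).trans ?_
    rw [Nat.add_comm, CQ.encode, List.append_assoc, List.append_assoc]
    exact getD_ofFn_append Q.head _ c
  atoms := by
    have := atomsAt_append Q.body (pre ++ ([α, Q.body.length] ++ List.ofFn Q.head)) post
    have e : (pre ++ ([α, Q.body.length] ++ List.ofFn Q.head)).length = pre.length + 2 + α := by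
      simp only [List.length_append, List.length_cons, List.length_nil, List.length_ofFn]
      omega
    rw [e] at this
    simpa only [CQ.encode, List.append_assoc] using this

theorem encode_length (Q : CQ σ α) : Q.encode.length = 2 + α + atomsLen Q.body := by
  simp only [CQ.encode, atomsLen, List.length_append, List.length_cons, List.length_nil,
    List.length_ofFn, List.length_flatten, List.map_map]
  congr 2
  refine List.map_congr_left fun A _ => ?_
  simp only [Function.comp_apply, List.length_append, List.length_cons, List.length_nil,
    List.length_ofFn]

theorem AtomsAt.get {arr : ℕ → ℕ} {l : List (RelAtom σ ℕ)} {p : ℕ} (h : AtomsAt arr p l) {j : ℕ}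
    (hj : j < l.length) : arr (p + atomsLen (l.take j)) = l[j].rel ∧
      arr (p + atomsLen (l.take j) + 1) = σ.arity l[j].rel ∧
      ∀ c < σ.arity l[j].rel, arr (p + atomsLen (l.take j) + 2 + c) = l[j].argN c := by
  induction l generalizing p j with
  | nil => simp at hj
  | cons A l ih =>
    cases j with
    | zero => exact ⟨h.1, h.2.1, h.2.2.1⟩
    | succ j =>
      have e : p + atomsLen ((A :: l).take (j + 1)) =
          p + 2 + σ.arity A.rel + atomsLen (l.take j) := by
        simp only [atomsLen, List.take_succ_cons, List.map_cons, List.sum_cons]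
        omega
      rw [e]
      exact ih h.2.2.2 (j := j) (by simpa using hj)

theorem atomsLen_take_succ {l : List (RelAtom σ ℕ)} {j : ℕ} (hj : j < l.length) :
    atomsLen (l.take (j + 1)) = atomsLen (l.take j) + (2 + σ.arity l[j].rel) := by
  rw [atomsLen, List.take_add_one, List.getElem?_eq_getElem hj]
  simp only [Option.toList_some, List.map_append, List.sum_append, List.map_cons, List.map_nil,
    List.sum_cons, List.sum_nil, atomsLen, Nat.add_zero]

theorem arity_le_atomsLen {l : List (RelAtom σ ℕ)} {A : RelAtom σ ℕ} (hA : A ∈ l) :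
    σ.arity A.rel ≤ atomsLen l := by
  have := List.single_le_sum (l := l.map fun A => 2 + σ.arity A.rel) (by simp) _
    (List.mem_map.2 ⟨A, hA, rfl⟩)
  rw [atomsLen]
  omega

theorem two_mul_length_le_atomsLen (l : List (RelAtom σ ℕ)) : 2 * l.length ≤ atomsLen l := by
  induction l with
  | nil => simp
  | cons A l ih =>
    simp only [atomsLen, List.map_cons, List.sum_cons, List.length_cons] at ih ⊢
    omega

theorem encode_length_le (Q : CQ σ α) : Q.encode.length ≤ 2 * Q.size + 2 := by
  have key : ∀ l : List (RelAtom σ ℕ),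
      atomsLen l = 2 * l.length + (l.map fun A => σ.arity A.rel).sum := by
    intro l
    induction l with
    | nil => rfl
    | cons A l ih =>
      simp only [atomsLen, List.map_cons, List.sum_cons, List.length_cons] at ih ⊢
      omega
  rw [encode_length, key, CQ.size]
  omega

/-- Passing each of the three positions lowers the count in the remaining suffix by one. -/
theorem three_le_count {β : Type*} [BEq β] [LawfulBEq β] {l : List β} {a : β} {i j k : ℕ}
    (hij : i < j) (hjk : j < k) (hk : k < l.length) (hi : l[i] = a) (hj : l[j] = a)
    (hk' : l[k] = a) : 3 ≤ l.count a := by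
  have step : ∀ n (hn : n < l.length), l[n] = a →
      (l.drop n).count a = (l.drop (n + 1)).count a + 1 := by
    intro n hn e
    rw [List.drop_eq_getElem_cons hn, e, List.count_cons_self]
  have anti : ∀ n n', n ≤ n' → (l.drop n').count a ≤ (l.drop n).count a := fun n n' h =>
    (List.drop_sublist_drop_left l h).count_le a
  have h1 := step i (by omega) hi
  have h2 := step j (by omega) hj
  have h3 := step k hk hk'
  have h4 := anti (i + 1) j hij
  have h5 := anti (j + 1) k hjk
  have h6 := anti 0 i (Nat.zero_le i)
  rw [List.drop_zero] at h6
  omega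

end

/-- The rows of the arrays `R`, `A`, `O` describe the query `Q` that is encoded at position `p`. -/
structure RowsOf {σ : Schema} {α : ℕ} (R A O : ℕ → ℕ) (p : ℕ) (Q : CQ σ α) : Prop where
  rel0 : R 0 = 1
  ar0 : A 0 = α
  off0 : O 0 = p
  rel : ∀ j (h : j < Q.body.length), R (j + 1) = Q.body[j].rel + 2
  ar : ∀ j (h : j < Q.body.length), A (j + 1) = σ.arity Q.body[j].rel
  off : ∀ j < Q.body.length, O (j + 1) = p + 2 + α + atomsLen (Q.body.take j)
  free : ∀ i, Q.body.length < i → R i = 0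

/-! ### From parsed rows to tables -/

namespace RowsOf

variable {σ : Schema} {α : ℕ} {R A O arr : ℕ → ℕ} {p W H : ℕ} {Q : CQ σ α}

/-- The number of rows and all arities are bounded by the length of the code, so they fit into width
`W`. Head and atoms alike have their arguments two entries after their start, so one formula serves
all rows. -/
theorem rep (h : RowsOf R A O p Q) (hQ : QueryAt arr p Q) {T : Tab} (hW : Q.encode.length ≤ W)
    (hr : T.rel = R) (ha : T.ar = A)
    (hg : ∀ i < W, ∀ c < W, T.arg (i * W + c) = arr (O i + 2 + c)) : T.Rep W Q.toQS := by
  subst hr ha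
  rw [encode_length] at hW
  have hlen := two_mul_length_le_atomsLen Q.body
  have row : ∀ j (hj : j < Q.body.length), T.RowIs W (j + 1) Q.body[j] := by
    intro j hj
    have w := arity_le_atomsLen (List.getElem_mem hj)
    refine ⟨h.rel j hj, h.ar j hj, fun c hc => ?_⟩
    rw [hg _ (by omega) _ (by omega), h.off j hj]
    exact (hQ.atoms.get hj).2.2 c hc
  have inv : ∀ i, 0 < i → T.rel i ≠ 0 → ∃ j, ∃ _ : j < Q.body.length, i = j + 1 := by
    intro i i0 hi
    refine ⟨i - 1, ?_, by omega⟩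
    by_contra hc
    exact hi (h.free i (by omega))
  refine ⟨by omega, h.rel0, h.ar0, fun c => ?_, fun B => ?_, fun i i0 _ hi => ?_, fun i _ hi => ?_⟩
  · have := hg 0 (by omega) c (by omega)
    rw [zero_mul, zero_add, h.off0, hQ.head] at this
    exact this
  · constructor
    · intro hB
      obtain ⟨j, hj, rfl⟩ := List.mem_iff_getElem.1 (show B ∈ Q.body from hB)
      exact ⟨j + 1, by omega, by omega, row j hj⟩
    · rintro ⟨i, i0, iW, hi⟩
      obtain ⟨j, hj, rfl⟩ := inv i i0 (by rw [hi.rel]; omega)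
      rw [hi.unique (row j hj)]
      exact List.getElem_mem hj
  · obtain ⟨j, hj, rfl⟩ := inv i i0 hi
    exact ⟨_, row j hj⟩
  · rcases Nat.eq_zero_or_pos i with rfl | i0
    · rw [h.ar0]
      omega
    · obtain ⟨j, hj, rfl⟩ := inv i i0 hi
      rw [h.ar j hj]
      have w := arity_le_atomsLen (List.getElem_mem hj)
      omega

theorem twoRows (h : RowsOf R A O p Q) (h2 : Q.IsTwoCQ) {T : Tab} (hr : T.rel = R) :
    T.TwoRows W := by
  subst hr
  have inv : ∀ i, 0 < i → T.rel i ≠ 0 → ∃ j, ∃ _ : j < Q.body.length, i = j + 1 := by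
    intro i i0 hi
    refine ⟨i - 1, ?_, by omega⟩
    by_contra hc
    exact hi (h.free i (by omega))
  have sorted : ∀ i j k, i < j → j < k → T.rel i = T.rel j → T.rel i = T.rel k →
      T.rel i ≠ 0 → False := by
    intro i j k hij hjk e1 e2 h0
    obtain ⟨b, hb, rfl⟩ := inv j (by omega) (by omega)
    obtain ⟨c, hc, rfl⟩ := inv k (by omega) (by omega)
    rw [h.rel b hb] at e1
    rw [h.rel c hc] at e2
    rcases Nat.eq_zero_or_pos i with rfl | i0
    · rw [h.rel0] at e1
      omega
    obtain ⟨a, ha, rfl⟩ := inv i i0 h0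
    rw [h.rel a ha] at e1 e2
    have := three_le_count (l := Q.body.map RelAtom.rel) (a := Q.body[a].rel) (i := a) (j := b)
      (k := c) (by omega) (by omega) (by simpa using hc) (by simp)
      (by simp only [List.getElem_map]; exact Fin.ext (by omega))
      (by simp only [List.getElem_map]; exact Fin.ext (by omega))
    have h3 := h2 Q.body[a].rel
    omega
  intro i _ j _ k _ e1 e2 h0
  by_contra! hne
  obtain ⟨n1, n2, n3⟩ := hne
  -- Of the eight sign patterns six are orderings of the three rows and two are contradictory.
  rcases Nat.lt_or_gt_of_ne n1 with a | a <;> rcases Nat.lt_or_gt_of_ne n2 with b | b <;>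
    rcases Nat.lt_or_gt_of_ne n3 with c | c
  · exact sorted i j k a c e1 e2 h0
  · exact sorted i k j b c e2 e1 h0
  · omega
  · exact sorted k i j b a e2.symm (by omega) (by omega)
  · exact sorted j i k a b e1.symm (by omega) (by omega)
  · omega
  · exact sorted j k i c b (by omega) (by omega) (by omega)
  · exact sorted k j i c a (by omega) (by omega) (by omega)

/-- This keeps the upper half of the table free for the atoms to be added. -/
theorem low (h : RowsOf R A O p Q) {T : Tab} (hr : T.rel = R) (hH : Q.encode.length ≤ H) :
    T.Low H W := by
  intro i _ hi
  rw [hr]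
  rw [encode_length] at hH
  have hlen := two_mul_length_le_atomsLen Q.body
  exact h.free i (by omega)

end RowsOf

/-! ### Parsing the queries, and tables of arithmetic in base `W` -/

namespace Pg

open Ex

variable {σ : Schema} {α : ℕ} {m : Mem}

/-- Read the query at position `var 1`: store relation numbers, arities and positions of the rows
in the arrays `R`, `A` and `O`, and move `var 1` to its end. -/
def rowsP (R A O l : ℕ) : Pg :=
  .seq (.store O (lit 0) (var 1)) (.seq (.store R (lit 0) (lit 1))
    (.seq (.store A (lit 0) (get 0 (var 1)))
      (.seq (.assign 1 (add (add (var 1) (lit 2)) (get 0 (var 1))))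
        (.forTo 14 l (.seq (.store O (add (var 14) (lit 1)) (var 1))
          (.seq (.store R (add (var 14) (lit 1)) (add (get 0 (var 1)) (lit 2)))
            (.seq (.store A (add (var 14) (lit 1)) (get 0 (add (var 1) (lit 1))))
              (.assign 1 (add (add (var 1) (lit 2)) (get 0 (add (var 1) (lit 1))))))))))))

/-- Variable `1` is the reading position; after `k` atoms it is `atomsLen` of these atoms beyond the
head. The array `R` must be zero at the start so that rows after the last atom count as unused. -/
theorem rowsP_spec {R A O l : ℕ} (hRA : R ≠ A) (hRO : R ≠ O) (hAO : A ≠ O) (hR : R ≠ 0)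
    (hA : A ≠ 0) (hO : O ≠ 0) {Q : CQ σ α} (hQ : QueryAt (m.arrs 0) (m.vars 1) Q)
    (hl : m.lims l = Q.body.length) (hz : ∀ i, m.arrs R i = 0) :
    RowsOf (((rowsP R A O l).eval m).arrs R) (((rowsP R A O l).eval m).arrs A)
      (((rowsP R A O l).eval m).arrs O) (m.vars 1) Q ∧
      ((rowsP R A O l).eval m).vars 1 = m.vars 1 + Q.encode.length := by
  set p := m.vars 1 with hp
  have h0 : (0 : ℕ) ≠ R ∧ (0 : ℕ) ≠ A ∧ (0 : ℕ) ≠ O := ⟨hR.symm, hA.symm, hO.symm⟩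
  simp only [rowsP, eval_seq]
  set m₁ := (Pg.store O (lit 0) (var 1)).eval m with hm₁
  set m₂ := (Pg.store R (lit 0) (lit 1)).eval m₁ with hm₂
  set m₃ := (Pg.store A (lit 0) (get 0 (var 1))).eval m₂ with hm₃
  set m₄ := (Pg.assign 1 (add (add (var 1) (lit 2)) (get 0 (var 1)))).eval m₃ with hm₄
  have aR : m₄.arrs R = Function.update (m.arrs R) 0 1 := by
    simp [hm₁, hm₂, hm₃, hm₄, eval, Mem.setArr, Mem.setVar, val, hRA, hRO]
  have aA : m₄.arrs A = Function.update (m.arrs A) 0 α := by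
    have := hQ.arity
    simp [hm₁, hm₂, hm₃, hm₄, eval, Mem.setArr, Mem.setVar, val, hRA.symm, hAO, h0, ← hp, this]
  have aO : m₄.arrs O = Function.update (m.arrs O) 0 p := by
    simp [hm₁, hm₂, hm₃, hm₄, eval, Mem.setArr, Mem.setVar, val, hRO.symm, hAO.symm, ← hp]
  have a0 : m₄.arrs 0 = m.arrs 0 := by
    simp [hm₁, hm₂, hm₃, hm₄, eval, Mem.setArr, Mem.setVar, h0]
  have v₄ : m₄.vars 1 = p + 2 + α := by
    have := hQ.arity
    simp [hm₁, hm₂, hm₃, hm₄, eval, Mem.setArr, Mem.setVar, val, h0, ← hp, this]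
  rw [eval_forTo, show m₄.lims l = Q.body.length from hl]
  have key := iter_induction (n := Q.body.length) (m := m₄) (f := fun k m' => (Pg.seq
      (.store O (add (var 14) (lit 1)) (var 1))
          (.seq (.store R (add (var 14) (lit 1)) (add (get 0 (var 1)) (lit 2)))
            (.seq (.store A (add (var 14) (lit 1)) (get 0 (add (var 1) (lit 1))))
              (.assign 1 (add (add (var 1) (lit 2)) (get 0 (add (var 1) (lit 1)))))))).eval
      (m'.setVar 14 k))
    (fun k m' => m'.arrs 0 = m.arrs 0 ∧ m'.vars 1 = p + 2 + α + atomsLen (Q.body.take k) ∧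
      m'.arrs R 0 = 1 ∧ m'.arrs A 0 = α ∧ m'.arrs O 0 = p ∧
      (∀ j (h : j < Q.body.length), j < k → m'.arrs R (j + 1) = Q.body[j].rel + 2 ∧
        m'.arrs A (j + 1) = σ.arity Q.body[j].rel ∧
        m'.arrs O (j + 1) = p + 2 + α + atomsLen (Q.body.take j)) ∧
      ∀ i, k < i → m'.arrs R i = 0)
    ⟨a0, by rw [v₄]; simp [atomsLen], by rw [aR]; simp, by rw [aA]; simp, by rw [aO]; simp,
      fun j _ hj => by omega, fun i hi => by
        rw [aR, Function.update_of_ne (by omega), hz]⟩ (by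
      rintro k hk m' ⟨k1, k2, k3, k4, k5, k6, k7⟩
      obtain ⟨g1, g2, -⟩ := hQ.atoms.get hk
      rw [← k2, ← k1] at g1 g2
      simp only [eval_seq]
      set m₅ := m'.setVar 14 k with hm₅
      set m₆ := (Pg.store O (add (var 14) (lit 1)) (var 1)).eval m₅ with hm₆
      set m₇ := (Pg.store R (add (var 14) (lit 1)) (add (get 0 (var 1)) (lit 2))).eval m₆ with hm₇
      set m₈ := (Pg.store A (add (var 14) (lit 1)) (get 0 (add (var 1) (lit 1)))).eval m₇ with hm₈
      set m₉ := (Pg.assign 1 (add (add (var 1) (lit 2)) (get 0 (add (var 1) (lit 1))))).eval m₈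
        with hm₉
      have bR : m₉.arrs R = Function.update (m'.arrs R) (k + 1) (Q.body[k].rel + 2) := by
        simp [hm₅, hm₆, hm₇, hm₈, hm₉, eval, Mem.setArr, Mem.setVar, val, hRA, hRO, h0, g1]
      have bA : m₉.arrs A = Function.update (m'.arrs A) (k + 1) (σ.arity Q.body[k].rel) := by
        simp [hm₅, hm₆, hm₇, hm₈, hm₉, eval, Mem.setArr, Mem.setVar, val, hRA.symm, hAO, h0, g2]
      have bO : m₉.arrs O = Function.update (m'.arrs O) (k + 1) (m'.vars 1) := by
        simp [hm₅, hm₆, hm₇, hm₈, hm₉, eval, Mem.setArr, Mem.setVar, val, hRO.symm, hAO.symm]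
      have b0 : m₉.arrs 0 = m'.arrs 0 := by
        simp [hm₅, hm₆, hm₇, hm₈, hm₉, eval, Mem.setArr, Mem.setVar, h0]
      have b1 : m₉.vars 1 = m'.vars 1 + 2 + σ.arity Q.body[k].rel := by
        simp [hm₅, hm₆, hm₇, hm₈, hm₉, eval, Mem.setArr, Mem.setVar, val, h0, g2]
      refine ⟨b0.trans k1, ?_, ?_, ?_, ?_, fun j hj hjk => ?_, fun i hi => ?_⟩
      · rw [b1, atomsLen_take_succ hk, k2]
        omega
      · rw [bR, Function.update_of_ne (by omega), k3]
      · rw [bA, Function.update_of_ne (by omega), k4]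
      · rw [bO, Function.update_of_ne (by omega), k5]
      · rw [bR, bA, bO]
        by_cases e : j = k
        · subst e
          simp [k2]
        · rw [Function.update_of_ne (by omega), Function.update_of_ne (by omega),
            Function.update_of_ne (by omega)]
          exact k6 j hj (by omega)
      · rw [bR, Function.update_of_ne (by omega), k7 i (by omega)])
  obtain ⟨-, k2, k3, k4, k5, k6, k7⟩ := key
  refine ⟨⟨k3, k4, k5, fun j h => (k6 j h h).1, fun j h => (k6 j h h).2.1,
    fun j h => (k6 j h h).2.2, k7⟩, ?_⟩
  rw [k2, encode_length, List.take_length]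
  omega

/-- Set `var 16` to the product of the bounds `2` and `l`. -/
def powP (l : ℕ) : Pg :=
  .seq (.assign 16 (lit 0)) (.forTo 14 2 (.assign 16 (add (var 16) (lim l))))

/-- Repeated addition replaces multiplication, which the machine does not have. -/
theorem powP_spec (l : ℕ) : ((powP l).eval m).vars 16 = m.lims l * m.lims 2 := by
  rw [powP, eval_seq, eval_forTo]
  have key := iter_induction (fun k m' => m'.lims = m.lims ∧ m'.vars 16 = m.lims l * k)
    (n := m.lims 2) (m := (Pg.assign 16 (lit 0)).eval m)
    (f := fun k m' => (Pg.assign 16 (add (var 16) (lim l))).eval (m'.setVar 14 k))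
    ⟨rfl, by simp [eval, Mem.setVar, val]⟩ (by
      rintro k - m' ⟨k1, k2⟩
      refine ⟨k1, ?_⟩
      have : (m'.setVar 14 k).vars 16 = m.lims l * k := k2
      simp [eval, Mem.setVar, val, k2, k1, Nat.mul_add])
  exact key.2

/-- Compute quotients, remainders and multiples. -/
def geoP : Pg :=
  .seq (.assign 17 (lit 0)) (.forTo 14 4 (.seq (.store 3 (var 14) (var 17))
    (.forTo 18 2 (.seq (.store 1 (var 17) (var 14)) (.seq (.store 2 (var 17) (var 18))
      (.assign 17 (add (var 17) (lit 1))))))))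

/-- One counter runs through the numbers `x * W + y` in increasing order, so neither division nor
multiplication is needed. -/
theorem geoP_spec {W : ℕ} (hW : 0 < W) (h2 : m.lims 2 = W) (h3 : m.lims 3 = W * W)
    (h4 : m.lims 4 = W * W * W) (h5 : m.lims 5 = W * W * W * W) : Geo W (geoP.eval m) := by
  have hl := eval_lims geoP m
  suffices (∀ x < W * W * W, (geoP.eval m).arrs 3 x = x * W) ∧ ∀ q < W * W * W * W,
      (geoP.eval m).arrs 1 q = q / W ∧ (geoP.eval m).arrs 2 q = q % W by
    have dm : ∀ x y, y < W → (x * W + y) / W = x ∧ (x * W + y) % W = y := fun x y hy => by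
      rw [Nat.add_comm, Nat.add_mul_div_right _ _ hW, Nat.div_eq_of_lt hy,
        Nat.add_mul_mod_self_right, Nat.mod_eq_of_lt hy, Nat.zero_add]
      exact ⟨rfl, rfl⟩
    refine ⟨hW, by rw [hl, h2], by rw [hl, h3], by rw [hl, h5], fun x hx y hy => ?_,
      fun x hx y hy => ?_, this.1⟩
    · rw [(this.2 _ (mul_add_lt_mul hx hy)).1, (dm x y hy).1]
    · rw [(this.2 _ (mul_add_lt_mul hx hy)).2, (dm x y hy).2]
  rw [geoP, eval_seq, eval_forTo, show ((Pg.assign 17 (lit 0)).eval m).lims 4 = W * W * W from h4]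
  have key := iter_induction (n := W * W * W) (m := (Pg.assign 17 (lit 0)).eval m)
    (fun k m' => m'.lims 2 = W ∧ m'.vars 17 = k * W ∧ (∀ x < k, m'.arrs 3 x = x * W) ∧
      ∀ q < k * W, m'.arrs 1 q = q / W ∧ m'.arrs 2 q = q % W)
    (f := fun k m' => (Pg.seq (.store 3 (var 14) (var 17))
    (.forTo 18 2 (.seq (.store 1 (var 17) (var 14)) (.seq (.store 2 (var 17) (var 18))
      (.assign 17 (add (var 17) (lit 1))))))).eval (m'.setVar 14 k))
    ⟨h2, by simp [eval, Mem.setVar, val], by simp, by simp⟩ (by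
      rintro k - m' ⟨k1, k2, k3, k4⟩
      rw [eval_seq, eval_forTo]
      set m₁ := (Pg.store 3 (var 14) (var 17)).eval (m'.setVar 14 k) with hm₁
      rw [show m₁.lims 2 = W from k1]
      have key := iter_induction (n := W) (m := m₁)
        (fun v m' => m'.lims 2 = W ∧ m'.vars 14 = k ∧ m'.vars 17 = k * W + v ∧
          (∀ x < k + 1, m'.arrs 3 x = x * W) ∧
          ∀ q < k * W + v, m'.arrs 1 q = q / W ∧ m'.arrs 2 q = q % W)
        (f := fun v m' => (Pg.seq (.store 1 (var 17) (var 14)) (.seq (.store 2 (var 17) (var 18))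
          (.assign 17 (add (var 17) (lit 1))))).eval (m'.setVar 18 v))
        ⟨k1, by simp [hm₁, eval, Mem.setVar, Mem.setArr],
          by simpa [hm₁, eval, Mem.setVar, Mem.setArr] using k2, fun x hx => by
            have : m₁.arrs 3 = Function.update (m'.arrs 3) k (k * W) := by
              simp [hm₁, eval, Mem.setVar, Mem.setArr, val, k2]
            rw [this]
            by_cases e : x = k
            · rw [e, Function.update_self]
            · rw [Function.update_of_ne e, k3 x (by omega)], fun q hq => k4 q hq⟩ (by
          rintro v hv m₂ ⟨l1, l2, l3, l4, l5⟩
          set m₃ := (Pg.seq (.store 1 (var 17) (var 14)) (.seq (.store 2 (var 17) (var 18))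
            (.assign 17 (add (var 17) (lit 1))))).eval (m₂.setVar 18 v) with hm₃
          have a1 : m₃.arrs 1 = Function.update (m₂.arrs 1) (k * W + v) k := by
            simp [hm₃, eval, Mem.setVar, Mem.setArr, val, l2, l3]
          have a2 : m₃.arrs 2 = Function.update (m₂.arrs 2) (k * W + v) v := by
            simp [hm₃, eval, Mem.setVar, Mem.setArr, val, l3]
          have a3 : m₃.arrs 3 = m₂.arrs 3 := by
            simp [hm₃, eval, Mem.setVar, Mem.setArr]
          refine ⟨l1, by simpa [hm₃, eval, Mem.setVar, Mem.setArr] using l2, ?_, ?_, fun q hq => ?_⟩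
          · simp [hm₃, eval, Mem.setVar, Mem.setArr, val, l3, Nat.add_assoc]
          · rw [a3]
            exact l4
          · rw [a1, a2]
            by_cases e : q = k * W + v
            · rw [e, Function.update_self, Function.update_self, Nat.add_comm,
                Nat.add_mul_div_right _ _ hW, Nat.div_eq_of_lt hv, Nat.add_mul_mod_self_right,
                Nat.mod_eq_of_lt hv, Nat.zero_add]
              exact ⟨rfl, rfl⟩
            · rw [Function.update_of_ne e, Function.update_of_ne e]
              exact l5 q (by omega))
      obtain ⟨l1, -, l3, l4, l5⟩ := key
      have e : (k + 1) * W = k * W + W := by ring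
      rw [e]
      exact ⟨l1, l3, l4, l5⟩)
  exact ⟨key.2.2.1, key.2.2.2⟩

end Pg

/-! ### The program -/

namespace Pg

open Ex Polynomial

/-- The effect of a program whose variable `s.2.2` becomes the loop bound `s.2.1`. -/
noncomputable def next (m : Mem) (s : Pg × ℕ × ℕ) : Mem :=
  (s.1.eval m).setLim s.2.1 ((s.1.eval m).vars s.2.2)

/-- Run programs that set loop bounds, and then a last program. -/
def stages : List (Pg × ℕ × ℕ) → Pg → RamProg
  | [], q => comp 0 q
  | s :: r, q => .seq (comp 0 s.1) (.seq (.assign (3 * s.2.1 + 1) (.var (3 * s.2.2))) (stages r q))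

/-- A time bound for `stages`. -/
noncomputable def stagesTime : List (Pg × ℕ × ℕ) → Pg → Polynomial ℕ
  | [], q => q.time
  | s :: r, q => s.1.time + (2 + stagesTime r q)

/-- All loop bounds are at most `N` before and after each program. -/
def Bounded (N : ℕ) : List (Pg × ℕ × ℕ) → Mem → Prop
  | [], m => ∀ l, m.lims l ≤ N
  | s :: r, m => (∀ l, m.lims l ≤ N) ∧ Bounded N r (next m s)

/-- A for-program cannot change loop bounds, so they are set between stages; the time bounds then
add up as long as all bounds stay below `N`. -/
theorem stages_runs {N : ℕ} {q : Pg} (hq : q.ok = true) (l : List (Pg × ℕ × ℕ))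
    (hl : ∀ s ∈ l, s.1.ok = true) {m : Mem} {s : RamState} (hs : Sim m s) (hN : Bounded N l m) :
    ∃ t s', (stages l q).Runs s t s' ∧ t ≤ (stagesTime l q).eval N ∧
      Sim (q.eval (l.foldl next m)) s' := by
  induction l generalizing m s with
  | nil =>
    obtain ⟨t, s', h1, h2, h3, -⟩ := comp_runs q hN hq (r := 0) hs
    exact ⟨t, s', h1, h2, h3⟩
  | cons a l ih =>
    obtain ⟨t, s', h1, h2, h3, -⟩ := comp_runs a.1 hN.1 (hl a List.mem_cons_self) (r := 0) hs
    obtain ⟨t', s'', k1, k2, k3⟩ := ih (fun b hb => hl b (List.mem_cons_of_mem _ hb))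
      (h3.setLim a.2.1 ((a.1.eval m).vars a.2.2)) hN.2
    rw [← h3.vars] at k1
    refine ⟨_, s'', .seq h1 (.seq (.assign _ _ _) k1), ?_, k3⟩
    simp only [stagesTime, RamExpr.cost, Polynomial.eval_add, Polynomial.eval_ofNat]
    omega

/-- Compute the loop bounds and the rows of the tables. -/
def setup : List (Pg × ℕ × ℕ) :=
  [(.assign 13 (get 0 (lit 1)), 0, 13),
    (.seq (rowsP 10 11 13 0) (.assign 13 (get 0 (add (var 1) (lit 1)))), 1, 13),
    (.seq (rowsP 20 21 23 1) (.seq (.assign 3 (var 1)) (.assign 15 (add (var 1) (var 1)))), 2, 15),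
    (powP 2, 3, 16), (powP 3, 4, 16), (powP 4, 5, 16)]

/-- Fill the array `a` with the arguments of the rows at the positions in the array `o`. -/
def argP (a o : ℕ) : Pg := .fill 3 a (get 0 (add (add (get o (fst (bv 0))) (lit 2)) (snd (bv 0))))

/-- The program that runs after `setup`. -/
def decideP : Pg := .seq geoP (.seq (argP 12 13) (.seq (argP 22 23) mainP))

theorem decideP_ok : decideP.ok = true := by decide

theorem setup_ok : ∀ s ∈ setup, s.1.ok = true := by decide

variable {σ : Schema} {α : ℕ} {Q₁ Q₂ : CQ σ α}

/-- The memory after `setup`. -/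
structure SetupSpec (Q₁ Q₂ : CQ σ α) (m : Mem) : Prop where
  query1 : QueryAt (m.arrs 0) 0 Q₁
  query2 : QueryAt (m.arrs 0) Q₁.encode.length Q₂
  rows1 : RowsOf (m.arrs 10) (m.arrs 11) (m.arrs 13) 0 Q₁
  rows2 : RowsOf (m.arrs 20) (m.arrs 21) (m.arrs 23) Q₁.encode.length Q₂
  half : m.vars 3 = Q₁.encode.length + Q₂.encode.length

theorem SetupSpec.ans (C : Type*) [Infinite C] {m : Mem} (h : SetupSpec Q₁ Q₂ m)
    (t₁ : Q₁.IsTwoCQ) (t₂ : Q₂.IsTwoCQ) {W : ℕ} (hW : W = m.vars 3 + m.vars 3)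
    (h2 : m.lims 2 = W) (h3 : m.lims 3 = W * W)
    (h4 : m.lims 4 = W * W * W) (h5 : m.lims 5 = W * W * W * W) :
    Ans (decideP.eval m) (CQ.MaxContained C Q₁ Q₂) := by
  have e1 := encode_length Q₁
  have e2 := encode_length Q₂
  have hh := h.half
  have hW0 : 0 < W := by omega
  simp only [decideP, eval_seq]
  set m₁ := geoP.eval m with hm₁
  have g₁ : Geo W m₁ := geoP_spec hW0 h2 h3 h4 h5
  have a₁ : ∀ b ∉ [3, 1, 2], m₁.arrs b = m.arrs b := fun b hb => eval_arrs geoP m hb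
  set m₂ := (argP 12 13).eval m₁ with hm₂
  set m₃ := (argP 22 23).eval m₂ with hm₃
  have a₂ : ∀ b ≠ 12, m₂.arrs b = m₁.arrs b := fun b hb => eval_arrs (argP 12 13) m₁ (by
    simpa [argP, setsArr] using hb)
  have a₃ : ∀ b ≠ 22, m₃.arrs b = m₂.arrs b := fun b hb => eval_arrs (argP 22 23) m₂ (by
    simpa [argP, setsArr] using hb)
  have hlt : ∀ {x y : ℕ}, x < W → y < W → x * W + y < W * W := fun hx hy => mul_add_lt_mul hx hy
  have hle : ∀ {x : ℕ}, x < W → x < W * W * W := fun hx => by nlinarith [Nat.mul_pos hW0 hW0]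
  have args : ∀ {m' : Mem} {a o : ℕ}, Geo W m' → ∀ i < W, ∀ c < W,
      ((argP a o).eval m').arrs a (i * W + c) = m'.arrs 0 (m'.arrs o i + 2 + c) := by
    intro m' a o g i hi c hc
    rw [argP, eval_fill_self (by rw [g.lim3]; exact hlt hi hc)]
    simp only [val, fst, snd, List.getD_cons_zero, g.fst _ (hle hi) _ hc, g.snd _ (hle hi) _ hc]
  have g₂ : Geo W m₂ := g₁.of_eq rfl (a₂ 1 (by decide)) (a₂ 2 (by decide)) (a₂ 3 (by decide))
  have g₃ : Geo W m₃ := g₂.of_eq rfl (a₃ 1 (by decide)) (a₃ 2 (by decide)) (a₃ 3 (by decide))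
  have b₁ : ∀ b ∉ [3, 1, 2, 12, 22], m₃.arrs b = m.arrs b := fun b hb => by
    simp only [List.mem_cons, List.not_mem_nil, not_or] at hb
    rw [a₃ b (by omega), a₂ b (by omega), a₁ b (by simp; omega)]
  have arg1 : ∀ i < W, ∀ c < W, (m₃.tab nameOne).arg (i * W + c) =
      m.arrs 0 (m.arrs 13 i + 2 + c) := fun i hi c hc => by
    show m₃.arrs 12 _ = _
    rw [a₃ 12 (by decide), hm₂, args g₁ i hi c hc, a₁ 0 (by decide), a₁ 13 (by decide)]
  have arg2 : ∀ i < W, ∀ c < W, (m₃.tab nameTwo).arg (i * W + c) =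
      m.arrs 0 (m.arrs 23 i + 2 + c) := fun i hi c hc => by
    show m₃.arrs 22 _ = _
    rw [hm₃, args g₂ i hi c hc, a₂ 0 (by decide), a₂ 23 (by decide), a₁ 0 (by decide),
      a₁ 23 (by decide)]
  have v₃ : m₃.vars 3 = m.vars 3 := eval_vars geoP m (by decide)
  refine mainP_ans C t₂ (H := m.vars 3) (W := W) ⟨g₃, v₃, hW, ?_, ?_, ?_, ?_, ?_, ?_⟩
  · exact h.rows1.rep h.query1 (by omega) (b₁ 10 (by decide)) (b₁ 11 (by decide)) arg1
  · exact h.rows1.twoRows t₁ (b₁ 10 (by decide))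
  · exact h.rows1.low (b₁ 10 (by decide)) (by omega)
  · exact h.rows2.rep h.query2 (by omega) (b₁ 20 (by decide)) (b₁ 21 (by decide)) arg2
  · exact h.rows2.twoRows t₂ (b₁ 20 (by decide))
  · exact h.rows2.low (b₁ 20 (by decide)) (by omega)

/-- The initial memory. -/
def initMem (input : List ℕ) : Mem := ⟨fun _ => 0, fun _ => 0, (RamState.init input).arrs⟩

theorem initMem_sim (input : List ℕ) : Sim (initMem input) (RamState.init input) :=
  ⟨fun _ => rfl, fun _ => rfl, rfl⟩

theorem next_lims (m : Mem) (s : Pg × ℕ × ℕ) :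
    (next m s).lims = Function.update m.lims s.2.1 ((s.1.eval m).vars s.2.2) := by
  rw [next, Mem.setLim, eval_lims]

theorem next_le {m : Mem} {N : ℕ} {s : Pg × ℕ × ℕ} (h : ∀ l, m.lims l ≤ N) {v : ℕ}
    (hv : (next m s).lims s.2.1 = v) (hN : v ≤ N) (l : ℕ) : (next m s).lims l ≤ N := by
  by_cases e : l = s.2.1
  · rw [e, hv]
    exact hN
  · rw [next_lims, Function.update_of_ne e]
    exact h l

/-- The bounds are the two numbers of atoms and the first four powers of `W`, none of which exceeds
`W ^ 4`. -/
theorem setup_spec (Q₁ Q₂ : CQ σ α) {W N : ℕ}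
    (hW : W = (Q₁.encode.length + Q₂.encode.length) + (Q₁.encode.length + Q₂.encode.length))
    (hN : W ^ 4 ≤ N) {m : Mem} (hm : m = setup.foldl next (initMem (Q₁.encode ++ Q₂.encode))) :
    Bounded N setup (initMem (Q₁.encode ++ Q₂.encode)) ∧ SetupSpec Q₁ Q₂ m ∧ m.lims 2 = W ∧
      m.lims 3 = W * W ∧ m.lims 4 = W * W * W ∧ m.lims 5 = W * W * W * W := by
  set m₀ := initMem (Q₁.encode ++ Q₂.encode) with hm₀
  have e1 := encode_length Q₁
  have e2 := encode_length Q₂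
  have k1 := two_mul_length_le_atomsLen Q₁.body
  have k2 := two_mul_length_le_atomsLen Q₂.body
  have W1 : 1 ≤ W := by omega
  have p1 : W ≤ W * W := Nat.le_mul_of_pos_left _ W1
  have p2 : W * W ≤ W * W * W := Nat.le_mul_of_pos_right _ W1
  have p3 : W * W * W ≤ W * W * W * W := Nat.le_mul_of_pos_right _ W1
  have p4 : W ^ 4 = W * W * W * W := by ring
  have q1 : QueryAt (m₀.arrs 0) 0 Q₁ := queryAt_append Q₁ [] Q₂.encode
  have q2 : QueryAt (m₀.arrs 0) Q₁.encode.length Q₂ := by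
    have := queryAt_append Q₂ Q₁.encode []
    rwa [List.append_nil] at this
  have z : ∀ a ≠ 0, ∀ i, m₀.arrs a i = 0 := fun a ha i => if_neg ha
  simp only [setup, List.foldl_cons, List.foldl_nil] at hm
  simp only [setup, Bounded]
  set s₀ : Pg × ℕ × ℕ := (.assign 13 (get 0 (lit 1)), 0, 13) with hs₀
  set s₁ : Pg × ℕ × ℕ := (.seq (rowsP 10 11 13 0)
    (.assign 13 (get 0 (add (var 1) (lit 1)))), 1, 13) with hs₁
  set s₂ : Pg × ℕ × ℕ := (.seq (rowsP 20 21 23 1) (.seq (.assign 3 (var 1))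
    (.assign 15 (add (var 1) (var 1)))), 2, 15) with hs₂
  set s₃ : Pg × ℕ × ℕ := (powP 2, 3, 16) with hs₃
  set s₄ : Pg × ℕ × ℕ := (powP 3, 4, 16) with hs₄
  set s₅ : Pg × ℕ × ℕ := (powP 4, 5, 16) with hs₅
  set m₁ := next m₀ s₀ with hm₁
  set m₂ := next m₁ s₁ with hm₂
  set m₃ := next m₂ s₂ with hm₃
  set m₄ := next m₃ s₃ with hm₄
  set m₅ := next m₄ s₄ with hm₅
  have b₀ : ∀ l, m₀.lims l ≤ N := fun l => Nat.zero_le _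
  have l₁ : m₁.lims 0 = Q₁.body.length := by
    rw [← q1.len]
    rfl
  have b₁ := next_le (s := s₀) b₀ l₁ (by omega)
  have a₁ : m₁.arrs = m₀.arrs := rfl
  have v₁ : m₁.vars 1 = 0 := rfl
  set m₁' := (rowsP 10 11 13 0).eval m₁ with hm₁'
  obtain ⟨r1, w1⟩ := rowsP_spec (m := m₁) (R := 10) (A := 11) (O := 13) (l := 0) (Q := Q₁)
    (by decide) (by decide) (by decide) (by decide) (by decide) (by decide) q1 l₁
    (z 10 (by decide))
  rw [v₁] at r1 w1
  have a₁' : ∀ b ∉ [13, 10, 11, 13, 10, 11], m₁'.arrs b = m₀.arrs b := fun b hb =>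
    eval_arrs (rowsP 10 11 13 0) m₁ hb
  rw [← hm₁'] at r1 w1
  rw [zero_add] at w1
  have a₂ : m₂.arrs = m₁'.arrs := rfl
  have v₂ : m₂.vars 1 = Q₁.encode.length := w1
  have l₂ : m₂.lims 1 = Q₂.body.length := by
    rw [← q2.len, ← a₁' 0 (by decide), ← w1]
    rfl
  have b₂ := next_le (s := s₁) b₁ l₂ (by omega)
  set m₂' := (rowsP 20 21 23 1).eval m₂ with hm₂'
  have q2' : QueryAt (m₂.arrs 0) (m₂.vars 1) Q₂ := by
    rw [v₂, a₂, a₁' 0 (by decide)]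
    exact q2
  obtain ⟨r2, w2⟩ := rowsP_spec (m := m₂) (R := 20) (A := 21) (O := 23) (l := 1) (Q := Q₂)
    (by decide) (by decide) (by decide) (by decide) (by decide) (by decide) q2' l₂
    (by rw [a₂, a₁' 20 (by decide)]; exact z 20 (by decide))
  rw [v₂] at r2 w2
  have a₂' : ∀ b ∉ [23, 20, 21, 23, 20, 21], m₂'.arrs b = m₁'.arrs b := fun b hb =>
    eval_arrs (rowsP 20 21 23 1) m₂ hb
  rw [← hm₂'] at r2 w2
  have a₃ : m₃.arrs = m₂'.arrs := rfl
  have v₃ : m₃.vars 3 = Q₁.encode.length + Q₂.encode.length := w2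
  have l₃ : m₃.lims 2 = W := by
    rw [hW, ← w2]
    rfl
  have b₃ := next_le (s := s₂) b₂ l₃ (by omega)
  have l₄ : m₄.lims 3 = W * W := by
    rw [← l₃]
    exact (congrFun (next_lims m₃ s₃) 3).trans ((Function.update_self ..).trans (powP_spec 2))
  have l₄' : m₄.lims 2 = W := by
    rw [hm₄, next_lims, Function.update_of_ne (by decide), l₃]
  have b₄ := next_le (s := s₃) b₃ l₄ (by omega)
  have l₅ : m₅.lims 4 = W * W * W := by
    rw [← l₄]
    refine (congrFun (next_lims m₄ s₄) 4).trans ((Function.update_self ..).trans ?_)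
    rw [← l₄']
    exact powP_spec 3
  have l₅' : m₅.lims 2 = W ∧ m₅.lims 3 = W * W := by
    rw [hm₅, next_lims, Function.update_of_ne (by decide), Function.update_of_ne (by decide)]
    exact ⟨l₄', l₄⟩
  have b₅ := next_le (s := s₄) b₄ l₅ (by omega)
  have l₆ : m.lims 5 = W * W * W * W := by
    rw [← l₅, hm]
    refine (congrFun (next_lims m₅ s₅) 5).trans ((Function.update_self ..).trans ?_)
    rw [← l₅'.1]
    exact powP_spec 4
  have l₆' : m.lims 2 = W ∧ m.lims 3 = W * W ∧ m.lims 4 = W * W * W := by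
    rw [hm, next_lims, Function.update_of_ne (by decide), Function.update_of_ne (by decide),
      Function.update_of_ne (by decide)]
    exact ⟨l₅'.1, l₅'.2, l₅⟩
  have b₆ := next_le (s := s₅) b₅ (hm ▸ l₆) (by omega)
  -- The computation of the powers writes no array, so the parsed rows are still in place.
  have a₆ : m.arrs = m₂'.arrs := by
    have c : ∀ (m' : Mem) (l : ℕ) (k : ℕ), (next m' (powP l, k, 16)).arrs = m'.arrs :=
      fun m' l k => funext fun b => eval_arrs (powP l) m' (List.not_mem_nil)
    rw [hm, c, hm₅, c, hm₄, c, a₃]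
  have v₆ : m.vars 3 = m₃.vars 3 := by
    have c : ∀ (m' : Mem) (l : ℕ) (k : ℕ), (next m' (powP l, k, 16)).vars 3 = m'.vars 3 :=
      fun m' l k => eval_vars (powP l) m' (by simp [powP, setsVar])
    rw [hm, c, hm₅, c, hm₄, c]
  refine ⟨⟨b₀, b₁, b₂, b₃, b₄, b₅, b₆⟩, ⟨?_, ?_, ?_, ?_, ?_⟩, l₆'.1, l₆'.2.1, l₆'.2.2, l₆⟩
  · rw [a₆, a₂' 0 (by decide), a₁' 0 (by decide)]
    exact q1
  · rw [a₆, a₂' 0 (by decide), a₁' 0 (by decide)]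
    exact q2
  · rw [a₆, a₂' 10 (by decide), a₂' 11 (by decide), a₂' 13 (by decide)]
    exact r1
  · rw [a₆]
    exact r2
  · rw [v₆, v₃]

end Pg

theorem mainTheorem4 (C : Type*) [Infinite C] :
    ∃ (p : RamProg) (f : Polynomial ℕ), ∀ (σ : Schema) (α : ℕ) (Q₁ Q₂ : CQ σ α),
      Q₁.IsTwoCQ → Q₂.IsTwoCQ →
        p.AnswersWithin (Q₁.encode ++ Q₂.encode) (f.eval (Q₁.size + Q₂.size))
          (CQ.MaxContained C Q₁ Q₂) := by
  -- A code has at most twice the size plus `2` entries and `W` is twice the total length, whence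
  -- `W` is at most `4` times the total size plus `8`; the largest loop bound is `W ^ 4`.
  refine ⟨Pg.stages Pg.setup Pg.decideP, (Pg.stagesTime Pg.setup Pg.decideP).comp
    ((4 * Polynomial.X + 8) ^ 4), fun σ α Q₁ Q₂ t₁ t₂ => ?_⟩
  set W := (Q₁.encode.length + Q₂.encode.length) + (Q₁.encode.length + Q₂.encode.length) with hW
  have hN : W ^ 4 ≤ (4 * (Q₁.size + Q₂.size) + 8) ^ 4 := by
    refine Nat.pow_le_pow_left ?_ 4
    have h1 := encode_length_le Q₁
    have h2 := encode_length_le Q₂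
    omega
  obtain ⟨hb, hs, h2, h3, h4, h5⟩ := Pg.setup_spec Q₁ Q₂ hW hN rfl
  obtain ⟨t, s, k1, k2, k3⟩ := Pg.stages_runs Pg.decideP_ok Pg.setup Pg.setup_ok
    (Pg.initMem_sim _) hb
  obtain ⟨ans1, ans0⟩ := hs.ans C t₁ t₂ (by rw [hs.half, hW]) h2 h3 h4 h5
  refine ⟨t, s, k1, by simpa using k2, ?_, ?_⟩
  · rw [show s.vars 0 = _ from k3.vars 0]
    exact ans1
  · rw [show s.vars 0 = _ from k3.vars 0]
    exact ans0
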